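/- Let $\mathfrak g\supset\mathfrak b\supset\mathfrak h$ be a (finite-dimensional) semisimple complex Lie algebra, a Borel subalgebra and a Cartan subalgebra, let $\mathfrak n=[\mathfrak b,\mathfrak b]$, and let $\bar{\mathfrak b}$ be the Borel subalgebra opposite to $\mathfrak b$ with respect to $\mathfrak h$. Let $S=S(\mathfrak h)$ be the symmetric algebra of $\mathfrak h$, and let $T$ be a commutative unital ring with a ring homomorphism $\varphi:S\to T$; in particular $T$ is a $\mathbb C$-algebra. Consider $\mathfrak g$-$T$-bimodules on which the left and the right operation of $\mathbb C$ coincide. For such a bimodule $M$ and $\lambda\in\mathfrak h^*$, the deformed weight space is $$M^\lambda=\{m\in M\mid (H-\lambda(H))m=m\,\varphi(H)\ \text{ for all } H\in\mathfrak h\}.$$ The deformed category $\mathcal O(T)$ is the full subcategory of those bimodules which are locally finite under $\mathfrak n$ (every element lies in a finite-dimensional $\mathfrak n$-stable complex subspace) and which are the sum of their deformed weight spaces; it is an abelian category. For $\lambda\in\mathfrak h^*$ let $\mathbb C_\lambda\otimes T$ be the module $T$ on which $\mathfrak b$ (respectively $\bar{\mathfrak b}$) operates through its canonical surjection onto $\mathfrak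 h$, with $H\in\mathfrak h$ operating as multiplication by $\lambda(H)+\varphi(H)$. Put $$\Delta_T(\lambda)=U(\mathfrak g)\otimes_{U(\mathfrak b)}(\mathbb C_\lambda\otimes T),$$ and let $\nabla_T(\lambda)\subset\operatorname{Hom}_{U(\bar{\mathfrak b})}(U(\mathfrak g),\mathbb C_\lambda\otimes T)$ be the sum of all deformed weight spaces; here $\mathfrak g$ operates on the Hom-space by $(x\psi)(u)=\psi(ux)$, and $T$ operates on the values. Then $\Delta_T(\lambda)$ and $\nabla_T(\lambda)$ belong to $\mathcal O(T)$ for all $\lambda\in\mathfrak h^*$, and the following hold. 1. For every $\lambda\in\mathfrak h^*$ the canonical maps $T\to\Delta_T(\lambda)^\lambda$, $t\mapsto 1\otimes t$, and $\nabla_T(\lambda)^\lambda\to T$, $\psi\mapsto\psi(1)$, are isomorphisms of $T$-modules, and restriction to the deformed weight space of weight $\lambda$, together with these two identifications (and $\operatorname{End}_T(T)=T$), induces an isomorphism of $T$-modules $$\operatorname{Hom}_{\mathcal O(T)}(\Delta_T(\lambda),\nabla_T(\lambda))\xrightarrow{\ \sim\ }T.$$ 2. For $\lambda\neq\mu$ in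 $\mathfrak h^*$ one has $\operatorname{Hom}_{\mathcal O(T)}(\Delta_T(\lambda),\nabla_T(\mu))=0$. 3. For all $\lambda,\mu\in\mathfrak h^*$ one has $\operatorname{Ext}^1_{\mathcal O(T)}(\Delta_T(\lambda),\nabla_T(\mu))=0$. -/

import Mathlib

open CategoryTheory TensorProduct

universe u v

/-- A Borel subalgebra: a maximal solvable Lie subalgebra. -/
def LieSubalgebra.IsBorel {𝔤 : Type u} [LieRing 𝔤] [LieAlgebra ℂ 𝔤]
    (𝔟 : LieSubalgebra ℂ 𝔤) : Prop :=
  Maximal (fun 𝔰 : LieSubalgebra ℂ 𝔤 => LieAlgebra.IsSolvable 𝔰) 𝔟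

namespace DeformedO

section Bimodules

attribute [local instance 100] LieRing.ofAssociativeRing

variable (𝔤 : Type u) (T : Type v) [LieRing 𝔤] [LieAlgebra ℂ 𝔤] [CommRing T] [Algebra ℂ T]

/-- The algebra `T ⊗ U(𝔤)` over `ℂ`. As `T` is commutative, its left modules are the
`𝔤`-`T`-bimodules on which the two operations of `ℂ` coincide. -/
abbrev BimodAlg : Type (max u v) := T ⊗[ℂ] UniversalEnvelopingAlgebra ℂ 𝔤

/-- The category of `𝔤`-`T`-bimodules on which the two operations of `ℂ` coincide. -/
abbrev Bimod : Type (max u v + 1) := ModuleCat.{max u v} (BimodAlg 𝔤 T)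

variable {𝔤} in
/-- The element of `T ⊗ U(𝔤)` through which `x : 𝔤` operates on bimodules. -/
noncomputable def lieElt (x : 𝔤) : BimodAlg 𝔤 T := 1 ⊗ₜ UniversalEnvelopingAlgebra.ι ℂ x

variable {𝔤 T}

noncomputable instance (M : Bimod 𝔤 T) : Module T M := Module.restrictScalars T (BimodAlg 𝔤 T) M

instance (M : Bimod 𝔤 T) : IsScalarTower T (BimodAlg 𝔤 T) M :=
  IsScalarTower.restrictScalars T (BimodAlg 𝔤 T) M

instance (M : Bimod 𝔤 T) : SMulCommClass (BimodAlg 𝔤 T) T M := IsScalarTower.to_smulCommClass'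

/-- The spaces of bimodule homomorphisms are `T`-modules. -/
noncomputable instance : Linear T (Bimod 𝔤 T) where
  homModule _ _ := inferInstance

lemma bimodAlg_induction {p : BimodAlg 𝔤 T → Prop} (hT : ∀ t : T, p (algebraMap T _ t))
    (hx : ∀ x : 𝔤, p (lieElt T x)) (hadd : ∀ a b, p a → p b → p (a + b))
    (hmul : ∀ a b, p a → p b → p (a * b)) (a : BimodAlg 𝔤 T) : p a := by
  let S : Subalgebra T (BimodAlg 𝔤 T) :=
    { carrier := {a | p a}
      mul_mem' := fun h₁ h₂ => hmul _ _ h₁ h₂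
      add_mem' := fun h₁ h₂ => hadd _ _ h₁ h₂
      algebraMap_mem' := hT }
  let S' : Subalgebra ℂ (UniversalEnvelopingAlgebra ℂ 𝔤) :=
    (S.restrictScalars ℂ).comap Algebra.TensorProduct.includeRight
  have hS' : ∀ w, w ∈ S' := by
    intro w
    let f : 𝔤 →ₗ⁅ℂ⁆ S' :=
      { toFun := fun x => ⟨UniversalEnvelopingAlgebra.ι ℂ x, hx x⟩
        map_add' := fun x y => by ext; simp
        map_smul' := fun c x => by ext; simp
        map_lie' := fun {x y} => by
          ext; simp [LieRing.of_associative_ring_bracket] }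
    have h : S'.val.comp (UniversalEnvelopingAlgebra.lift ℂ f) = AlgHom.id ℂ _ := by
      apply UniversalEnvelopingAlgebra.hom_ext
      ext x
      simp [f]
    have := congrArg (fun g => g w) h
    simp only [AlgHom.comp_apply, AlgHom.id_apply] at this
    rw [← this]
    exact (UniversalEnvelopingAlgebra.lift ℂ f w).2
  change a ∈ S
  induction a using TensorProduct.induction_on with
  | zero => exact S.zero_mem
  | add a b ha hb => exact S.add_mem ha hb
  | tmul t w =>
    have h : (t ⊗ₜ[ℂ] w : BimodAlg 𝔤 T) = t • (1 ⊗ₜ[ℂ] w) := by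
      rw [TensorProduct.smul_tmul', smul_eq_mul, mul_one]
    rw [h]
    exact S.smul_mem (hS' w) t

end Bimodules

section Cartan

attribute [local instance 100] LieRing.ofAssociativeRing

variable {𝔤 : Type u} {T : Type v} [LieRing 𝔤] [LieAlgebra ℂ 𝔤] [CommRing T] [Algebra ℂ T]

/-- The nilpotent subalgebra `𝔫 = [𝔟, 𝔟]`, as a subspace of `𝔤`. -/
def nilrad (𝔟 : LieSubalgebra ℂ 𝔤) : Submodule ℂ 𝔤 :=
  (LieAlgebra.derivedSeries ℂ 𝔟 1).toSubmodule.map 𝔟.toSubmodule.subtype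

variable (𝔥 : LieSubalgebra ℂ 𝔤)

/-- The deformed weight space
`M^μ = {m | (H - μ(H)) m = m φ(H) for all H ∈ 𝔥}` of a bimodule. -/
noncomputable def weightSpace (φ : SymmetricAlgebra ℂ 𝔥 →ₐ[ℂ] T) (μ : Module.Dual ℂ 𝔥)
    (M : Bimod 𝔤 T) : Submodule T M where
  carrier := {m | ∀ H : 𝔥, (lieElt T (H : 𝔤) - algebraMap ℂ (BimodAlg 𝔤 T) (μ H)) • m =
    φ (SymmetricAlgebra.ι ℂ 𝔥 H) • m}
  add_mem' := fun h₁ h₂ H => by rw [smul_add, h₁ H, h₂ H, smul_add]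
  zero_mem' := fun H => by simp
  smul_mem' := fun t m h H => by rw [smul_comm, h H, smul_comm]

variable {𝔥}

/-- A bimodule homomorphism restricts to a `T`-linear map on deformed weight spaces. -/
noncomputable def restrictWeight (φ : SymmetricAlgebra ℂ 𝔥 →ₐ[ℂ] T) (μ : Module.Dual ℂ 𝔥)
    {M N : Bimod 𝔤 T} (f : M ⟶ N) : weightSpace 𝔥 φ μ M →ₗ[T] weightSpace 𝔥 φ μ N where
  toFun m := ⟨f.hom m, fun H => by
    rw [← map_smul, m.2 H, ← algebraMap_smul (BimodAlg 𝔤 T), map_smul, algebraMap_smul]⟩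
  map_add' m n := by ext; simp
  map_smul' t m := by
    ext
    change f.hom (t • (m : M)) = t • f.hom (m : M)
    rw [← algebraMap_smul (BimodAlg 𝔤 T), map_smul, algebraMap_smul]

variable (𝔤 T) in
/-- The operation of `U(𝔤)` on the space of `ℂ`-linear maps `U(𝔤) → T` by
`(w ψ)(z) = ψ(z w)`. -/
noncomputable def translation : UniversalEnvelopingAlgebra ℂ 𝔤 →ₐ[ℂ]
    Module.End ℂ (UniversalEnvelopingAlgebra ℂ 𝔤 →ₗ[ℂ] T) :=
  AlgHom.ofLinearMap
    { toFun := fun w => LinearMap.lcomp ℂ T (LinearMap.mulRight ℂ w)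
      map_add' := fun w w' => by ext ψ z; simp [mul_add]
      map_smul' := fun c w => by ext ψ z; simp }
    (by ext ψ z; simp) (fun w w' => by ext ψ z; simp [mul_assoc])

variable (𝔤 T) in
lemma commute_translation (t : T) (w : UniversalEnvelopingAlgebra ℂ 𝔤) :
    Commute (Algebra.lsmul ℂ ℂ (UniversalEnvelopingAlgebra ℂ 𝔤 →ₗ[ℂ] T) t)
      (translation 𝔤 T w) :=
  LinearMap.ext fun _ => LinearMap.ext fun _ => rfl

variable (𝔤 T) in
/-- The operation of `T ⊗ U(𝔤)` on the space of `ℂ`-linear maps `U(𝔤) → T` by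
`((t ⊗ w) ψ)(z) = t ψ(z w)`. -/
noncomputable def funAction :
    BimodAlg 𝔤 T →ₐ[ℂ] Module.End ℂ (UniversalEnvelopingAlgebra ℂ 𝔤 →ₗ[ℂ] T) :=
  Algebra.TensorProduct.lift (Algebra.lsmul ℂ ℂ (UniversalEnvelopingAlgebra ℂ 𝔤 →ₗ[ℂ] T))
    (translation 𝔤 T) (commute_translation 𝔤 T)

lemma funAction_tmul (t : T) (w : UniversalEnvelopingAlgebra ℂ 𝔤)
    (ψ : UniversalEnvelopingAlgebra ℂ 𝔤 →ₗ[ℂ] T) (z : UniversalEnvelopingAlgebra ℂ 𝔤) :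
    funAction 𝔤 T (t ⊗ₜ w) ψ z = t * ψ (z * w) := by
  rw [funAction, Algebra.TensorProduct.lift_tmul]
  rfl

variable (𝔤 T) in
/-- The bimodule of all `ℂ`-linear maps `U(𝔤) → T`. -/
def FunSpace : Type (max u v) := UniversalEnvelopingAlgebra ℂ 𝔤 →ₗ[ℂ] T

noncomputable instance : AddCommGroup (FunSpace 𝔤 T) :=
  inferInstanceAs (AddCommGroup (UniversalEnvelopingAlgebra ℂ 𝔤 →ₗ[ℂ] T))

noncomputable instance : Module (BimodAlg 𝔤 T) (FunSpace 𝔤 T) :=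
  Module.compHom (UniversalEnvelopingAlgebra ℂ 𝔤 →ₗ[ℂ] T) (funAction 𝔤 T).toRingHom

/-- The value of an element of `FunSpace` at a point of `U(𝔤)`. -/
def FunSpace.eval (ψ : FunSpace 𝔤 T) (z : UniversalEnvelopingAlgebra ℂ 𝔤) : T :=
  (show UniversalEnvelopingAlgebra ℂ 𝔤 →ₗ[ℂ] T from ψ) z

lemma FunSpace.eval_add (ψ ψ' : FunSpace 𝔤 T) (z : UniversalEnvelopingAlgebra ℂ 𝔤) :
    (ψ + ψ').eval z = ψ.eval z + ψ'.eval z := rfl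

lemma FunSpace.eval_zero (z : UniversalEnvelopingAlgebra ℂ 𝔤) :
    (0 : FunSpace 𝔤 T).eval z = 0 := rfl

lemma FunSpace.eval_tmul_smul (t : T) (w : UniversalEnvelopingAlgebra ℂ 𝔤)
    (ψ : FunSpace 𝔤 T) (z : UniversalEnvelopingAlgebra ℂ 𝔤) :
    ((t ⊗ₜ[ℂ] w : BimodAlg 𝔤 T) • ψ).eval z = t * ψ.eval (z * w) :=
  funAction_tmul t w ψ z

/-! ### The deformed category `𝒪` -/

section Category

attribute [local instance] ModuleCat.moduleOfAlgebraModule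
attribute [local instance] ModuleCat.isScalarTower_of_algebra_moduleCat

/-- Local finiteness under `𝔫`: every element lies in a finite-dimensional `ℂ`-subspace
that is stable under `𝔫`. -/
def IsLocallyFinite (𝔫 : Submodule ℂ 𝔤) (M : Bimod 𝔤 T) : Prop :=
  ∀ m : M, ∃ V : Submodule ℂ M, m ∈ V ∧ FiniteDimensional ℂ V ∧
    ∀ x ∈ 𝔫, ∀ w ∈ V, lieElt T x • w ∈ V

/-- The bimodules that belong to `𝒪(T)`: those which are locally finite under `𝔫 = [𝔟, 𝔟]` and
are the sum of their deformed weight spaces. -/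
def IsInO (𝔟 : LieSubalgebra ℂ 𝔤) (φ : SymmetricAlgebra ℂ 𝔥 →ₐ[ℂ] T) :
    ObjectProperty (Bimod 𝔤 T) :=
  fun M => IsLocallyFinite (nilrad 𝔟) M ∧ ⨆ μ, weightSpace 𝔥 φ μ M = ⊤

/-- The deformed category `𝒪(T)`, a full subcategory of the category of bimodules. -/
abbrev CatO (𝔟 : LieSubalgebra ℂ 𝔤) (φ : SymmetricAlgebra ℂ 𝔥 →ₐ[ℂ] T) : Type (max u v + 1) :=
  (IsInO 𝔟 φ).FullSubcategory

variable (𝔟 : LieSubalgebra ℂ 𝔤) (φ : SymmetricAlgebra ℂ 𝔥 →ₐ[ℂ] T)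


lemma weightSpace_component_mem {N : Bimod 𝔤 T} (K : Submodule (BimodAlg 𝔤 T) N)
    (s : Finset (Module.Dual ℂ 𝔥)) (n : Module.Dual ℂ 𝔥 → N)
    (hn : ∀ μ, n μ ∈ weightSpace 𝔥 φ μ N) (hK : ∑ μ ∈ s, n μ ∈ K) :
    ∀ μ ∈ s, n μ ∈ K := by
  classical
  induction s using Finset.strongInduction generalizing n with
  | H s ih =>
    intro μ hμ
    by_cases hs : ∃ ν ∈ s, ν ≠ μ
    · obtain ⟨ν, hν, hne⟩ := hs
      obtain ⟨H, hH⟩ : ∃ H, ν H ≠ μ H := by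
        by_contra hcon
        push Not at hcon
        exact hne (LinearMap.ext hcon)
      set a : BimodAlg 𝔤 T := lieElt T (H : 𝔤) - algebraMap ℂ _ (ν H) -
        algebraMap T _ (φ (SymmetricAlgebra.ι ℂ 𝔥 H)) with ha
      have hact : ∀ κ, a • n κ = (κ H - ν H) • n κ := by
        intro κ
        have h := hn κ H
        rw [sub_smul, sub_eq_iff_eq_add, algebraMap_smul] at h
        rw [ha, sub_smul, sub_smul, h, algebraMap_smul, algebraMap_smul, sub_smul]
        abel
      have hsum : ∑ κ ∈ s.erase ν, (κ H - ν H) • n κ ∈ K := by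
        have h := K.smul_mem a hK
        rw [Finset.smul_sum, ← Finset.add_sum_erase _ _ hν] at h
        simpa [hact] using h
      have h := ih (s.erase ν) (Finset.erase_ssubset hν) (fun κ => (κ H - ν H) • n κ)
        (fun κ H' => by
          have h := hn κ H'
          rw [smul_comm, h, ← algebraMap_smul (BimodAlg 𝔤 T), smul_comm,
            algebraMap_smul]) hsum μ
        (Finset.mem_erase.2 ⟨hne.symm, hμ⟩)
      have hc : μ H - ν H ≠ 0 := sub_ne_zero.2 hH.symm
      have h' := K.smul_of_tower_mem (μ H - ν H)⁻¹ h
      simpa [smul_smul, inv_mul_cancel₀ hc] using h'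
    · push Not at hs
      have : s = {μ} := Finset.eq_singleton_iff_unique_mem.2 ⟨hμ, hs⟩
      simpa [this] using hK

lemma map_mem_iSup_weightSpace {M N : Bimod 𝔤 T} (f : M ⟶ N) {m : M}
    (hm : m ∈ ⨆ μ, weightSpace 𝔥 φ μ M) : f.hom m ∈ ⨆ μ, weightSpace 𝔥 φ μ N := by
  induction hm using Submodule.iSup_induction' with
  | mem μ x hx => exact Submodule.mem_iSup_of_mem μ (restrictWeight φ μ f ⟨x, hx⟩).2
  | zero => simp
  | add x y _ _ hx hy => rw [map_add]; exact add_mem hx hy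

/-- The category `𝒪(T)` is stable under sub-bimodules. -/
instance : (IsInO 𝔟 φ).IsClosedUnderSubobjects where
  prop_of_mono {M N} f _ hN := by
    have hf : Function.Injective f.hom := (ModuleCat.mono_iff_injective f).1 inferInstance
    refine ⟨fun m => ?_, ?_⟩
    · obtain ⟨V, hm, hV, hst⟩ := hN.1 (f.hom m)
      refine ⟨V.comap (f.hom.restrictScalars ℂ), hm, ?_, fun x hx w hw => ?_⟩
      · exact Module.Finite.of_injective
          ((f.hom.restrictScalars ℂ).restrict (p := V.comap (f.hom.restrictScalars ℂ)) (q := V)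
            (fun _ h => h))
          (fun a b h => Subtype.ext (hf (congrArg Subtype.val h)))
      · change f.hom (lieElt T x • w) ∈ V
        rw [map_smul]
        exact hst x hx _ hw
    · refine eq_top_iff.2 fun m _ => ?_
      have hm : f.hom m ∈ ⨆ μ, weightSpace 𝔥 φ μ N := hN.2 ▸ Submodule.mem_top
      obtain ⟨n, hn, hsum⟩ := (Submodule.mem_iSup_iff_exists_finsupp _ _).1 hm
      have hmem := weightSpace_component_mem φ (LinearMap.range f.hom) n.support n hn
        ⟨m, hsum.symm⟩
      have hall : ∀ μ, ∃ k : M, f.hom k = n μ := by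
        intro μ
        by_cases hμ : μ ∈ n.support
        · exact hmem μ hμ
        · exact ⟨0, by simpa using (Finsupp.notMem_support_iff.1 hμ).symm⟩
      choose k hk using hall
      have hkm : m = ∑ μ ∈ n.support, k μ := by
        apply hf
        rw [map_sum, ← hsum]
        exact Finset.sum_congr rfl fun μ _ => (hk μ).symm
      rw [hkm]
      refine Submodule.sum_mem _ fun μ _ => Submodule.mem_iSup_of_mem μ fun H => hf ?_
      rw [map_smul, hk, hn μ H, ← hk, ← algebraMap_smul (BimodAlg 𝔤 T), ← map_smul,
        algebraMap_smul]

/-- The category `𝒪(T)` is stable under quotients. -/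
instance : (IsInO 𝔟 φ).IsClosedUnderQuotients where
  prop_of_epi {M N} f _ hM := by
    have hf : Function.Surjective f.hom := (ModuleCat.epi_iff_surjective f).1 inferInstance
    refine ⟨fun n => ?_, ?_⟩
    · obtain ⟨m, rfl⟩ := hf n
      obtain ⟨V, hm, hV, hst⟩ := hM.1 m
      refine ⟨V.map (f.hom.restrictScalars ℂ), ⟨m, hm, rfl⟩, inferInstance, ?_⟩
      rintro x hx _ ⟨w, hw, rfl⟩
      exact ⟨lieElt T x • w, hst x hx w hw, map_smul f.hom _ _⟩
    · refine eq_top_iff.2 fun n _ => ?_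
      obtain ⟨m, rfl⟩ := hf n
      exact map_mem_iSup_weightSpace φ f (hM.2 ▸ Submodule.mem_top)

instance : (IsInO 𝔟 φ).ContainsZero where
  exists_zero := by
    have h : Subsingleton (ModuleCat.of (BimodAlg 𝔤 T) PUnit.{max u v + 1}) :=
      inferInstanceAs (Subsingleton PUnit)
    refine ⟨ModuleCat.of _ PUnit.{max u v + 1}, ModuleCat.isZero_of_subsingleton _,
      fun m => ⟨⊥, ?_, inferInstance, ?_⟩, ?_⟩
    · exact (Submodule.mem_bot _).2 (Subsingleton.elim _ _)
    · intro x _ w _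
      exact (Submodule.mem_bot _).2 (Subsingleton.elim _ _)
    · exact Subsingleton.elim _ _

lemma isInO_pi {J : Type} [Finite J] (F : J → Bimod 𝔤 T) (hF : ∀ j, IsInO 𝔟 φ (F j)) :
    IsInO 𝔟 φ (ModuleCat.of (BimodAlg 𝔤 T) (∀ j, F j)) := by
  classical
  cases nonempty_fintype J
  let i : ∀ j, F j ⟶ ModuleCat.of (BimodAlg 𝔤 T) (∀ j, F j) := fun j =>
    ModuleCat.ofHom (LinearMap.single _ (fun j => F j) j)
  have hsum : ∀ m : ModuleCat.of (BimodAlg 𝔤 T) (∀ j, F j), ∑ j, (i j).hom (m j) = m := fun m =>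
    Finset.univ_sum_single m
  refine ⟨fun m => ?_, eq_top_iff.2 fun m _ => ?_⟩
  · choose V hm hV hst using fun j => (hF j).1 (m j)
    refine ⟨⨆ j, (V j).map ((i j).hom.restrictScalars ℂ), ?_, inferInstance, ?_⟩
    · rw [← hsum m]
      exact Submodule.sum_mem _ fun j _ => Submodule.mem_iSup_of_mem j ⟨m j, hm j, rfl⟩
    · intro x hx w hw
      induction hw using Submodule.iSup_induction' with
      | mem j y hy =>
        obtain ⟨w, hw, rfl⟩ := hy
        exact Submodule.mem_iSup_of_mem j
          ⟨lieElt T x • w, hst j x hx w hw, map_smul (i j).hom _ _⟩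
      | zero => rw [smul_zero]; exact zero_mem _
      | add y z _ _ hy hz => rw [smul_add]; exact add_mem hy hz
  · rw [← hsum m]
    exact Submodule.sum_mem _ fun j _ =>
      map_mem_iSup_weightSpace φ (i j) ((hF j).2 ▸ Submodule.mem_top)

instance : (IsInO 𝔟 φ).IsClosedUnderFiniteProducts where
  isClosedUnderLimitsOfShape J _ :=
    { limitsOfShape_le := by
        rintro X ⟨p⟩
        let g : X ⟶ ModuleCat.of (BimodAlg 𝔤 T) (∀ j : J, p.diag.obj ⟨j⟩) :=
          ModuleCat.ofHom (LinearMap.pi fun j => (p.π.app ⟨j⟩).hom)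
        have : Mono g := ⟨fun a b hab => p.isLimit.hom_ext fun ⟨j⟩ => by
          ext z
          exact congrFun (congrArg (fun q => q.hom z) hab) j⟩
        exact (IsInO 𝔟 φ).prop_of_mono g
          (isInO_pi 𝔟 φ _ fun j => p.prop_diag_obj ⟨j⟩) }

/-- The category `𝒪(T)` is abelian. -/
noncomputable instance : Abelian (CatO 𝔟 φ) := inferInstance

instance : HasExt.{max u v + 1} (CatO 𝔟 φ) := HasExt.standard _

end Category

/-! ### The Cartan projection, the opposite Borel subalgebra, sums of weight spaces -/

variable [FiniteDimensional ℂ 𝔤] [𝔥.IsCartanSubalgebra]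

variable (𝔥) in
lemma isCompl_rootSpaces :
    IsCompl 𝔥.toSubmodule (⨆ α ∈ {α : 𝔥 → ℂ | α ≠ 0}, (LieAlgebra.rootSpace 𝔥 α).toSubmodule) := by
  have h0 : 𝔥.toSubmodule = (LieAlgebra.rootSpace 𝔥 (0 : 𝔥 → ℂ)).toSubmodule := by
    rw [LieAlgebra.rootSpace_zero_eq, LieSubalgebra.coe_toLieSubmodule]
  rw [h0]
  constructor
  · have h := LieModule.iSupIndep_genWeightSpace ℂ 𝔥 𝔤
    rw [LieSubmodule.iSupIndep_toSubmodule.symm] at h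
    exact h.disjoint_biSup (by simp)
  · rw [codisjoint_iff, eq_top_iff, ← LieSubmodule.top_toSubmodule (R := ℂ) (L := 𝔥),
      ← LieModule.iSup_genWeightSpace_eq_top ℂ 𝔥 𝔤, LieSubmodule.iSup_toSubmodule]
    refine iSup_le fun α => ?_
    by_cases hα : α = 0
    · subst hα
      exact le_sup_left
    · exact le_trans (le_biSup (fun α : 𝔥 → ℂ => (LieAlgebra.rootSpace 𝔥 α).toSubmodule)
        (show α ∈ {α : 𝔥 → ℂ | α ≠ 0} from hα)) le_sup_right

variable (𝔥) in
/-- The projection `𝔤 → 𝔥` along the sum of the root spaces. On a Borel subalgebra that contains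
`𝔥` it is the canonical surjection onto `𝔥`, with kernel the derived algebra. -/
noncomputable def cartanProj : 𝔤 →ₗ[ℂ] 𝔥 :=
  Submodule.projectionOnto _ _ (isCompl_rootSpaces 𝔥)

variable (𝔥) in
/-- The Borel subalgebra opposite to `𝔟` with respect to `𝔥`: it is generated by the root
spaces `𝔤_{-α}` (including `𝔤_0 = 𝔥`) such that `𝔤_α` is contained in `𝔟`. -/
noncomputable def oppositeBorel (𝔟 : LieSubalgebra ℂ 𝔤) : LieSubalgebra ℂ 𝔤 :=
  LieSubalgebra.lieSpan ℂ 𝔤 (⋃ α ∈ {α : 𝔥 → ℂ | (LieAlgebra.rootSpace 𝔥 α).toSubmodule ≤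
    𝔟.toSubmodule}, (LieAlgebra.rootSpace 𝔥 (-α) : Set 𝔤))

/-- The operation of a Borel subalgebra containing `𝔥` on `ℂ_μ ⊗ T = T`: it factors over the
canonical surjection onto `𝔥`, and `H : 𝔥` operates as multiplication by `μ(H) + φ(H)`. -/
noncomputable def deformedChar (φ : SymmetricAlgebra ℂ 𝔥 →ₐ[ℂ] T) (μ : Module.Dual ℂ 𝔥) :
    𝔤 →ₗ[ℂ] T :=
  ((Algebra.linearMap ℂ T).comp μ + φ.toLinearMap.comp (SymmetricAlgebra.ι ℂ 𝔥)).comp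
    (cartanProj 𝔥)

variable [LieAlgebra.IsSemisimple ℂ 𝔤]

lemma lieElt_smul_mem_weightSpace (φ : SymmetricAlgebra ℂ 𝔥 →ₐ[ℂ] T) {M : Bimod 𝔤 T}
    (α : LieModule.Weight ℂ 𝔥 𝔤) {x : 𝔤} (hx : x ∈ LieAlgebra.rootSpace 𝔥 α)
    {μ : Module.Dual ℂ 𝔥} {m : M} (hm : m ∈ weightSpace 𝔥 φ μ M) :
    lieElt T x • m ∈ weightSpace 𝔥 φ (μ + α.toLinear) M := by
  intro H
  have hHx : ⁅(H : 𝔤), x⁆ = α H • x := LieAlgebra.IsKilling.lie_eq_smul_of_mem_rootSpace hx H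
  have hcomm : lieElt T (H : 𝔤) * lieElt T x =
      lieElt T x * lieElt T (H : 𝔤) + algebraMap ℂ (BimodAlg 𝔤 T) (α H) * lieElt T x := by
    have h := congrArg (lieElt T) hHx
    simp only [lieElt, LieHom.map_lie, LieRing.of_associative_ring_bracket, map_smul,
      TensorProduct.tmul_sub, TensorProduct.tmul_smul] at h
    rw [← Algebra.smul_def]
    simp only [lieElt, Algebra.TensorProduct.tmul_mul_tmul, mul_one]
    rw [← h]
    abel
  have h := hm H
  rw [sub_smul, sub_eq_iff_eq_add] at h
  rw [smul_smul, sub_mul, hcomm, sub_smul, add_smul, mul_smul, h, smul_add, smul_comm]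
  have e : (μ + α.toLinear) H = μ H + α H := rfl
  rw [e, map_add, add_mul, add_smul, smul_smul, ← Algebra.commutes (μ H) (lieElt T x)]
  abel

lemma lieElt_smul_mem (φ : SymmetricAlgebra ℂ 𝔥 →ₐ[ℂ] T) {M : Bimod 𝔤 T} (x : 𝔤) {m : M}
    (hm : m ∈ ⨆ μ, weightSpace 𝔥 φ μ M) : lieElt T x • m ∈ ⨆ μ, weightSpace 𝔥 φ μ M := by
  induction hm using Submodule.iSup_induction' with
  | zero => simp
  | add y z _ _ hy hz => rw [smul_add]; exact add_mem hy hz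
  | mem μ y hy =>
    have hx : x ∈ ⨆ α : LieModule.Weight ℂ 𝔥 𝔤, LieAlgebra.rootSpace 𝔥 α := by
      rw [LieModule.iSup_genWeightSpace_eq_top']
      exact LieSubmodule.mem_top x
    induction hx using LieSubmodule.iSup_induction' with
    | mem α x hx =>
      exact Submodule.mem_iSup_of_mem _ (lieElt_smul_mem_weightSpace φ α hx hy)
    | zero => simp [lieElt]
    | add x x' _ _ h h' =>
      rw [lieElt, map_add, TensorProduct.tmul_add, add_smul]
      exact add_mem h h'

/-- The sum of all deformed weight spaces of a bimodule, a sub-bimodule. -/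
noncomputable def weightSum (φ : SymmetricAlgebra ℂ 𝔥 →ₐ[ℂ] T) (M : Bimod 𝔤 T) :
    Submodule (BimodAlg 𝔤 T) M :=
  { (⨆ μ, weightSpace 𝔥 φ μ M).toAddSubmonoid with
    smul_mem' := fun a m hm => by
      change m ∈ ⨆ μ, weightSpace 𝔥 φ μ M at hm
      change a • m ∈ ⨆ μ, weightSpace 𝔥 φ μ M
      induction a using bimodAlg_induction generalizing m with
      | hT t => rw [algebraMap_smul]; exact Submodule.smul_mem _ _ hm
      | hx x => exact lieElt_smul_mem φ x hm
      | hadd a b ha hb => rw [add_smul]; exact add_mem (ha _ hm) (hb _ hm)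
      | hmul a b ha hb => rw [mul_smul]; exact ha _ (hb _ hm) }

/-! ### Deformed Verma modules -/

/-- The deformed Verma module `Δ_T(μ) = U(𝔤) ⊗_{U(𝔟)} (ℂ_μ ⊗ T)`, that is, the quotient of
`U(𝔤) ⊗ T` by the relations `w y ⊗ t = w ⊗ y t` for `w ∈ U(𝔤)`, `y ∈ 𝔟`, `t ∈ T`. -/
noncomputable def verma (𝔟 : LieSubalgebra ℂ 𝔤) (φ : SymmetricAlgebra ℂ 𝔥 →ₐ[ℂ] T)
    (μ : Module.Dual ℂ 𝔥) : Bimod 𝔤 T :=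
  ModuleCat.of (BimodAlg 𝔤 T) (BimodAlg 𝔤 T ⧸ Submodule.span (BimodAlg 𝔤 T)
    {a | ∃ (t : T) (w : UniversalEnvelopingAlgebra ℂ 𝔤), ∃ y ∈ 𝔟,
      a = t ⊗ₜ[ℂ] (w * UniversalEnvelopingAlgebra.ι ℂ y) - (deformedChar φ μ y * t) ⊗ₜ[ℂ] w})

/-- The canonical map `T → Δ_T(μ)`, `t ↦ 1 ⊗ t`. -/
noncomputable def vermaMk (𝔟 : LieSubalgebra ℂ 𝔤) (φ : SymmetricAlgebra ℂ 𝔥 →ₐ[ℂ] T)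
    (μ : Module.Dual ℂ 𝔥) (t : T) : verma 𝔟 φ μ :=
  Submodule.Quotient.mk (t ⊗ₜ[ℂ] (1 : UniversalEnvelopingAlgebra ℂ 𝔤))

/-! ### Deformed nabla modules -/

/-- The coinduced bimodule `Hom_{U(𝔠)}(U(𝔤), ℂ_μ ⊗ T)`, for a Borel subalgebra `𝔠`
containing `𝔥`: the `ℂ`-linear maps `ψ : U(𝔤) → T` such that `ψ(y z) = y ψ(z)` for all `y ∈ 𝔠`. -/
noncomputable def coind (𝔠 : LieSubalgebra ℂ 𝔤) (φ : SymmetricAlgebra ℂ 𝔥 →ₐ[ℂ] T)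
    (μ : Module.Dual ℂ 𝔥) : Submodule (BimodAlg 𝔤 T) (FunSpace 𝔤 T) where
  carrier := {ψ | ∀ y ∈ 𝔠, ∀ z : UniversalEnvelopingAlgebra ℂ 𝔤,
    ψ.eval (UniversalEnvelopingAlgebra.ι ℂ y * z) = deformedChar φ μ y * ψ.eval z}
  add_mem' := fun h₁ h₂ y hy z => by
    rw [FunSpace.eval_add, h₁ y hy, h₂ y hy, FunSpace.eval_add, mul_add]
  zero_mem' := fun y hy z => by rw [FunSpace.eval_zero, FunSpace.eval_zero, mul_zero]
  smul_mem' := fun a ψ h => by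
    induction a using TensorProduct.induction_on with
    | zero =>
      intro y hy z
      rw [zero_smul, FunSpace.eval_zero, FunSpace.eval_zero, mul_zero]
    | tmul t w =>
      intro y hy z
      rw [FunSpace.eval_tmul_smul, FunSpace.eval_tmul_smul, mul_assoc, h y hy]
      ring
    | add a b ha hb =>
      intro y hy z
      rw [add_smul, FunSpace.eval_add, FunSpace.eval_add, ha y hy, hb y hy, mul_add]

/-- The deformed nabla module `∇_T(μ)`: the sum of all deformed weight spaces in the bimodule
`Hom_{U(𝔟')}(U(𝔤), ℂ_μ ⊗ T)`, where `𝔟'` is the Borel subalgebra opposite to `𝔟`. -/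
noncomputable def nabla (𝔟 : LieSubalgebra ℂ 𝔤) (φ : SymmetricAlgebra ℂ 𝔥 →ₐ[ℂ] T)
    (μ : Module.Dual ℂ 𝔥) : Bimod 𝔤 T :=
  ModuleCat.of (BimodAlg 𝔤 T)
    (weightSum φ (ModuleCat.of (BimodAlg 𝔤 T) (coind (oppositeBorel 𝔥 𝔟) φ μ)))

/-- The canonical map `∇_T(μ) → T`, `ψ ↦ ψ(1)`. -/
noncomputable def nablaEval (𝔟 : LieSubalgebra ℂ 𝔤) (φ : SymmetricAlgebra ℂ 𝔥 →ₐ[ℂ] T)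
    (μ : Module.Dual ℂ 𝔥) (ψ : nabla 𝔟 φ μ) : T :=
  FunSpace.eval (ψ.1 : coind (oppositeBorel 𝔥 𝔟) φ μ).1 1

end Cartan
end DeformedO

/-! Let h₀ be the sum of the coroots of the roots of 𝔟. Its eigenvalues on 𝔤 are integers, positive
on the nonzero roots of 𝔟, and maximality of 𝔟 then makes 𝔥, 𝔟 and the opposite Borel subalgebra the
parts of degree 0, ≥ 0 and ≤ 0 (`LieSubalgebra.IsBorel.isGrading`). Comparing weights by their
values at h₀ is the only ordering used.

A highest weight vector of weight λ in M gives a homomorphism Δ(λ) → M (`exists_verma_hom`). If M is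
the sum of its weight spaces, a T-linear form on M that transforms under the opposite Borel by the
character of μ gives a homomorphism M → ∇(μ) (`exists_hom_nabla`, Frobenius reciprocity). Commuting
root vectors shows that Δ(λ) consists of the T-multiples of its generator and of weights below λ. It
also shows that an element of ∇(μ) is determined by its values on products of positive root vectors.
Hence all weights of ∇(μ) are μ or below, and ψ ↦ ψ(1) is injective on the weight space of μ and
zero on the others. A highest weight vector of weight λ ≠ μ in ∇(μ) is therefore zero, which gives
the vanishing of Hom for λ ≠ μ. Only nonzero complex numbers are inverted, so T may be arbitrary.

It remains to see that nothing collapses. Injectivity of T → Δ(λ)^λ and surjectivity of ∇(λ)^λ → T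
and of Hom(Δ(λ), ∇(λ)) → T all follow from one homomorphism Δ(λ) → ∇(λ) that sends the generator to
some ψ with ψ(1) = 1. This amounts to a form on U(𝔤), equivariant on the right under 𝔟 and on the
left under its opposite, with value 1 at 1. `UniversalEnvelopingAlgebra.exists_equivariant_form`
obtains it from an explicit operation of 𝔤 on T ⊗ U(𝔫⁻), with 𝔫⁻ the part of negative degree; no PBW
basis is needed.

For Ext¹ it suffices to split every 0 → ∇(μ) → E → Δ(λ) → 0
(`CategoryTheory.Abelian.Ext.subsingleton_one_of_split`). If λ is not below μ, a lift of the
generator to E^λ is a highest weight vector and defines a section. If λ is below μ, then E^μ =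
∇(μ)^μ and E has no weights above μ. Evaluation at 1, extended by zero to the other weight spaces of
E, is then equivariant and defines a retraction. -/

set_option linter.unusedSectionVars false

/-! ### Ext¹ and short exact sequences in an abelian category -/

section ExtOne

universe w v₁ u₁

open Limits Pretriangulated DerivedCategory

variable {C : Type u₁} [Category.{v₁} C] [Abelian C]

/-- A distinguished triangle whose three vertices are concentrated in degree `0` comes from a
short exact sequence. -/
lemma DerivedCategory.shortExact_of_distTriang [HasDerivedCategory.{w} C] {Y E X : C}
    (i : Y ⟶ E) (p : E ⟶ X)
    (δ : (singleFunctor C 0).obj X ⟶ ((singleFunctor C 0).obj Y)⟦(1 : ℤ)⟧)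
    (hT : Triangle.mk ((singleFunctor C 0).map i) ((singleFunctor C 0).map p) δ ∈
      distTriang (DerivedCategory C)) :
    ∃ w : i ≫ p = 0, (ShortComplex.mk i p w).ShortExact := by
  have w : i ≫ p = 0 := (singleFunctor C 0).map_injective (by
    rw [Functor.map_comp, Functor.map_zero]
    exact comp_distTriang_mor_zero₁₂ _ hT)
  -- A map killed by `i` factors through X⟦-1⟧, which lives in degree 1 and receives no nonzero map
  -- from degree 0. The argument for `p` is dual, with Y⟦1⟧ in degree -1.
  have hi : Mono i := by
    rw [Preadditive.mono_iff_cancel_zero]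
    intro Z g hg
    obtain ⟨k, hk⟩ := Triangle.coyoneda_exact₂ _ (inv_rot_of_distTriang _ hT)
      ((singleFunctor C 0).map g) (by
        change (singleFunctor C 0).map g ≫ (singleFunctor C 0).map i = 0
        rw [← Functor.map_comp, hg, Functor.map_zero])
    have : k = 0 := by
      have : TStructure.t.IsGE (((singleFunctor C 0).obj X)⟦(-1 : ℤ)⟧) 1 :=
        TStructure.t.isGE_shift _ 0 (-1) 1
      exact TStructure.t.zero (Y := ((singleFunctor C 0).obj X)⟦(-1 : ℤ)⟧) k 0 1
    apply (singleFunctor C 0).map_injective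
    rw [hk, this, zero_comp, Functor.map_zero]
    rfl
  have hp : Epi p := by
    rw [Preadditive.epi_iff_cancel_zero]
    intro Z g hg
    obtain ⟨k, hk⟩ := Triangle.yoneda_exact₃ _ hT ((singleFunctor C 0).map g) (by
        change (singleFunctor C 0).map p ≫ (singleFunctor C 0).map g = 0
        rw [← Functor.map_comp, hg, Functor.map_zero])
    have : k = 0 := by
      have : TStructure.t.IsLE (((singleFunctor C 0).obj Y)⟦(1 : ℤ)⟧) (-1) :=
        TStructure.t.isLE_shift _ 0 1 (-1)
      exact TStructure.t.zero (X := ((singleFunctor C 0).obj Y)⟦(1 : ℤ)⟧) k (-1) 0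
    apply (singleFunctor C 0).map_injective
    rw [hk, this, comp_zero, Functor.map_zero]
    rfl
  refine ⟨w, ⟨ShortComplex.exact_of_f_is_kernel _
    (KernelFork.IsLimit.ofι' _ w fun {Z} g hg => ?_)⟩⟩
  have h : ∃ k : (singleFunctor C 0).obj Z ⟶ (singleFunctor C 0).obj Y,
      (singleFunctor C 0).map g = k ≫ (singleFunctor C 0).map i :=
    Triangle.coyoneda_exact₂ _ hT ((singleFunctor C 0).map g) (by
      change (singleFunctor C 0).map g ≫ (singleFunctor C 0).map p = 0
      rw [← Functor.map_comp, hg, Functor.map_zero])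
  refine ⟨(singleFunctor C 0).preimage h.choose, (singleFunctor C 0).map_injective ?_⟩
  rw [Functor.map_comp, Functor.map_preimage]
  exact h.choose_spec.symm

/-- If all short exact sequences `0 → Y → E → X → 0` split, then `Ext¹(X, Y)` vanishes. -/
lemma CategoryTheory.Abelian.Ext.subsingleton_one_of_split [HasExt.{w} C] (X Y : C)
    (h : ∀ (E : C) (i : Y ⟶ E) (p : E ⟶ X) (w : i ≫ p = 0),
      (ShortComplex.mk i p w).ShortExact → ∃ s : X ⟶ E, s ≫ p = 𝟙 X) :
    Subsingleton (Ext.{w} X Y 1) := by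
  let := HasDerivedCategory.standard C
  refine subsingleton_of_forall_eq 0 fun e => Ext.homEquiv.injective ?_
  change e.hom = (0 : Ext X Y 1).hom
  rw [Ext.zero_hom]
  -- The class is a map X ⟶ Y⟦1⟧; complete it to a triangle. Its middle vertex is concentrated in
  -- degree 0 because the outer two are, so it is an object of `C`.
  obtain ⟨E', f, g, hT⟩ := distinguished_cocone_triangle₂
    (show (singleFunctor C 0).obj X ⟶ ((singleFunctor C 0).obj Y)⟦(1 : ℤ)⟧ from e.hom)
  have h₁ : TStructure.t.IsLE E' 0 := TStructure.t.isLE₂ _ hT 0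
    (inferInstanceAs (TStructure.t.IsLE ((singleFunctor C 0).obj Y) 0))
    (inferInstanceAs (TStructure.t.IsLE ((singleFunctor C 0).obj X) 0))
  have h₂ : TStructure.t.IsGE E' 0 := TStructure.t.isGE₂ _ hT 0
    (inferInstanceAs (TStructure.t.IsGE ((singleFunctor C 0).obj Y) 0))
    (inferInstanceAs (TStructure.t.IsGE ((singleFunctor C 0).obj X) 0))
  obtain ⟨E, ⟨ε⟩⟩ := exists_iso_singleFunctor_obj_of_isGE_of_isLE E' 0
  obtain ⟨i, hi⟩ := (singleFunctor C 0).map_surjective (f ≫ ε.hom)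
  obtain ⟨p, hp⟩ := (singleFunctor C 0).map_surjective (ε.inv ≫ g)
  have hT' : Triangle.mk ((singleFunctor C 0).map i) ((singleFunctor C 0).map p) e.hom ∈
      distTriang (DerivedCategory C) := by
    refine isomorphic_distinguished _ hT _ (Triangle.isoMk _ _ (Iso.refl _) ε.symm (Iso.refl _)
      ?_ ?_ ?_)
    · change (singleFunctor C 0).map i ≫ ε.inv = 𝟙 _ ≫ f
      simp [hi]
    · change (singleFunctor C 0).map p ≫ 𝟙 _ = ε.inv ≫ g
      simp [hp]
    · change e.hom ≫ (shiftFunctor (DerivedCategory C) (1 : ℤ)).map (𝟙 _) = 𝟙 _ ≫ e.hom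
      rw [Functor.map_id, Category.id_comp]
      exact Category.comp_id _
  obtain ⟨w, hs⟩ := shortExact_of_distTriang i p _ hT'
  obtain ⟨s, hs⟩ := h E i p w hs
  -- Consecutive maps of a triangle compose to zero, so a section of `p` forces the class itself to
  -- vanish.
  have h₃ : (singleFunctor C 0).map p ≫ e.hom = 0 := comp_distTriang_mor_zero₂₃ _ hT'
  calc e.hom = (singleFunctor C 0).map (s ≫ p) ≫ e.hom := by rw [hs]; simp
    _ = 0 := by rw [Functor.map_comp, Category.assoc, h₃, Limits.comp_zero]

end ExtOne

/-! ### Induced modules and equivariant forms on the enveloping algebra -/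

section Induced

attribute [local instance 100] LieRing.ofAssociativeRing

variable {R : Type*} [CommRing R] {𝔤 : Type*} [LieRing 𝔤] [LieAlgebra R 𝔤]

open UniversalEnvelopingAlgebra (ι)

lemma UniversalEnvelopingAlgebra.adjoin_range_ι :
    Algebra.adjoin R (Set.range (ι R : 𝔤 → UniversalEnvelopingAlgebra R 𝔤)) = ⊤ := by
  set S := Algebra.adjoin R (Set.range (ι R : 𝔤 → UniversalEnvelopingAlgebra R 𝔤))
  let f : 𝔤 →ₗ⁅R⁆ S :=
    { toFun := fun x => ⟨ι R x, Algebra.subset_adjoin ⟨x, rfl⟩⟩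
      map_add' := fun x y => by ext; simp
      map_smul' := fun c x => by ext; simp
      map_lie' := fun {x y} => by ext; simp [LieRing.of_associative_ring_bracket] }
  have h : S.val.comp (UniversalEnvelopingAlgebra.lift R f) = AlgHom.id R _ := by
    apply UniversalEnvelopingAlgebra.hom_ext
    ext x
    simp [f]
  refine eq_top_iff.2 fun w _ => ?_
  have := congrArg (fun g => g w) h
  simp only [AlgHom.comp_apply, AlgHom.id_apply] at this
  rw [← this]
  exact (UniversalEnvelopingAlgebra.lift R f w).2

/-- A subspace of `U(𝔤)` that contains `1` and is stable under left multiplication by `𝔤`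
is everything. -/
lemma UniversalEnvelopingAlgebra.eq_top_of_ι_mul_mem
    (P : Submodule R (UniversalEnvelopingAlgebra R 𝔤)) (h1 : 1 ∈ P)
    (hx : ∀ x : 𝔤, ∀ w ∈ P, ι R x * w ∈ P) : P = ⊤ := by
  let S : Subalgebra R (UniversalEnvelopingAlgebra R 𝔤) :=
    { carrier := {a | ∀ w ∈ P, a * w ∈ P}
      mul_mem' := fun ha hb w hw => by rw [mul_assoc]; exact ha _ (hb _ hw)
      add_mem' := fun ha hb w hw => by rw [add_mul]; exact add_mem (ha _ hw) (hb _ hw)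
      algebraMap_mem' := fun r w hw => by
        rw [← Algebra.smul_def]; exact P.smul_mem r hw }
  have hS : S = ⊤ := by
    rw [eq_top_iff, ← adjoin_range_ι, Algebra.adjoin_le_iff]
    rintro _ ⟨x, rfl⟩
    exact hx x
  refine eq_top_iff.2 fun w _ => ?_
  have hw : w ∈ S := hS ▸ Algebra.mem_top
  simpa using hw 1 h1

namespace InducedModule

variable {T : Type*} [CommRing T] [Algebra R T] {𝔫 𝔟 : LieSubalgebra R 𝔤}

variable (T 𝔫) in
/-- The space `T ⊗ U(𝔫)` underlying the module induced from a character of a complement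
of `𝔫`. -/
abbrev Carrier : Type _ := T ⊗[R] UniversalEnvelopingAlgebra R 𝔫

/-- A `T`-submodule of `T ⊗ U(𝔫)` that contains `1` and is stable under left multiplication by `𝔫`
is everything. -/
lemma eq_top_of_tmul_mul_mem (P : Submodule T (Carrier T 𝔫)) (h1 : 1 ∈ P)
    (hx : ∀ y : 𝔫, ∀ v ∈ P, (1 ⊗ₜ ι R y) * v ∈ P) : P = ⊤ := by
  have h : (P.restrictScalars R).comap (TensorProduct.mk R T _ 1) = ⊤ :=
    UniversalEnvelopingAlgebra.eq_top_of_ι_mul_mem _ h1 fun y w hw => by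
      simpa using hx y _ hw
  refine eq_top_iff.2 fun v _ => ?_
  induction v using TensorProduct.induction_on with
  | zero => exact zero_mem _
  | add a b ha hb => exact add_mem (ha trivial) (hb trivial)
  | tmul t w =>
    have hw : (1 : T) ⊗ₜ[R] w ∈ P := by
      have : w ∈ (P.restrictScalars R).comap (TensorProduct.mk R T _ 1) := h ▸ Submodule.mem_top
      exact this
    have := P.smul_mem t hw
    rwa [TensorProduct.smul_tmul', smul_eq_mul, mul_one] at this

variable (T 𝔫) in
/-- The operation of `𝔫` on the linear maps `𝔤 → T ⊗ U(𝔫)`. -/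
noncomputable def homAction : 𝔫 →ₗ⁅R⁆ Module.End T (𝔤 →ₗ[R] Carrier T 𝔫) where
  toFun y :=
    { toFun := fun F => (LinearMap.mulLeft R (1 ⊗ₜ ι R y : Carrier T 𝔫)).comp F -
        F.comp (LieAlgebra.ad R 𝔤 (y : 𝔤))
      map_add' := fun F G => by ext x; simp [mul_add]; abel
      map_smul' := fun t F => by ext x; simp [smul_sub] }
  map_add' y y' := by
    ext F x
    simp [TensorProduct.tmul_add, add_mul]; abel
  map_smul' r y := by
    ext F x
    simp [smul_sub]
  map_lie' {y y'} := by
    ext F x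
    simp [LieRing.of_associative_ring_bracket, TensorProduct.tmul_sub, sub_mul, mul_sub,
      ← mul_assoc]
    abel

variable (h𝔫𝔟 : IsCompl 𝔫.toSubmodule 𝔟.toSubmodule) (χ : 𝔤 →ₗ[R] T)

/-- The map giving the operation of `𝔤` on the generator of the induced module. -/
noncomputable def generatorMap : 𝔤 →ₗ[R] Carrier T 𝔫 :=
  (TensorProduct.mk R T (UniversalEnvelopingAlgebra R 𝔫) 1).comp
    ((ι R : 𝔫 →ₗ⁅R⁆ _).toLinearMap.comp (Submodule.projectionOnto _ _ h𝔫𝔟)) +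
  (Algebra.linearMap T (Carrier T 𝔫)).restrictScalars R ∘ₗ χ

/-- The operation of `𝔤` on the induced module, as a linear map. -/
noncomputable def opAux : Carrier T 𝔫 →ₗ[T] 𝔤 →ₗ[R] Carrier T 𝔫 :=
  TensorProduct.AlgebraTensorModule.lift
    (LinearMap.toSpanSingleton T _
      ((LinearMap.applyₗ' R (generatorMap h𝔫𝔟 χ)) ∘ₗ
        (UniversalEnvelopingAlgebra.lift R (homAction T 𝔫)).toLinearMap))

lemma opAux_one : opAux h𝔫𝔟 χ 1 = generatorMap h𝔫𝔟 χ := by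
  rw [Algebra.TensorProduct.one_def, opAux, TensorProduct.AlgebraTensorModule.lift_tmul]
  simp

lemma opAux_tmul_mul (y : 𝔫) (v : Carrier T 𝔫) :
    opAux h𝔫𝔟 χ ((1 ⊗ₜ ι R y) * v) = homAction T 𝔫 y (opAux h𝔫𝔟 χ v) := by
  induction v using TensorProduct.induction_on with
  | zero => simp
  | add a b ha hb => rw [mul_add, map_add, ha, hb, map_add, map_add]
  | tmul t w =>
    rw [Algebra.TensorProduct.tmul_mul_tmul, opAux, TensorProduct.AlgebraTensorModule.lift_tmul,
      TensorProduct.AlgebraTensorModule.lift_tmul]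
    simp

/-- The operation of an element of `𝔤` on the induced module. -/
noncomputable def op : 𝔤 →ₗ[R] Module.End T (Carrier T 𝔫) where
  toFun x :=
    { toFun := fun v => opAux h𝔫𝔟 χ v x
      map_add' := fun v w => by simp
      map_smul' := fun t v => by simp }
  map_add' x y := by ext; simp
  map_smul' r x := by ext; simp

lemma op_one (x : 𝔤) : op h𝔫𝔟 χ x 1 = generatorMap h𝔫𝔟 χ x :=
  congrArg (fun F => F x) (opAux_one h𝔫𝔟 χ)

/-- In a 𝔤-module one has x(yv) = y(xv) + [x,y]v, so the values on 1 determine the operation on T ⊗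
U(𝔫). `opAux` takes this rule as a recursive definition. It is consistent with the relations of U(𝔫)
because `homAction` is a representation of 𝔫. -/
lemma op_tmul_mul (x : 𝔤) (y : 𝔫) (v : Carrier T 𝔫) :
    op h𝔫𝔟 χ x ((1 ⊗ₜ ι R y) * v) = (1 ⊗ₜ ι R y) * op h𝔫𝔟 χ x v + op h𝔫𝔟 χ ⁅x, (y : 𝔤)⁆ v := by
  have h : op h𝔫𝔟 χ x ((1 ⊗ₜ ι R y) * v) =
      (1 ⊗ₜ ι R y) * op h𝔫𝔟 χ x v - op h𝔫𝔟 χ ⁅(y : 𝔤), x⁆ v :=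
    congrArg (fun F => F x) (opAux_tmul_mul h𝔫𝔟 χ y v)
  rw [h, ← lie_skew, map_neg, LinearMap.neg_apply, sub_neg_eq_add]

variable {χ}

lemma op_coe (hχ𝔫 : ∀ y ∈ 𝔫, χ y = 0) (y : 𝔫) (v : Carrier T 𝔫) :
    op h𝔫𝔟 χ y v = (1 ⊗ₜ ι R y) * v := by
  have h : (⨅ y : 𝔫, LinearMap.eqLocus (op h𝔫𝔟 χ y) (LinearMap.mulLeft T (1 ⊗ₜ ι R y))) = ⊤ := by
    refine eq_top_of_tmul_mul_mem _ ?_ fun y' v hv => ?_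
    · simp only [Submodule.mem_iInf, LinearMap.mem_eqLocus]
      intro y
      have hy : Submodule.projectionOnto _ _ h𝔫𝔟 (y : 𝔤) = y :=
        Submodule.projectionOnto_apply_left h𝔫𝔟 y
      rw [op_one, generatorMap, LinearMap.mulLeft_apply, mul_one]
      simp [hχ𝔫 y y.2, hy]
    · simp only [Submodule.mem_iInf, LinearMap.mem_eqLocus, LinearMap.mulLeft_apply] at hv ⊢
      intro y
      rw [op_tmul_mul, hv, ← LieSubalgebra.coe_bracket, hv]
      simp only [LieHom.map_lie, LieRing.of_associative_ring_bracket, TensorProduct.tmul_sub,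
        sub_mul, ← mul_assoc, Algebra.TensorProduct.tmul_mul_tmul, mul_one]
      abel
  have hv : v ∈ (⨅ y : 𝔫, LinearMap.eqLocus (op h𝔫𝔟 χ y)
    (LinearMap.mulLeft T (1 ⊗ₜ ι R y))) := h ▸ Submodule.mem_top
  simp only [Submodule.mem_iInf, LinearMap.mem_eqLocus] at hv
  exact hv y

lemma op_one_of_mem {x : 𝔤} (hx : x ∈ 𝔟) : op h𝔫𝔟 χ x 1 = χ x • 1 := by
  have : Submodule.projectionOnto _ _ h𝔫𝔟 x = 0 := by
    rw [Submodule.projectionOnto_apply_eq_zero_iff]; exact hx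
  rw [op_one, generatorMap]
  simp [this, Algebra.algebraMap_eq_smul_one]

/-- If one of the two elements lies in 𝔫, the relation is the recursion itself. Two elements of 𝔟
operate on 1 by scalars, and χ kills their bracket. This settles the relation on 1, and the Jacobi
identity carries it from v to yv. -/
lemma op_lie (hχ𝔫 : ∀ y ∈ 𝔫, χ y = 0) (hχ𝔟 : ∀ x ∈ 𝔟, ∀ y ∈ 𝔟, χ ⁅x, y⁆ = 0) (x x' : 𝔤) :
    op h𝔫𝔟 χ ⁅x, x'⁆ = ⁅op h𝔫𝔟 χ x, op h𝔫𝔟 χ x'⁆ := by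
  have hn : ∀ (y : 𝔫) (x : 𝔤) (v : Carrier T 𝔫), op h𝔫𝔟 χ ⁅x, (y : 𝔤)⁆ v =
      ⁅op h𝔫𝔟 χ x, op h𝔫𝔟 χ y⁆ v := by
    intro y x v
    rw [LieRing.of_associative_ring_bracket]
    simp only [LinearMap.sub_apply, Module.End.mul_apply, op_coe h𝔫𝔟 hχ𝔫, op_tmul_mul]
    abel
  have h1 : ∀ x x' : 𝔤, op h𝔫𝔟 χ ⁅x, x'⁆ 1 = ⁅op h𝔫𝔟 χ x, op h𝔫𝔟 χ x'⁆ 1 := by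
    intro x x'
    have hx' : x' ∈ 𝔫.toSubmodule ⊔ 𝔟.toSubmodule := h𝔫𝔟.sup_eq_top ▸ Submodule.mem_top
    obtain ⟨y', hy', b', hb', rfl⟩ := Submodule.mem_sup.1 hx'
    have hx : x ∈ 𝔫.toSubmodule ⊔ 𝔟.toSubmodule := h𝔫𝔟.sup_eq_top ▸ Submodule.mem_top
    obtain ⟨y, hy, b, hb, rfl⟩ := Submodule.mem_sup.1 hx
    have e₁ : op h𝔫𝔟 χ ⁅y + b, y'⁆ 1 = ⁅op h𝔫𝔟 χ (y + b), op h𝔫𝔟 χ y'⁆ 1 :=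
      hn ⟨y', hy'⟩ (y + b) 1
    have e₂ : op h𝔫𝔟 χ ⁅b', y⁆ 1 = ⁅op h𝔫𝔟 χ b', op h𝔫𝔟 χ y⁆ 1 := hn ⟨y, hy⟩ b' 1
    have e₃ : op h𝔫𝔟 χ ⁅b, b'⁆ 1 = ⁅op h𝔫𝔟 χ b, op h𝔫𝔟 χ b'⁆ 1 := by
      rw [op_one_of_mem h𝔫𝔟 (𝔟.lie_mem hb hb'), hχ𝔟 b hb b' hb',
        LieRing.of_associative_ring_bracket, LinearMap.sub_apply, Module.End.mul_apply,
        Module.End.mul_apply, op_one_of_mem h𝔫𝔟 hb, op_one_of_mem h𝔫𝔟 hb', map_smul, map_smul,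
        op_one_of_mem h𝔫𝔟 hb, op_one_of_mem h𝔫𝔟 hb', smul_comm, sub_self, zero_smul]
    have e₄ : op h𝔫𝔟 χ ⁅y, b'⁆ 1 = ⁅op h𝔫𝔟 χ y, op h𝔫𝔟 χ b'⁆ 1 := by
      rw [← lie_skew y b', ← lie_skew (op h𝔫𝔟 χ y), map_neg, LinearMap.neg_apply, e₂,
        LinearMap.neg_apply]
    rw [lie_add (y + b), map_add, map_add _ y' b', lie_add, LinearMap.add_apply,
      LinearMap.add_apply, e₁, add_lie y b b', map_add _ y b, map_add,
      add_lie _ _ (op h𝔫𝔟 χ b'), LinearMap.add_apply, LinearMap.add_apply, e₃, e₄]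
  have h : (⨅ p : 𝔤 × 𝔤, LinearMap.eqLocus (op h𝔫𝔟 χ ⁅p.1, p.2⁆)
      ⁅op h𝔫𝔟 χ p.1, op h𝔫𝔟 χ p.2⁆) = ⊤ := by
    refine eq_top_of_tmul_mul_mem _ ?_ fun y v hv => ?_
    · simp only [Submodule.mem_iInf, LinearMap.mem_eqLocus]
      exact fun p => h1 p.1 p.2
    · simp only [Submodule.mem_iInf, LinearMap.mem_eqLocus, Prod.forall,
        LieRing.of_associative_ring_bracket, LinearMap.sub_apply, Module.End.mul_apply] at hv ⊢
      intro x x'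
      have hj : ⁅⁅x, x'⁆, (y : 𝔤)⁆ = ⁅x, ⁅x', (y : 𝔤)⁆⁆ - ⁅x', ⁅x, (y : 𝔤)⁆⁆ := lie_lie _ _ _
      rw [op_tmul_mul, hv x x', hj, map_sub, LinearMap.sub_apply, hv x ⁅x', (y : 𝔤)⁆,
        hv x' ⁅x, (y : 𝔤)⁆, op_tmul_mul, op_tmul_mul, map_add, map_add, op_tmul_mul, op_tmul_mul,
        mul_sub]
      abel
  refine LinearMap.ext fun v => ?_
  have hv : v ∈ (⨅ p : 𝔤 × 𝔤, LinearMap.eqLocus (op h𝔫𝔟 χ ⁅p.1, p.2⁆)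
      ⁅op h𝔫𝔟 χ p.1, op h𝔫𝔟 χ p.2⁆) := h ▸ Submodule.mem_top
  simp only [Submodule.mem_iInf, LinearMap.mem_eqLocus] at hv
  exact hv (x, _)

/-- The map `T ⊗ U(𝔫) → T` given by the augmentation of `U(𝔫)`. -/
noncomputable def augmentation : Carrier T 𝔫 →ₐ[T] T :=
  Algebra.TensorProduct.lift (AlgHom.id T T)
    ((Algebra.ofId R T).comp (UniversalEnvelopingAlgebra.lift R (0 : 𝔫 →ₗ⁅R⁆ R)))
    (fun _ _ => Commute.all _ _)

lemma augmentation_tmul_mul (y : 𝔫) (v : Carrier T 𝔫) :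
    augmentation ((1 ⊗ₜ ι R y) * v) = 0 := by
  have : augmentation (1 ⊗ₜ ι R y : Carrier T 𝔫) = 0 := by
    rw [augmentation, Algebra.TensorProduct.lift_tmul, AlgHom.comp_apply,
      UniversalEnvelopingAlgebra.lift_ι_apply]
    simp
  rw [map_mul, this, zero_mul]

/-- The augmentation kills every yv with y ∈ 𝔫. In x(yv) = y(xv) + [x,y]v it kills both terms, as
[x,y] ∈ 𝔫, so only the value on 1 counts. -/
lemma augmentation_op (hχ𝔫 : ∀ y ∈ 𝔫, χ y = 0) {x : 𝔤} (hx : x ∈ 𝔟) (hx𝔫 : ∀ y ∈ 𝔫, ⁅x, y⁆ ∈ 𝔫)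
    (v : Carrier T 𝔫) : augmentation (op h𝔫𝔟 χ x v) = χ x * augmentation v := by
  have h : LinearMap.eqLocus (augmentation.toLinearMap ∘ₗ op h𝔫𝔟 χ x)
      (χ x • (augmentation (T := T) (𝔫 := 𝔫)).toLinearMap) = ⊤ := by
    refine eq_top_of_tmul_mul_mem _ ?_ fun y v hv => ?_
    · simp [op_one_of_mem h𝔫𝔟 hx]
    · simp only [LinearMap.mem_eqLocus, LinearMap.comp_apply, AlgHom.toLinearMap_apply,
        LinearMap.smul_apply] at hv ⊢
      rw [op_tmul_mul, map_add, augmentation_tmul_mul, augmentation_tmul_mul,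
        op_coe h𝔫𝔟 hχ𝔫 ⟨⁅x, (y : 𝔤)⁆, hx𝔫 y y.2⟩, augmentation_tmul_mul, smul_zero, add_zero]
  have hv : v ∈ LinearMap.eqLocus (augmentation.toLinearMap ∘ₗ op h𝔫𝔟 χ x)
      (χ x • (augmentation (T := T) (𝔫 := 𝔫)).toLinearMap) := h ▸ Submodule.mem_top
  exact hv

end InducedModule

open InducedModule in
/-- For a decomposition `𝔤 = 𝔫 ⊕ 𝔟` into subalgebras and a linear form `χ : 𝔤 → T` that vanishes
on `𝔫` and restricts to a character of `𝔟`, there is a linear form on `U(𝔤)` that is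
`χ`-equivariant on the right under `𝔟`, and on the left under `𝔫` and the normalizer of `𝔫`
in `𝔟`. -/
lemma UniversalEnvelopingAlgebra.exists_equivariant_form {T : Type*} [CommRing T] [Algebra R T]
    {𝔫 𝔟 : LieSubalgebra R 𝔤} (h𝔫𝔟 : IsCompl 𝔫.toSubmodule 𝔟.toSubmodule) (χ : 𝔤 →ₗ[R] T)
    (hχ𝔫 : ∀ y ∈ 𝔫, χ y = 0) (hχ𝔟 : ∀ x ∈ 𝔟, ∀ y ∈ 𝔟, χ ⁅x, y⁆ = 0) :
    ∃ ψ : UniversalEnvelopingAlgebra R 𝔤 →ₗ[R] T, ψ 1 = 1 ∧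
      (∀ x ∈ 𝔟, ∀ z, ψ (z * ι R x) = χ x * ψ z) ∧
      (∀ y ∈ 𝔫, ∀ z, ψ (ι R y * z) = 0) ∧
      (∀ x ∈ 𝔟, (∀ y ∈ 𝔫, ⁅x, y⁆ ∈ 𝔫) → ∀ z, ψ (ι R x * z) = χ x * ψ z) := by
  let ρ : 𝔤 →ₗ⁅R⁆ Module.End T (Carrier T 𝔫) :=
    { op h𝔫𝔟 χ with map_lie' := fun {x x'} => op_lie h𝔫𝔟 hχ𝔫 hχ𝔟 x x' }
  have hρ : ∀ x, UniversalEnvelopingAlgebra.lift R ρ (ι R x) = op h𝔫𝔟 χ x :=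
    fun x => UniversalEnvelopingAlgebra.lift_ι_apply R ρ x
  -- The form sends z to the augmentation of z·1. Right equivariance is read off from the generator
  -- 1, left equivariance from the augmentation.
  let ψ : UniversalEnvelopingAlgebra R 𝔤 →ₗ[R] T :=
    ((augmentation (T := T) (𝔫 := 𝔫)).toLinearMap.restrictScalars R).comp
      ((LinearMap.applyₗ' R (1 : Carrier T 𝔫)).comp
        (UniversalEnvelopingAlgebra.lift R ρ).toLinearMap)
  have hψ : ∀ z, ψ z = augmentation (UniversalEnvelopingAlgebra.lift R ρ z 1) := fun z => rfl
  refine ⟨ψ, ?_, fun x hx z => ?_, fun y hy z => ?_, fun x hx hx𝔫 z => ?_⟩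
  · simp [hψ]
  · rw [hψ, map_mul, Module.End.mul_apply, hρ, op_one_of_mem h𝔫𝔟 hx, map_smul, map_smul, hψ,
      smul_eq_mul]
  · rw [hψ, map_mul, Module.End.mul_apply, hρ, op_coe h𝔫𝔟 hχ𝔫 ⟨y, hy⟩, augmentation_tmul_mul]
  · rw [hψ, map_mul, Module.End.mul_apply, hρ, augmentation_op h𝔫𝔟 hχ𝔫 hx hx𝔫, hψ]

end Induced

/-! ### Root strings and the sum of the coroots -/

section RootCombinatorics

open LieModule LieAlgebra LieAlgebra.IsKilling Module

variable {K L : Type*} [Field K] [CharZero K] [LieRing L] [LieAlgebra K L]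
  [IsKilling K L] [FiniteDimensional K L]
  {H : LieSubalgebra K L} [H.IsCartanSubalgebra] [IsTriangularizable K H L]

lemma LieAlgebra.IsKilling.exists_smul_eq_of_mem_rootSpace {β : Weight K H L} (hβ : β.IsNonZero)
    {x y : L} (hx : x ∈ rootSpace H β) (hx0 : x ≠ 0) (hy : y ∈ rootSpace H β) :
    ∃ c : K, c • x = y := by
  obtain ⟨c, hc⟩ := (finrank_eq_one_iff_of_nonzero' (⟨x, hx⟩ : rootSpace H β)
    (fun h => hx0 (congrArg Subtype.val h))).1 (finrank_rootSpace_eq_one β hβ) ⟨y, hy⟩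
  exact ⟨c, congrArg Subtype.val hc⟩

/-- The bracket of root vectors for `α` and `β` does not vanish if `α + β` is a root. -/
lemma LieAlgebra.IsKilling.lie_ne_zero_of_mem_rootSpace {α β γ : Weight K H L} (hα : α.IsNonZero)
    (hβ : β.IsNonZero) (hγ : (γ : H → K) = α + β) {e x : L} (he : e ∈ rootSpace H α) (he0 : e ≠ 0)
    (hx : x ∈ rootSpace H β) (hx0 : x ≠ 0) : ⁅e, x⁆ ≠ 0 := by
  obtain ⟨h, e', f, t, he', hf⟩ := exists_isSl2Triple_of_weight_isNonZero hα
  obtain ⟨c, rfl⟩ := exists_smul_eq_of_mem_rootSpace hα he he0 he'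
  obtain rfl := t.h_eq_coroot hα he' hf
  obtain ⟨z, hz, hz0⟩ := (chainTop α β).exists_ne_zero
  have prim : t.HasPrimitiveVectorWith z (chainLength α β : K) :=
    have := lie_mem_genWeightSpace_of_mem_genWeightSpace he' hz
    ⟨hz0, (chainLength_smul _ _ hz).symm, by rwa [genWeightSpace_add_chainTop _ _ hα] at this⟩
  have hq : 1 ≤ chainTopCoeff α β := by
    have h := (rootSpace_zsmul_add_ne_bot_iff α β hα 1).1 (by
      rw [one_smul, ← hγ]; exact γ.genWeightSpace_ne_bot)
    exact_mod_cast h.1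
  obtain ⟨q, hq⟩ := Nat.exists_eq_add_of_le' hq
  have hqL : q + 1 ≤ chainLength α β := hq ▸ chainTopCoeff_le_chainLength α β
  -- β lies q + 1 steps below the top of its α-string, so x is a multiple of f^(q+1) z. With ℓ the
  -- length of the string, e f^(q+1) z = (q + 1)(ℓ - q) f^q z, and this is nonzero because q + 1 ≤
  -- ℓ.
  have hmem : (toEnd K L L f ^ (q + 1)) z ∈ rootSpace H β := by
    have h := toEnd_pow_apply_mem hf hz (q + 1)
    have e : (q + 1) • (-α : H → K) + chainTop α β = β := by
      rw [coe_chainTop', hq, smul_neg, neg_add_cancel_left]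
    rwa [e] at h
  obtain ⟨d, hd⟩ := exists_smul_eq_of_mem_rootSpace hβ hmem
    (prim.pow_toEnd_f_ne_zero_of_eq_nat rfl hqL) hx
  have hd0 : d ≠ 0 := by rintro rfl; exact hx0 (by rw [← hd, zero_smul])
  intro h0
  have h1 : ⁅c • e, x⁆ = 0 := by rw [smul_lie, h0, smul_zero]
  rw [← hd, lie_smul, prim.lie_e_pow_succ_toEnd_f, smul_smul, smul_eq_zero] at h1
  refine h1.elim (fun h => ?_) (prim.pow_toEnd_f_ne_zero_of_eq_nat rfl (by omega))
  have h2 : ((q : K) + 1) ≠ 0 := by exact_mod_cast q.succ_ne_zero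
  have h3 : ((chainLength α β : K) - q) ≠ 0 := by
    rw [sub_ne_zero]; exact_mod_cast (by omega : chainLength α β ≠ q)
  exact mul_ne_zero hd0 (mul_ne_zero h2 h3) h

variable {B : LieSubalgebra K L}

lemma LieSubalgebra.rootSpace_le_of_mem {β : Weight K H L} (hβ : β.IsNonZero) {x : L}
    (hx : x ∈ rootSpace H β) (hx0 : x ≠ 0) (hxB : x ∈ B) :
    (rootSpace H β).toSubmodule ≤ B.toSubmodule := by
  intro y hy
  obtain ⟨c, rfl⟩ := exists_smul_eq_of_mem_rootSpace hβ hx hx0 hy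
  exact B.smul_mem c hxB

/-- The roots of a subalgebra that contains the Cartan subalgebra are closed under addition. -/
lemma LieSubalgebra.rootSpace_add_le (hHB : H ≤ B) {α β γ : Weight K H L} (hα : α.IsNonZero)
    (hγ : (γ : H → K) = α + β) (hαB : (rootSpace H α).toSubmodule ≤ B.toSubmodule)
    (hβB : (rootSpace H β).toSubmodule ≤ B.toSubmodule) :
    (rootSpace H γ).toSubmodule ≤ B.toSubmodule := by
  by_cases hβ : β.IsZero
  · rwa [hγ, hβ.eq, add_zero]
  by_cases hγ0 : γ.IsZero
  · rw [hγ0.eq, rootSpace_zero_eq, LieSubalgebra.coe_toLieSubmodule]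
    exact hHB
  obtain ⟨e, he, he0⟩ := α.exists_ne_zero
  obtain ⟨x, hx, hx0⟩ := β.exists_ne_zero
  refine rootSpace_le_of_mem hγ0 (x := ⁅e, x⁆) ?_
    (lie_ne_zero_of_mem_rootSpace hα hβ hγ he he0 hx hx0) (B.lie_mem (hαB he) (hβB hx))
  rw [hγ]
  exact lie_mem_genWeightSpace_of_mem_genWeightSpace he hx

/-- A solvable subalgebra does not contain opposite root spaces. -/
lemma LieSubalgebra.not_rootSpace_neg_le [IsSolvable B] {α : Weight K H L} (hα : α.IsNonZero)
    (hαB : (rootSpace H α).toSubmodule ≤ B.toSubmodule) :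
    ¬ (rootSpace H (-α)).toSubmodule ≤ B.toSubmodule := by
  intro hnB
  obtain ⟨h, e, f, t, he, hf⟩ := exists_isSl2Triple_of_weight_isNonZero hα
  have heB : e ∈ B := hαB he
  have hfB : f ∈ B := hnB hf
  have hhB : h ∈ B := t.lie_e_f ▸ B.lie_mem heB hfB
  -- An 𝔰𝔩₂-triple is spanned by its own brackets, hence survives in every term of the derived
  -- series.
  have key : ∀ k, (⟨h, hhB⟩ : B) ∈ derivedSeries K B k ∧ (⟨e, heB⟩ : B) ∈ derivedSeries K B k ∧
      (⟨f, hfB⟩ : B) ∈ derivedSeries K B k := by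
    intro k
    induction k with
    | zero => simp
    | succ k ih =>
      obtain ⟨ih₁, ih₂, ih₃⟩ := ih
      rw [LieAlgebra.derivedSeries, derivedSeriesOfIdeal_succ]
      have e₁ : (⟨h, hhB⟩ : B) = ⁅(⟨e, heB⟩ : B), (⟨f, hfB⟩ : B)⁆ := Subtype.ext t.lie_e_f.symm
      have e₂ : (⟨e, heB⟩ : B) = (2⁻¹ : K) • ⁅(⟨h, hhB⟩ : B), (⟨e, heB⟩ : B)⁆ := by
        refine Subtype.ext ?_
        change e = (2⁻¹ : K) • ⁅h, e⁆
        rw [t.lie_h_e_smul K, smul_smul, inv_mul_cancel₀ two_ne_zero, one_smul]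
      have e₃ : (⟨f, hfB⟩ : B) = (-2⁻¹ : K) • ⁅(⟨h, hhB⟩ : B), (⟨f, hfB⟩ : B)⁆ := by
        refine Subtype.ext ?_
        change f = (-2⁻¹ : K) • ⁅h, f⁆
        rw [t.lie_lie_smul_f K, neg_smul, smul_neg, neg_neg, smul_smul,
          inv_mul_cancel₀ two_ne_zero, one_smul]
      refine ⟨?_, ?_, ?_⟩
      · rw [e₁]; exact LieSubmodule.lie_mem_lie ih₂ ih₃
      · rw [e₂]; exact Submodule.smul_mem _ _ (LieSubmodule.lie_mem_lie ih₁ ih₂)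
      · rw [e₃]; exact Submodule.smul_mem _ _ (LieSubmodule.lie_mem_lie ih₁ ih₃)
  obtain ⟨k, hk⟩ := (isSolvable_iff K (L := B)).1 inferInstance
  have := (key k).1
  rw [hk, LieSubmodule.mem_bot] at this
  exact t.h_ne_zero (congrArg Subtype.val this)

/-- The roots of a subalgebra that contains the Cartan subalgebra are stable under the
reflections in such roots, as long as these reflections raise. -/
lemma LieSubalgebra.rootSpace_reflection_le (hHB : H ≤ B) {α β γ : Weight K H L}
    (hα : α.IsNonZero) (k : ℕ) (hk : k ≤ chainTopCoeff α β) (hγ : (γ : H → K) = k • (α : H → K) + β)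
    (hαB : (rootSpace H α).toSubmodule ≤ B.toSubmodule)
    (hβB : (rootSpace H β).toSubmodule ≤ B.toSubmodule) :
    (rootSpace H γ).toSubmodule ≤ B.toSubmodule := by
  induction k generalizing γ with
  | zero => rwa [hγ, zero_smul, zero_add]
  | succ k ih =>
    -- Root strings have no gaps, so adding α once at a time stays among the weights.
    have hne : rootSpace H (k • (α : H → K) + β) ≠ ⊥ := by
      have := (rootSpace_zsmul_add_ne_bot_iff α β hα k).2 ⟨by omega, by omega⟩
      rwa [natCast_zsmul] at this
    refine rootSpace_add_le hHB (β := ⟨_, hne⟩) hα ?_ hαB (ih (by omega) rfl)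
    rw [hγ, succ_nsmul', add_assoc]
    rfl

open Classical in
/-- The sum of the coroots of a subalgebra. -/
noncomputable def LieSubalgebra.corootSum (H B : LieSubalgebra K L) [H.IsCartanSubalgebra]
    [IsTriangularizable K H L] : H :=
  ∑ β ∈ Finset.univ.filter
    (fun β : H.root => (rootSpace H β.1).toSubmodule ≤ B.toSubmodule), coroot β.1

lemma LieSubalgebra.apply_corootSum_eq_intCast (α : Weight K H L) :
    ∃ n : ℤ, α (corootSum H B) = n := by
  classical
  refine ⟨∑ β ∈ Finset.univ.filter
    (fun β : H.root => (rootSpace H β.1).toSubmodule ≤ B.toSubmodule),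
      (chainBotCoeff β.1 α - chainTopCoeff β.1 α : ℤ), ?_⟩
  have h : α (corootSum H B) = Weight.toLinear K H L α (corootSum H B) := rfl
  rw [h, corootSum, map_sum, Int.cast_sum]
  exact Finset.sum_congr rfl fun β _ => apply_coroot_eq_cast β.1 α

/-- The value is the sum of the pairings ⟨α, β^∨⟩ over the roots β of `B`. If a term is negative,
the reflection in α moves β upwards along its α-string, hence to another root of `B`, and changes
the sign of the term. So the negative terms are cancelled by distinct positive ones. The term 2 of β
= α is not used up, because -α is not a root of `B`. No positive system is presupposed: `B` need not
be maximal here. -/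
lemma LieSubalgebra.apply_corootSum_pos [IsSolvable B] (hHB : H ≤ B) {α : Weight K H L}
    (hα : α.IsNonZero) (hαB : (rootSpace H α).toSubmodule ≤ B.toSubmodule) :
    ∃ n : ℕ, 0 < n ∧ α (corootSum H B) = n := by
  classical
  let P := rootSystem H
  let a : H.root := ⟨α, by simpa using hα⟩
  set s := Finset.univ.filter
    (fun β : H.root => (rootSpace H β.1).toSubmodule ≤ B.toSubmodule) with hs
  have hsum : α (corootSum H B) = ((∑ β ∈ s, P.pairingIn ℤ a β : ℤ) : K) := by
    have h : α (corootSum H B) = Weight.toLinear K H L α (corootSum H B) := rfl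
    rw [h, corootSum, map_sum, Int.cast_sum]
    refine Finset.sum_congr rfl fun β _ => ?_
    have := P.algebraMap_pairingIn ℤ a β
    rw [← eq_intCast (algebraMap ℤ K), this]
    rfl
  have has : a ∈ s := by simp [hs, a, hαB]
  let A := s.filter (fun β => P.pairingIn ℤ a β < 0)
  have hneg : ∀ β, P.pairingIn ℤ a (P.reflectionPerm a β) = - P.pairingIn ℤ a β := by
    intro β
    have h : P.pairing a (P.reflectionPerm a β) = - P.pairing a β := by
      rw [P.pairing_reflectionPerm, P.pairing_reflectionPerm_self_left]
    rw [← P.algebraMap_pairingIn ℤ, ← P.algebraMap_pairingIn ℤ a β, ← map_neg] at h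
    exact FaithfulSMul.algebraMap_injective ℤ K h
  have hAs : ∀ β ∈ A, P.reflectionPerm a β ∈ s := by
    intro β hβ
    obtain ⟨hβs, hβ⟩ := Finset.mem_filter.1 hβ
    rw [P.pairingIn_lt_zero_iff] at hβ
    have hc : P.pairingIn ℤ β a = chainBotCoeff α β.1 - chainTopCoeff α β.1 := by
      have h : P.pairing β a = ((chainBotCoeff α β.1 - chainTopCoeff α β.1 : ℤ) : K) :=
        apply_coroot_eq_cast α β.1
      rw [← P.algebraMap_pairingIn ℤ, eq_intCast] at h
      exact_mod_cast h
    obtain ⟨k, hk⟩ := Int.eq_ofNat_of_zero_le (a := - P.pairingIn ℤ β a) (by omega)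
    have hβB : (rootSpace H β.1).toSubmodule ≤ B.toSubmodule := (Finset.mem_filter.1 hβs).2
    refine Finset.mem_filter.2 ⟨Finset.mem_univ _,
      rootSpace_reflection_le hHB hα k (by omega) ?_ hαB hβB⟩
    have h := P.root_reflectionPerm a β
    rw [P.reflection_apply_root, ← P.algebraMap_pairingIn ℤ, eq_intCast] at h
    have h' := congrArg (fun g : Module.Dual K H => (g : H → K)) h
    have e : P.pairingIn ℤ β a = - (k : ℤ) := by omega
    simp only [e] at h'
    have h'' : ((P.reflectionPerm a β).1 : H → K) = β.1 - ((- (k : ℤ) : ℤ) : K) • (α : H → K) := h'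
    rw [h'']
    ext x
    simp
    ring
  have hna : P.reflectionPerm a a ∉ s := by
    intro hβ
    have hβB := (Finset.mem_filter.1 hβ).2
    have h := P.root_reflectionPerm a a
    rw [P.reflection_apply_self] at h
    have h' : ((P.reflectionPerm a a).1 : H → K) = -α :=
      congrArg (fun g : Module.Dual K H => (g : H → K)) h
    rw [h'] at hβB
    exact not_rootSpace_neg_le hα hαB hβB
  have hpos : 0 < ∑ β ∈ s, P.pairingIn ℤ a β := by
    have haA : a ∉ A.image (P.reflectionPerm a) := by
      intro h
      obtain ⟨β, hβ, h⟩ := Finset.mem_image.1 h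
      have h' : P.reflectionPerm a a = β := by
        rw [← P.reflectionPerm_self a β, h]
      exact hna (h' ▸ (Finset.mem_filter.1 hβ).1)
    have hsub : insert a (A.image (P.reflectionPerm a)) ⊆
        s.filter (fun β => ¬ P.pairingIn ℤ a β < 0) := by
      intro β hβ
      rw [Finset.mem_insert, Finset.mem_image] at hβ
      rcases hβ with rfl | ⟨β, hβ, rfl⟩
      · refine Finset.mem_filter.2 ⟨has, ?_⟩
        rw [P.pairingIn_same]; norm_num
      · refine Finset.mem_filter.2 ⟨hAs β hβ, ?_⟩
        have := (Finset.mem_filter.1 hβ).2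
        rw [hneg]; omega
    have h := Finset.sum_le_sum_of_subset_of_nonneg (f := fun β => P.pairingIn ℤ a β) hsub
      (fun β hβ _ => not_lt.1 (Finset.mem_filter.1 hβ).2)
    rw [Finset.sum_insert haA,
      Finset.sum_image (fun _ _ _ _ h => (P.reflectionPerm a).injective h),
      Finset.sum_congr rfl (fun β _ => hneg β), Finset.sum_neg_distrib, P.pairingIn_same] at h
    have h' := Finset.sum_filter_add_sum_filter_not s (fun β => P.pairingIn ℤ a β < 0)
      (fun β => P.pairingIn ℤ a β)
    change ∑ β ∈ A, P.pairingIn ℤ a β + _ = _ at h'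
    omega
  obtain ⟨n, hn⟩ := Int.eq_ofNat_of_zero_le hpos.le
  exact ⟨n, by omega, by rw [hsum, hn]; simp⟩

end RootCombinatorics

/-! ### Gradings defined by an element of the Cartan subalgebra -/

section Grading

open LieModule LieAlgebra LieAlgebra.IsKilling Module

variable {K L : Type*} [Field K] [CharZero K] [LieRing L] [LieAlgebra K L]

/-- A subalgebra with a descending filtration whose successive steps contain brackets is
solvable. -/
lemma LieSubalgebra.isSolvable_of_filtration (q : LieSubalgebra K L) (F : ℕ → Submodule K L)
    (h0 : q.toSubmodule ≤ F 0) (hF : ∀ k, ∀ x ∈ F k, ∀ y ∈ F k, ⁅x, y⁆ ∈ F (k + 1))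
    (N : ℕ) (hN : F N = ⊥) : IsSolvable q := by
  have key : ∀ k, (LieAlgebra.derivedSeries K q k).toSubmodule ≤ (F k).comap q.toSubmodule.subtype := by
    intro k
    induction k with
    | zero => exact fun x _ => h0 x.2
    | succ k ih =>
      rw [LieAlgebra.derivedSeries, derivedSeriesOfIdeal_succ,
        LieSubmodule.lieIdeal_oper_eq_linear_span', Submodule.span_le]
      rintro _ ⟨x, hx, y, hy, rfl⟩
      exact hF k _ (ih hx) _ (ih hy)
  refine (isSolvable_iff K (L := q)).2 ⟨N, ?_⟩
  rw [LieSubmodule.eq_bot_iff]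
  intro x hx
  have : (x : L) ∈ F N := key N hx
  rw [hN, Submodule.mem_bot] at this
  exact Subtype.ext this

variable [IsKilling K L] [FiniteDimensional K L]
  {H : LieSubalgebra K L} [H.IsCartanSubalgebra] [IsTriangularizable K H L]

/-- The sum of the root spaces (including the Cartan subalgebra) on which the eigenvalue of `h₀`
is an integer in `S`. -/
noncomputable def gradedPart (h₀ : H) (S : Set ℤ) : Submodule K L :=
  ⨆ (α : Weight K H L) (_ : ∃ n ∈ S, α h₀ = (n : K)), (rootSpace H α).toSubmodule

variable {h₀ : H} {S S' S'' : Set ℤ}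

lemma rootSpace_le_gradedPart {α : Weight K H L} {n : ℤ} (hn : n ∈ S) (hα : α h₀ = n) :
    (rootSpace H α).toSubmodule ≤ gradedPart h₀ S :=
  le_iSup₂_of_le (f := fun (α : Weight K H L) (_ : ∃ n ∈ S, α h₀ = (n : K)) =>
    (rootSpace H α).toSubmodule) α ⟨n, hn, hα⟩ le_rfl

lemma gradedPart_induction {p : L → Prop} (h0 : p 0) (hadd : ∀ x y, p x → p y → p (x + y))
    (hroot : ∀ (α : Weight K H L) (n : ℤ), n ∈ S → α h₀ = n → ∀ x ∈ rootSpace H α, p x)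
    {x : L} (hx : x ∈ gradedPart h₀ S) : p x := by
  rw [gradedPart, iSup_subtype'] at hx
  induction hx using Submodule.iSup_induction' with
  | zero => exact h0
  | add x y _ _ hx hy => exact hadd x y hx hy
  | mem α x hx =>
    obtain ⟨α, n, hn, hα⟩ := α
    exact hroot α n hn hα x hx

lemma gradedPart_mono (h : S ⊆ S') : gradedPart h₀ S ≤ gradedPart h₀ S' := fun _ hx =>
  gradedPart_induction (zero_mem _) (fun _ _ => add_mem)
    (fun _ _ hn hα _ hx => rootSpace_le_gradedPart (h hn) hα hx) hx

lemma lie_mem_gradedPart (hS : ∀ a ∈ S, ∀ b ∈ S', a + b ∈ S'') {x y : L}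
    (hx : x ∈ gradedPart h₀ S) (hy : y ∈ gradedPart h₀ S') : ⁅x, y⁆ ∈ gradedPart h₀ S'' := by
  refine gradedPart_induction (p := fun x => ⁅x, y⁆ ∈ gradedPart h₀ S'') (by simp)
    (fun x x' hx hx' => by rw [add_lie]; exact add_mem hx hx') (fun α a ha hα x hx => ?_) hx
  refine gradedPart_induction (p := fun y => ⁅x, y⁆ ∈ gradedPart h₀ S'') (by simp)
    (fun y y' hy hy' => by rw [lie_add]; exact add_mem hy hy') (fun β b hb hβ y hy => ?_) hy
  have hxy : ⁅x, y⁆ ∈ rootSpace H (α + β : H → K) := lie_mem_genWeightSpace_of_mem_genWeightSpace hx hy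
  by_cases hne : rootSpace H (α + β : H → K) = ⊥
  · rw [hne, LieSubmodule.mem_bot] at hxy
    rw [hxy]
    exact zero_mem _
  · exact rootSpace_le_gradedPart (α := ⟨_, hne⟩) (hS a ha b hb)
      (show α h₀ + β h₀ = _ by rw [hα, hβ, Int.cast_add]) hxy

variable (h₀) in
/-- The part of the grading given by a set of degrees that is closed under addition. -/
noncomputable def gradedSubalgebra (S : Set ℤ) (hS : ∀ a ∈ S, ∀ b ∈ S, a + b ∈ S) :
    LieSubalgebra K L :=
  { gradedPart h₀ S with
    lie_mem' := fun hx hy => lie_mem_gradedPart hS hx hy }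

lemma cartan_le_gradedPart (h : (0 : ℤ) ∈ S) : H.toSubmodule ≤ gradedPart h₀ S := by
  intro x hx
  have hx' : x ∈ rootSpace H (0 : H → K) := by
    rw [rootSpace_zero_eq]; exact hx
  by_cases hne : rootSpace H (0 : H → K) = ⊥
  · rw [hne, LieSubmodule.mem_bot] at hx'
    rw [hx']
    exact zero_mem _
  · exact rootSpace_le_gradedPart (α := ⟨_, hne⟩) h (by simp) hx'

variable (h₀) in
-- There are finitely many weights, so the degrees are bounded above.
lemma exists_gradedPart_eq_bot : ∃ N : ℕ, gradedPart h₀ {n : ℤ | (N : ℤ) ≤ n} = ⊥ := by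
  have hfin : (Set.range fun α : Weight K H L => α h₀).Finite := Set.finite_range _
  have hfin' : {n : ℤ | ∃ α : Weight K H L, α h₀ = n}.Finite :=
    (hfin.preimage (f := fun n : ℤ => (n : K)) (Int.cast_injective.injOn)).subset
      (fun n ⟨α, hα⟩ => ⟨α, hα⟩)
  obtain ⟨M, hM⟩ := hfin'.bddAbove
  refine ⟨M.toNat + 1, ?_⟩
  rw [gradedPart, iSup₂_eq_bot]
  rintro α ⟨n, hn, hα⟩
  have := hM ⟨α, hα⟩
  simp only [Set.mem_ofPred_eq, Nat.cast_add, Nat.cast_one] at hn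
  omega

lemma disjoint_gradedPart (h : Disjoint S S') : Disjoint (gradedPart h₀ S) (gradedPart h₀ S') := by
  have hi : iSupIndep fun α : Weight K H L => (rootSpace H α).toSubmodule :=
    LieSubmodule.iSupIndep_toSubmodule.2 (iSupIndep_genWeightSpace' K H L)
  refine hi.disjoint_biSup_biSup (s := {α : Weight K H L | ∃ n ∈ S, α h₀ = (n : K)})
    (t := {α : Weight K H L | ∃ n ∈ S', α h₀ = (n : K)}) ?_
  refine Set.disjoint_left.2 ?_
  rintro α ⟨n, hn, hα⟩ ⟨m, hm, hα'⟩
  have : n = m := Int.cast_injective (hα.symm.trans hα')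
  exact Set.disjoint_left.1 h hn (this ▸ hm)

lemma gradedPart_sup (hh₀ : ∀ α : Weight K H L, ∃ n : ℤ, α h₀ = n) (h : S ∪ S' = Set.univ) :
    gradedPart h₀ S ⊔ gradedPart h₀ S' = ⊤ := by
  rw [eq_top_iff]
  intro x _
  have hx : x ∈ ⨆ α : Weight K H L, rootSpace H α := by
    rw [iSup_genWeightSpace_eq_top']
    exact LieSubmodule.mem_top x
  induction hx using LieSubmodule.iSup_induction' with
  | zero => exact zero_mem _
  | add x y _ _ hx hy => exact add_mem (hx trivial) (hy trivial)
  | mem α x hx =>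
    obtain ⟨n, hn⟩ := hh₀ α
    rcases (h ▸ Set.mem_univ n : n ∈ S ∪ S') with h | h
    · exact Submodule.mem_sup_left (rootSpace_le_gradedPart h hn hx)
    · exact Submodule.mem_sup_right (rootSpace_le_gradedPart h hn hx)

/-- A subspace that contains the root spaces of a subalgebra containing the Cartan subalgebra
contains that subalgebra. -/
lemma LieSubalgebra.le_of_rootSpace_le {B : LieSubalgebra K L} (hHB : H ≤ B) {V : Submodule K L}
    (hV : ∀ α : Weight K H L, (rootSpace H α).toSubmodule ≤ B.toSubmodule →
      (rootSpace H α).toSubmodule ≤ V) : B.toSubmodule ≤ V := by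
  -- Being stable under 𝔥, the subalgebra is the sum of its intersections with the root spaces.
  -- These are lines for nonzero roots, so a nonzero intersection is the whole root space.
  let N : LieSubmodule K H L :=
    { B.toSubmodule with
      lie_mem := fun {x m} hm => B.lie_mem (hHB x.2) hm }
  have hN : N.toSubmodule = B.toSubmodule := rfl
  rw [← hN, eq_iSup_inf_genWeightSpace K H L N, LieSubmodule.iSup_toSubmodule]
  refine iSup_le fun α => ?_
  rintro x ⟨hxB, hx⟩
  by_cases hx0 : x = 0
  · exact hx0 ▸ zero_mem V
  by_cases hα : α.IsZero
  · refine hV α ?_ hx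
    rw [hα.eq, rootSpace_zero_eq, LieSubalgebra.coe_toLieSubmodule]
    exact hHB
  · exact hV α (rootSpace_le_of_mem hα hx hx0 hxB) hx

end Grading

/-! ### A Borel subalgebra and its opposite as halves of a grading -/

section Borel

open LieModule LieAlgebra LieAlgebra.IsKilling Module LieSubalgebra

variable {𝔤 : Type u} [LieRing 𝔤] [LieAlgebra ℂ 𝔤] [FiniteDimensional ℂ 𝔤]
  [LieAlgebra.IsSemisimple ℂ 𝔤] {𝔥 : LieSubalgebra ℂ 𝔤} [𝔥.IsCartanSubalgebra]
  {𝔟 : LieSubalgebra ℂ 𝔤}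

namespace LieSubalgebra.IsBorel

/-- Let G₁ be the part of positive degree. Then 𝔥 + 𝔤_α + G₁ is a solvable subalgebra: 𝔥 is abelian,
𝔤_α is a line, and α has degree ≥ 0. It contains 𝔟, whose nonzero roots have positive degree, so by
maximality it equals 𝔟. Degree 0 is admitted on purpose, to exclude afterwards nonzero roots of
degree 0. -/
lemma rootSpace_le (h𝔟 : 𝔟.IsBorel) (h𝔥𝔟 : 𝔥 ≤ 𝔟) {α : Weight ℂ 𝔥 𝔤} {n : ℕ}
    (hn : α (corootSum 𝔥 𝔟) = n) : (rootSpace 𝔥 α).toSubmodule ≤ 𝔟.toSubmodule := by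
  have : LieAlgebra.IsSolvable 𝔟 := h𝔟.prop
  by_cases hα : α.IsZero
  · rw [hα.eq, rootSpace_zero_eq, LieSubalgebra.coe_toLieSubmodule]
    exact h𝔥𝔟
  set h₀ := corootSum 𝔥 𝔟
  let G : ℕ → Submodule ℂ 𝔤 := fun k => gradedPart h₀ {m : ℤ | (k : ℤ) ≤ m}
  have hGG : ∀ j k, ∀ x ∈ G j, ∀ y ∈ G k, ⁅x, y⁆ ∈ G (j + k) := fun j k x hx y hy =>
    lie_mem_gradedPart (fun a ha b hb => by
      simp only [Set.mem_ofPred_eq, Nat.cast_add] at *; omega) hx hy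
  have hG0 : 𝔥.toSubmodule ≤ G 0 := cartan_le_gradedPart (by simp)
  have hαG : (rootSpace 𝔥 α).toSubmodule ≤ G 0 :=
    rootSpace_le_gradedPart (n := n) (by simp) (by rw [hn]; simp)
  have hGle : ∀ j k, j ≤ k → G k ≤ G j := fun j k hjk => gradedPart_mono fun a ha => by
    simp only [Set.mem_ofPred_eq] at *; omega
  let U := (rootSpace 𝔥 α).toSubmodule ⊔ G 1
  have hUG : U ≤ G 0 := sup_le hαG (hGle 0 1 zero_le_one)
  have hUU : ∀ x ∈ U, ∀ y ∈ U, ⁅x, y⁆ ∈ G 1 := by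
    intro x hx y hy
    obtain ⟨a, ha, b, hb, rfl⟩ := Submodule.mem_sup.1 hx
    obtain ⟨c, hc, d, hd, rfl⟩ := Submodule.mem_sup.1 hy
    have hac : ⁅a, c⁆ = 0 := by
      by_cases ha0 : a = 0
      · rw [ha0, zero_lie]
      · obtain ⟨t, rfl⟩ := exists_smul_eq_of_mem_rootSpace hα ha ha0 hc
        rw [lie_smul, lie_self, smul_zero]
    rw [lie_add, add_lie, hac, zero_add]
    exact add_mem (hGG 1 0 _ hb _ (hαG hc)) (hGG 0 1 _ (hUG hx) _ hd)
  have hHU : ∀ x ∈ 𝔥, ∀ y ∈ U, ⁅x, y⁆ ∈ U := by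
    intro x hx y hy
    obtain ⟨c, hc, d, hd, rfl⟩ := Submodule.mem_sup.1 hy
    rw [lie_add]
    refine add_mem (Submodule.mem_sup_left ?_)
      (Submodule.mem_sup_right (hGG 0 1 _ (hG0 hx) _ hd))
    exact (rootSpace 𝔥 α).lie_mem (x := ⟨x, hx⟩) hc
  have hHH : ∀ x ∈ 𝔥, ∀ y ∈ 𝔥, ⁅x, y⁆ = 0 := fun x hx y hy =>
    congrArg Subtype.val (trivial_lie_zero 𝔥 𝔥 ⟨x, hx⟩ ⟨y, hy⟩)
  have hQ : ∀ x ∈ 𝔥.toSubmodule ⊔ U, ∀ y ∈ 𝔥.toSubmodule ⊔ U, ⁅x, y⁆ ∈ U := by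
    intro x hx y hy
    obtain ⟨a, ha, b, hb, rfl⟩ := Submodule.mem_sup.1 hx
    obtain ⟨c, hc, d, hd, rfl⟩ := Submodule.mem_sup.1 hy
    rw [lie_add, add_lie, add_lie, hHH a ha c hc, zero_add]
    refine add_mem ?_ (add_mem (hHU a ha d hd) (Submodule.mem_sup_right (hUU b hb d hd)))
    rw [← lie_skew]
    exact neg_mem (hHU c hc b hb)
  let q : LieSubalgebra ℂ 𝔤 :=
    { 𝔥.toSubmodule ⊔ U with
      lie_mem' := fun hx hy => Submodule.mem_sup_right (hQ _ hx _ hy) }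
  obtain ⟨N, hN⟩ := exists_gradedPart_eq_bot h₀
  have hq : LieAlgebra.IsSolvable q := by
    refine isSolvable_of_filtration q
      -- The first two steps remove 𝔥 and the line 𝔤_α; from then on brackets raise the degree.
      (fun k => match k with
        | 0 => 𝔥.toSubmodule ⊔ U
        | 1 => U
        | (k + 2) => G (k + 1)) le_rfl ?_ (N + 2) ?_
    · rintro (_ | _ | k) x hx y hy
      · exact hQ x hx y hy
      · exact hUU x hx y hy
      · exact hGle _ _ (by omega) (hGG _ _ x hx y hy)
    · exact _root_.eq_bot_iff.2 ((hGle N (N + 1) (by omega)).trans hN.le)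
  have hle : 𝔟 ≤ q := by
    change 𝔟.toSubmodule ≤ 𝔥.toSubmodule ⊔ U
    refine le_of_rootSpace_le h𝔥𝔟 fun β hβ𝔟 => ?_
    by_cases hβ : β.IsZero
    · rw [hβ.eq, rootSpace_zero_eq, LieSubalgebra.coe_toLieSubmodule]
      exact le_sup_left
    · obtain ⟨m, hm, hβm⟩ := apply_corootSum_pos h𝔥𝔟 hβ hβ𝔟
      refine le_trans ?_ (le_sup_right.trans le_sup_right)
      exact rootSpace_le_gradedPart (n := m) (by
        change ((1 : ℕ) : ℤ) ≤ m; exact_mod_cast hm) (by rw [hβm]; simp)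
  have hge : q ≤ 𝔟 := h𝔟.2 hq hle
  exact le_trans (le_sup_left.trans le_sup_right) (show 𝔥.toSubmodule ⊔ U ≤ 𝔟.toSubmodule from hge)

lemma toSubmodule_eq (h𝔟 : 𝔟.IsBorel) (h𝔥𝔟 : 𝔥 ≤ 𝔟) :
    𝔟.toSubmodule = gradedPart (corootSum 𝔥 𝔟) {n : ℤ | 0 ≤ n} := by
  have : LieAlgebra.IsSolvable 𝔟 := h𝔟.prop
  apply le_antisymm
  · refine le_of_rootSpace_le h𝔥𝔟 fun β hβ𝔟 => ?_
    by_cases hβ : β.IsZero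
    · exact rootSpace_le_gradedPart (n := 0) (by simp) (by rw [hβ.eq]; simp)
    · obtain ⟨m, hm, hβm⟩ := apply_corootSum_pos h𝔥𝔟 hβ hβ𝔟
      exact rootSpace_le_gradedPart (n := m) (by simp) (by rw [hβm]; simp)
  · exact fun x hx => gradedPart_induction (zero_mem _) (fun _ _ => add_mem)
      (fun α n hn hα x hx => h𝔟.rootSpace_le h𝔥𝔟 (n := n.toNat) (by
        rw [hα, ← Int.cast_natCast, Int.toNat_of_nonneg hn]) hx) hx

/-- A nonzero root of degree 0 would belong to 𝔟 by `rootSpace_le` and then have positive degree. -/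
lemma isZero_of_apply_eq_zero (h𝔟 : 𝔟.IsBorel) (h𝔥𝔟 : 𝔥 ≤ 𝔟) {α : Weight ℂ 𝔥 𝔤}
    (hα : α (corootSum 𝔥 𝔟) = 0) : α.IsZero := by
  have : LieAlgebra.IsSolvable 𝔟 := h𝔟.prop
  by_contra h
  obtain ⟨m, hm, hαm⟩ := apply_corootSum_pos h𝔥𝔟 h (h𝔟.rootSpace_le h𝔥𝔟 (n := 0) (by simpa using hα))
  rw [hα] at hαm
  exact hm.ne (by exact_mod_cast hαm)

lemma gradedPart_zero (h𝔟 : 𝔟.IsBorel) (h𝔥𝔟 : 𝔥 ≤ 𝔟) :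
    gradedPart (corootSum 𝔥 𝔟) {0} = 𝔥.toSubmodule := by
  apply le_antisymm
  · refine fun x hx => gradedPart_induction (zero_mem _) (fun _ _ => add_mem)
      (fun α n hn hα x hx => ?_) hx
    obtain rfl : n = 0 := hn
    have h0 := h𝔟.isZero_of_apply_eq_zero h𝔥𝔟 (by simpa using hα)
    rw [h0.eq, rootSpace_zero_eq] at hx
    exact hx
  · exact cartan_le_gradedPart rfl

lemma oppositeBorel_toSubmodule_eq (h𝔟 : 𝔟.IsBorel) (h𝔥𝔟 : 𝔥 ≤ 𝔟) :
    (DeformedO.oppositeBorel 𝔥 𝔟).toSubmodule = gradedPart (corootSum 𝔥 𝔟) {n : ℤ | n ≤ 0} := by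
  have : LieAlgebra.IsSolvable 𝔟 := h𝔟.prop
  let C := gradedSubalgebra (corootSum 𝔥 𝔟) {n : ℤ | n ≤ 0} (fun a ha b hb => by
    simp only [Set.mem_ofPred_eq] at *; omega)
  apply le_antisymm
  · change DeformedO.oppositeBorel 𝔥 𝔟 ≤ C
    rw [DeformedO.oppositeBorel, LieSubalgebra.lieSpan_le]
    refine Set.iUnion₂_subset fun α hα x hx => ?_
    change x ∈ gradedPart _ _
    change x ∈ rootSpace 𝔥 (-α) at hx
    -- The generating set is indexed by all functions α on 𝔥. If -α is not a weight, its
    -- contribution is zero; otherwise α is the negative of a weight, hence a weight.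
    by_cases hne : rootSpace 𝔥 (-α) = ⊥
    · rw [hne, LieSubmodule.mem_bot] at hx
      rw [hx]
      exact zero_mem _
    · let β : Weight ℂ 𝔥 𝔤 := ⟨-α, hne⟩
      have hβ : ((-β : Weight ℂ 𝔥 𝔤) : 𝔥 → ℂ) = α := by rw [Weight.coe_neg]; exact neg_neg α
      by_cases hβ0 : β.IsZero
      · exact rootSpace_le_gradedPart (α := β) (n := 0) (by simp) (by rw [hβ0.eq]; simp) hx
      · obtain ⟨m, hm, hβm⟩ := apply_corootSum_pos h𝔥𝔟 (α := -β) (Weight.IsNonZero.neg hβ0)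
          (by rw [hβ]; exact hα)
        refine rootSpace_le_gradedPart (α := β) (n := -m) (by simp) ?_ hx
        rw [Weight.coe_neg, Pi.neg_apply] at hβm
        rw [← neg_neg (β _), hβm]
        simp
  · refine fun x hx => gradedPart_induction (zero_mem _) (fun _ _ => add_mem)
      (fun α n hn hα x hx => ?_) hx
    refine LieSubalgebra.subset_lieSpan ?_
    refine Set.mem_iUnion₂.2 ⟨-α, ?_, by rwa [neg_neg]⟩
    have hn' : n ≤ 0 := hn
    refine h𝔟.rootSpace_le h𝔥𝔟 (α := -α) (n := (-n).toNat) ?_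
    rw [Weight.coe_neg, Pi.neg_apply, hα, ← Int.cast_natCast, Int.toNat_of_nonneg (by omega),
      Int.cast_neg]

/-- In a bracket of elements of 𝔟 the product of the degree 0 parts vanishes, 𝔥 being abelian; all
other terms have positive degree. This inclusion is all that is needed, both for local finiteness
and for the characters of 𝔟. -/
lemma nilrad_le (h𝔟 : 𝔟.IsBorel) (h𝔥𝔟 : 𝔥 ≤ 𝔟) :
    DeformedO.nilrad 𝔟 ≤ gradedPart (corootSum 𝔥 𝔟) {n : ℤ | 0 < n} := by
  have hHH : ∀ x ∈ 𝔥, ∀ y ∈ 𝔥, ⁅x, y⁆ = 0 := fun x hx y hy =>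
    congrArg Subtype.val (trivial_lie_zero 𝔥 𝔥 ⟨x, hx⟩ ⟨y, hy⟩)
  have hdec : ∀ x ∈ 𝔟, ∃ a ∈ gradedPart (corootSum 𝔥 𝔟) {0},
      ∃ b ∈ gradedPart (corootSum 𝔥 𝔟) {n : ℤ | 0 < n}, a + b = x := by
    intro x hx
    rw [← LieSubalgebra.mem_toSubmodule, h𝔟.toSubmodule_eq h𝔥𝔟] at hx
    rw [← Submodule.mem_sup]
    refine gradedPart_induction (zero_mem _) (fun _ _ => add_mem) (fun α n hn hα x hx => ?_) hx
    rcases (show 0 ≤ n from hn).eq_or_lt with h | h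
    · exact Submodule.mem_sup_left (rootSpace_le_gradedPart (n := n) h.symm hα hx)
    · exact Submodule.mem_sup_right (rootSpace_le_gradedPart (n := n) h hα hx)
  have hD : (LieAlgebra.derivedSeries ℂ 𝔟 1).toSubmodule =
      Submodule.span ℂ {⁅x, y⁆ | (x : 𝔟) (y : 𝔟)} := coe_derivedSeries_one_eq ℂ 𝔟
  rw [DeformedO.nilrad, hD, Submodule.map_span, Submodule.span_le]
  rintro _ ⟨_, ⟨x, y, rfl⟩, rfl⟩
  change ⁅(x : 𝔤), (y : 𝔤)⁆ ∈ gradedPart _ _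
  obtain ⟨a, ha, b, hb, e⟩ := hdec x x.2
  obtain ⟨c, hc, d, hd, e'⟩ := hdec y y.2
  have hac : ⁅a, c⁆ = 0 := by
    rw [h𝔟.gradedPart_zero h𝔥𝔟] at ha hc
    exact hHH a ha c hc
  rw [← e, ← e', lie_add, add_lie, add_lie, hac, zero_add]
  refine add_mem (lie_mem_gradedPart ?_ hb hc) (add_mem (lie_mem_gradedPart ?_ ha hd)
    (lie_mem_gradedPart ?_ hb hd))
  all_goals
    intro a ha b hb
    simp only [Set.mem_ofPred_eq, Set.mem_singleton_iff] at *
    omega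

end LieSubalgebra.IsBorel

end Borel

namespace DeformedO

/-! ### Deformed weight spaces and the triangular decomposition -/

section Weights

attribute [local instance 100] LieRing.ofAssociativeRing

open LieModule LieAlgebra LieSubalgebra

variable {𝔤 : Type u} {T : Type v} [LieRing 𝔤] [LieAlgebra ℂ 𝔤] [CommRing T] [Algebra ℂ T]

lemma lieElt_add (x y : 𝔤) : lieElt T (x + y) = lieElt T x + lieElt T y := by
  rw [lieElt, map_add, TensorProduct.tmul_add]; rfl

lemma lieElt_zero : lieElt T (0 : 𝔤) = 0 := by
  rw [lieElt, map_zero, TensorProduct.tmul_zero]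

lemma lieElt_smul (c : ℂ) (x : 𝔤) : lieElt T (c • x) = algebraMap ℂ T c • lieElt T x := by
  rw [lieElt, map_smul, TensorProduct.tmul_smul, algebraMap_smul]; rfl

lemma lieElt_mul (x y : 𝔤) :
    lieElt T x * lieElt T y = lieElt T y * lieElt T x + lieElt T ⁅x, y⁆ := by
  simp only [lieElt, LieHom.map_lie, LieRing.of_associative_ring_bracket, TensorProduct.tmul_sub,
    Algebra.TensorProduct.tmul_mul_tmul, mul_one]
  abel

lemma lieElt_smul_smul {M : Bimod 𝔤 T} (x y : 𝔤) (m : M) :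
    lieElt T x • lieElt T y • m = lieElt T y • lieElt T x • m + lieElt T ⁅x, y⁆ • m := by
  rw [smul_smul, lieElt_mul, add_smul, mul_smul]

lemma tmul_eq_smul (t : T) (w : UniversalEnvelopingAlgebra ℂ 𝔤) :
    (t ⊗ₜ[ℂ] w : BimodAlg 𝔤 T) = t • (1 ⊗ₜ[ℂ] w) := by
  rw [TensorProduct.smul_tmul', smul_eq_mul, mul_one]

lemma hom_smul {M N : Bimod 𝔤 T} (f : M ⟶ N) (t : T) (m : M) : f.hom (t • m) = t • f.hom m := by
  rw [← algebraMap_smul (BimodAlg 𝔤 T), map_smul, algebraMap_smul]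

/-- A `T`-submodule of a bimodule that is stable under `𝔤` is a sub-bimodule. -/
def submoduleOfLieStable {M : Bimod 𝔤 T} (P : Submodule T M)
    (hP : ∀ (x : 𝔤), ∀ m ∈ P, lieElt T x • m ∈ P) : Submodule (BimodAlg 𝔤 T) M :=
  { P.toAddSubmonoid with
    smul_mem' := fun a m hm => by
      change m ∈ P at hm
      change a • m ∈ P
      induction a using bimodAlg_induction generalizing m with
      | hT t => rw [algebraMap_smul]; exact Submodule.smul_mem _ _ hm
      | hx x => exact hP x m hm
      | hadd a b ha hb => rw [add_smul]; exact add_mem (ha _ hm) (hb _ hm)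
      | hmul a b ha hb => rw [mul_smul]; exact ha _ (hb _ hm) }

section

variable {𝔥 : LieSubalgebra ℂ 𝔤} (φ : SymmetricAlgebra ℂ 𝔥 →ₐ[ℂ] T)

lemma mem_weightSpace_iff {M : Bimod 𝔤 T} {ν : Module.Dual ℂ 𝔥} {m : M} :
    m ∈ weightSpace 𝔥 φ ν M ↔ ∀ H : 𝔥, lieElt T (H : 𝔤) • m =
      (algebraMap ℂ T (ν H) + φ (SymmetricAlgebra.ι ℂ 𝔥 H)) • m := by
  refine forall_congr' fun H => ?_
  rw [sub_smul, sub_eq_iff_eq_add, add_smul, IsScalarTower.algebraMap_apply ℂ T (BimodAlg 𝔤 T),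
    algebraMap_smul, add_comm]

lemma hom_mem_weightSpace {M N : Bimod 𝔤 T} (f : M ⟶ N) {ν : Module.Dual ℂ 𝔥} {m : M}
    (hm : m ∈ weightSpace 𝔥 φ ν M) : f.hom m ∈ weightSpace 𝔥 φ ν N :=
  (restrictWeight φ ν f ⟨m, hm⟩).2

lemma mem_weightSpace_of_injective {M N : Bimod 𝔤 T} (f : M ⟶ N)
    (hf : Function.Injective f.hom) {ν : Module.Dual ℂ 𝔥} {m : M}
    (hm : f.hom m ∈ weightSpace 𝔥 φ ν N) : m ∈ weightSpace 𝔥 φ ν M := by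
  rw [mem_weightSpace_iff] at hm ⊢
  intro H
  apply hf
  rw [map_smul, hm, hom_smul]

lemma iSupIndep_weightSpace (M : Bimod 𝔤 T) : iSupIndep fun ν => weightSpace 𝔥 φ ν M := by
  classical
  rw [iSupIndep_iff_finsetSum_eq_zero_imp_eq_zero]
  intro s n hn h0 ν hν
  have h := weightSpace_component_mem φ (⊥ : Submodule (BimodAlg 𝔤 T) M) s
    -- `weightSpace_component_mem` asks for a weight vector for every weight, so the family is
    -- extended by zero.
    (fun μ => if μ ∈ s then n μ else 0)
    (fun μ => by split_ifs with h; exacts [hn μ h, zero_mem _])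
    (by
      rw [Submodule.mem_bot, ← h0]
      exact Finset.sum_congr rfl fun μ hμ => by rw [if_pos hμ]) ν hν
  simpa [hν] using h

lemma isCompl_weightSpace {M : Bimod 𝔤 T} (hM : ⨆ ν, weightSpace 𝔥 φ ν M = ⊤)
    (μ : Module.Dual ℂ 𝔥) :
    IsCompl (weightSpace 𝔥 φ μ M) (⨆ (ν) (_ : ν ≠ μ), weightSpace 𝔥 φ ν M) := by
  refine ⟨iSupIndep_weightSpace φ M μ, codisjoint_iff.2 (eq_top_iff.2 ?_)⟩
  rw [← hM]
  refine iSup_le fun ν => ?_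
  by_cases h : ν = μ
  · exact h ▸ le_sup_left
  · exact le_trans (le_iSup₂_of_le (f := fun ν (_ : ν ≠ μ) => weightSpace 𝔥 φ ν M) ν h le_rfl)
      le_sup_right

end

variable {𝔥 : LieSubalgebra ℂ 𝔤} [FiniteDimensional ℂ 𝔤] [𝔥.IsCartanSubalgebra]
  (φ : SymmetricAlgebra ℂ 𝔥 →ₐ[ℂ] T)

lemma cartanProj_coe (H : 𝔥) : cartanProj 𝔥 (H : 𝔤) = H :=
  Submodule.projectionOnto_apply_left (isCompl_rootSpaces 𝔥) H

lemma cartanProj_of_mem_rootSpace {α : Weight ℂ 𝔥 𝔤} (hα : α.IsNonZero) {x : 𝔤}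
    (hx : x ∈ rootSpace 𝔥 α) : cartanProj 𝔥 x = 0 := by
  refine Submodule.projectionOnto_apply_of_mem_right (isCompl_rootSpaces 𝔥) ?_
  exact le_iSup₂_of_le (f := fun (α : 𝔥 → ℂ) (_ : α ∈ {α : 𝔥 → ℂ | α ≠ 0}) =>
    (rootSpace 𝔥 α).toSubmodule) α (fun h => hα h) le_rfl hx

lemma deformedChar_coe (ν : Module.Dual ℂ 𝔥) (H : 𝔥) :
    deformedChar φ ν (H : 𝔤) = algebraMap ℂ T (ν H) + φ (SymmetricAlgebra.ι ℂ 𝔥 H) := by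
  simp [deformedChar, cartanProj_coe]

lemma deformedChar_of_mem_rootSpace (ν : Module.Dual ℂ 𝔥) {α : Weight ℂ 𝔥 𝔤} (hα : α.IsNonZero)
    {x : 𝔤} (hx : x ∈ rootSpace 𝔥 α) : deformedChar φ ν x = 0 := by
  simp [deformedChar, cartanProj_of_mem_rootSpace hα hx]

lemma mem_weightSpace_iff_deformedChar {M : Bimod 𝔤 T} {ν : Module.Dual ℂ 𝔥} {m : M} :
    m ∈ weightSpace 𝔥 φ ν M ↔ ∀ H : 𝔥, lieElt T (H : 𝔤) • m = deformedChar φ ν (H : 𝔤) • m := by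
  simp only [mem_weightSpace_iff, deformedChar_coe]

variable [LieAlgebra.IsSemisimple ℂ 𝔤]

/-- The element `h₀` of the Cartan subalgebra defines a grading of `𝔤` whose degree `0` part is the
Cartan subalgebra and for which the Borel subalgebra `𝔟` and its opposite are the sums of the parts
of nonnegative and nonpositive degree. -/
structure IsGrading (𝔟 : LieSubalgebra ℂ 𝔤) (h₀ : 𝔥) : Prop where
  exists_int : ∀ α : Weight ℂ 𝔥 𝔤, ∃ n : ℤ, α h₀ = n
  isZero : ∀ α : Weight ℂ 𝔥 𝔤, α h₀ = 0 → α.IsZero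
  borel : 𝔟.toSubmodule = gradedPart h₀ {n : ℤ | 0 ≤ n}
  opposite : (oppositeBorel 𝔥 𝔟).toSubmodule = gradedPart h₀ {n : ℤ | n ≤ 0}
  nilrad_le : nilrad 𝔟 ≤ gradedPart h₀ {n : ℤ | 0 < n}

lemma _root_.LieSubalgebra.IsBorel.isGrading {𝔟 : LieSubalgebra ℂ 𝔤} (h𝔟 : 𝔟.IsBorel)
    (h𝔥𝔟 : 𝔥 ≤ 𝔟) : IsGrading 𝔟 (corootSum 𝔥 𝔟) where
  exists_int := apply_corootSum_eq_intCast
  isZero _ := h𝔟.isZero_of_apply_eq_zero h𝔥𝔟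
  borel := h𝔟.toSubmodule_eq h𝔥𝔟
  opposite := h𝔟.oppositeBorel_toSubmodule_eq h𝔥𝔟
  nilrad_le := h𝔟.nilrad_le h𝔥𝔟

namespace IsGrading

variable {𝔟 : LieSubalgebra ℂ 𝔤} {h₀ : 𝔥} (hg : IsGrading 𝔟 h₀)

include hg

/-- An induction principle for elements of `𝔤`. -/
lemma lie_induction {p : 𝔤 → Prop} (hadd : ∀ x y, p x → p y → p (x + y))
    (hpos : ∀ (α : Weight ℂ 𝔥 𝔤) (n : ℕ), 0 < n → α h₀ = n → ∀ x ∈ rootSpace 𝔥 α, p x)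
    (hH : ∀ H : 𝔥, p H)
    (hneg : ∀ (α : Weight ℂ 𝔥 𝔤) (n : ℕ), 0 < n → α h₀ = -n → ∀ x ∈ rootSpace 𝔥 α, p x)
    (x : 𝔤) : p x := by
  have hx : x ∈ ⨆ α : Weight ℂ 𝔥 𝔤, rootSpace 𝔥 α := by
    rw [iSup_genWeightSpace_eq_top']
    exact LieSubmodule.mem_top x
  induction hx using LieSubmodule.iSup_induction' with
  | zero => exact hH 0
  | add x y _ _ hx hy => exact hadd _ _ hx hy
  | mem α x hx =>
    obtain ⟨n, hn⟩ := hg.exists_int α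
    rcases lt_trichotomy n 0 with h | rfl | h
    · obtain ⟨k, rfl⟩ := Int.exists_eq_neg_ofNat h.le
      exact hneg α k (by omega) (by simpa using hn) x hx
    · have h0 := hg.isZero α (by simpa using hn)
      rw [h0.eq, rootSpace_zero_eq] at hx
      exact hH ⟨x, hx⟩
    · obtain ⟨k, rfl⟩ := Int.eq_ofNat_of_zero_le h.le
      exact hpos α k (by omega) (by simpa using hn) x hx

/-- An induction principle for elements of the Borel subalgebra. -/
lemma borel_induction {p : 𝔤 → Prop} (hadd : ∀ x y, p x → p y → p (x + y))
    (hpos : ∀ (α : Weight ℂ 𝔥 𝔤) (n : ℕ), 0 < n → α h₀ = n → ∀ x ∈ rootSpace 𝔥 α, p x)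
    (hH : ∀ H : 𝔥, p H) {x : 𝔤} (hx : x ∈ 𝔟) : p x := by
  rw [← LieSubalgebra.mem_toSubmodule, hg.borel] at hx
  refine gradedPart_induction (hH 0) hadd (fun α n hn hα x hx => ?_) hx
  obtain ⟨k, rfl⟩ := Int.eq_ofNat_of_zero_le hn
  rcases Nat.eq_zero_or_pos k with rfl | hk
  · have h0 := hg.isZero α (by simpa using hα)
    rw [h0.eq, rootSpace_zero_eq] at hx
    exact hH ⟨x, hx⟩
  · exact hpos α k hk (by simpa using hα) x hx

/-- An induction principle for elements of the opposite Borel subalgebra. -/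
lemma opposite_induction {p : 𝔤 → Prop} (hadd : ∀ x y, p x → p y → p (x + y))
    (hH : ∀ H : 𝔥, p H)
    (hneg : ∀ (α : Weight ℂ 𝔥 𝔤) (n : ℕ), 0 < n → α h₀ = -n → ∀ x ∈ rootSpace 𝔥 α, p x)
    {x : 𝔤} (hx : x ∈ oppositeBorel 𝔥 𝔟) : p x := by
  rw [← LieSubalgebra.mem_toSubmodule, hg.opposite] at hx
  refine gradedPart_induction (hH 0) hadd (fun α n hn hα x hx => ?_) hx
  obtain ⟨k, rfl⟩ := Int.exists_eq_neg_ofNat (show n ≤ 0 from hn)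
  rcases Nat.eq_zero_or_pos k with rfl | hk
  · have h0 := hg.isZero α (by simpa using hα)
    rw [h0.eq, rootSpace_zero_eq] at hx
    exact hH ⟨x, hx⟩
  · exact hneg α k hk (by simpa using hα) x hx

lemma cartan_mem_borel (H : 𝔥) : (H : 𝔤) ∈ 𝔟 := by
  rw [← LieSubalgebra.mem_toSubmodule, hg.borel]
  exact cartan_le_gradedPart (by simp) H.2

lemma mem_borel {α : Weight ℂ 𝔥 𝔤} {n : ℕ} (hα : α h₀ = n) {x : 𝔤} (hx : x ∈ rootSpace 𝔥 α) :
    x ∈ 𝔟 := by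
  rw [← LieSubalgebra.mem_toSubmodule, hg.borel]
  exact rootSpace_le_gradedPart (n := n) (by simp) (by simpa using hα) hx

lemma cartan_mem_opposite (H : 𝔥) : (H : 𝔤) ∈ oppositeBorel 𝔥 𝔟 := by
  rw [← LieSubalgebra.mem_toSubmodule, hg.opposite]
  exact cartan_le_gradedPart (by simp) H.2

lemma mem_opposite {α : Weight ℂ 𝔥 𝔤} {n : ℕ} (hα : α h₀ = -n) {x : 𝔤}
    (hx : x ∈ rootSpace 𝔥 α) : x ∈ oppositeBorel 𝔥 𝔟 := by
  rw [← LieSubalgebra.mem_toSubmodule, hg.opposite]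
  exact rootSpace_le_gradedPart (n := -n) (by simp) (by simpa using hα) hx

omit hg in
lemma isNonZero_of_pos {α : Weight ℂ 𝔥 𝔤} {n : ℕ} (hn : 0 < n) (hα : α h₀ = n) : α.IsNonZero := by
  intro h
  rw [h.eq, Pi.zero_apply] at hα
  exact hn.ne (by exact_mod_cast hα)

omit hg in
lemma isNonZero_of_neg {α : Weight ℂ 𝔥 𝔤} {n : ℕ} (hn : 0 < n) (hα : α h₀ = -n) : α.IsNonZero := by
  intro h
  rw [h.eq, Pi.zero_apply, zero_eq_neg] at hα
  exact hn.ne' (by exact_mod_cast hα)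

end IsGrading

end Weights

end DeformedO

namespace DeformedO

/-! ### Highest weight vectors and Verma modules -/

section HighestWeight

attribute [local instance 100] LieRing.ofAssociativeRing

open LieModule LieAlgebra LieSubalgebra

variable {𝔤 : Type u} {T : Type v} [LieRing 𝔤] [LieAlgebra ℂ 𝔤] [CommRing T] [Algebra ℂ T]
  {𝔥 : LieSubalgebra ℂ 𝔤}

/-- The weight `ν` is below `lam` with respect to `h₀` if `lam(h₀) - ν(h₀)` is a positive integer. -/
def Below (h₀ : 𝔥) (ν lam : Module.Dual ℂ 𝔥) : Prop := ∃ n : ℕ, 0 < n ∧ lam h₀ = ν h₀ + n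

lemma Below.ne {h₀ : 𝔥} {ν lam : Module.Dual ℂ 𝔥} (h : Below h₀ ν lam) : ν ≠ lam := by
  rintro rfl
  obtain ⟨n, hn, h⟩ := h
  rw [left_eq_add] at h
  exact hn.ne' (by exact_mod_cast h)

lemma Below.trans {h₀ : 𝔥} {ν κ lam : Module.Dual ℂ 𝔥} (h : Below h₀ ν κ) (h' : Below h₀ κ lam) :
    Below h₀ ν lam := by
  obtain ⟨n, hn, h⟩ := h
  obtain ⟨k, hk, h'⟩ := h'
  exact ⟨n + k, by omega, by rw [h', h]; push_cast; ring⟩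

lemma Below.asymm {h₀ : 𝔥} {ν lam : Module.Dual ℂ 𝔥} (h : Below h₀ ν lam) : ¬ Below h₀ lam ν :=
  fun hlam => (h.trans hlam).ne rfl

/-- All weights of the bimodule `M` are equal to `lam` or below `lam`. -/
def IsBoundedBy (φ : SymmetricAlgebra ℂ 𝔥 →ₐ[ℂ] T) (h₀ : 𝔥) (lam : Module.Dual ℂ 𝔥)
    (M : Bimod 𝔤 T) : Prop :=
  ∀ ν, ∀ m ∈ weightSpace 𝔥 φ ν M, m ≠ 0 → ν = lam ∨ Below h₀ ν lam

variable [FiniteDimensional ℂ 𝔤] [𝔥.IsCartanSubalgebra] [LieAlgebra.IsSemisimple ℂ 𝔤]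

lemma below_add_of_neg {h₀ : 𝔥} {ν : Module.Dual ℂ 𝔥} {α : Weight ℂ 𝔥 𝔤} {n : ℕ} (hn : 0 < n)
    (hα : α h₀ = -n) : Below h₀ (ν + α.toLinear) ν :=
  ⟨n, hn, by
    have : (ν + α.toLinear) h₀ = ν h₀ + α h₀ := rfl
    rw [this, hα]; ring⟩

lemma below_add_of_pos {h₀ : 𝔥} {ν : Module.Dual ℂ 𝔥} {α : Weight ℂ 𝔥 𝔤} {n : ℕ} (hn : 0 < n)
    (hα : α h₀ = n) : Below h₀ ν (ν + α.toLinear) :=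
  ⟨n, hn, by
    have : (ν + α.toLinear) h₀ = ν h₀ + α h₀ := rfl
    rw [this, hα]⟩

/-- A vector is a highest weight vector if it is a weight vector annihilated by all positive root
vectors. -/
structure IsHighestWeight (φ : SymmetricAlgebra ℂ 𝔥 →ₐ[ℂ] T) (h₀ : 𝔥) (lam : Module.Dual ℂ 𝔥)
    {M : Bimod 𝔤 T} (v : M) : Prop where
  mem : v ∈ weightSpace 𝔥 φ lam M
  smul_eq_zero : ∀ (α : Weight ℂ 𝔥 𝔤) (n : ℕ), 0 < n → α h₀ = n → ∀ x ∈ rootSpace 𝔥 α,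
    lieElt T x • v = 0

/-- The vectors obtained from `v` by successive operation of negative root vectors. -/
inductive IsLowering (h₀ : 𝔥) {M : Bimod 𝔤 T} (v : M) : M → Prop
  | base : IsLowering h₀ v v
  | step (α : Weight ℂ 𝔥 𝔤) (n : ℕ) (hn : 0 < n) (hα : α h₀ = -n) (y : 𝔤)
    (hy : y ∈ rootSpace 𝔥 α) (w : M) (hw : IsLowering h₀ v w) : IsLowering h₀ v (lieElt T y • w)

variable {φ : SymmetricAlgebra ℂ 𝔥 →ₐ[ℂ] T} {h₀ : 𝔥} {𝔟 : LieSubalgebra ℂ 𝔤}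
  {lam : Module.Dual ℂ 𝔥} {M : Bimod 𝔤 T}

lemma IsLowering.eq_or_mem {v w : M} (hv : v ∈ weightSpace 𝔥 φ lam M) (hw : IsLowering h₀ v w) :
    w = v ∨ ∃ ν, Below h₀ ν lam ∧ w ∈ weightSpace 𝔥 φ ν M := by
  induction hw with
  | base => exact Or.inl rfl
  | step α n hn hα y hy w _ ih =>
    right
    rcases ih with rfl | ⟨ν, hν, hw⟩
    · exact ⟨_, below_add_of_neg hn hα, lieElt_smul_mem_weightSpace φ α hy hv⟩
    · exact ⟨_, (below_add_of_neg hn hα).trans hν, lieElt_smul_mem_weightSpace φ α hy hw⟩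

/-- Write x(yw) = y(xw) + [x,y]w and induct on the number of lowering factors, for all x at once. On
v itself, positive root vectors give 0, and 𝔥 operates by elements of T. -/
lemma IsHighestWeight.lieElt_smul_mem_span (hg : IsGrading 𝔟 h₀) {v : M}
    (hv : IsHighestWeight φ h₀ lam v) (x : 𝔤) {w : M} (hw : IsLowering h₀ v w) :
    lieElt T x • w ∈ Submodule.span T {w : M | IsLowering h₀ v w} := by
  induction hw generalizing x with
  | base =>
    induction x using hg.lie_induction with
    | hadd x y hx hy => rw [lieElt_add, add_smul]; exact add_mem hx hy
    | hpos α n hn hα x hx => rw [hv.smul_eq_zero α n hn hα x hx]; exact zero_mem _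
    | hH H =>
      rw [(mem_weightSpace_iff φ).1 hv.mem H]
      exact Submodule.smul_mem _ _ (Submodule.subset_span .base)
    | hneg α n hn hα x hx => exact Submodule.subset_span (IsLowering.step α n hn hα x hx v .base)
  | step α n hn hα y hy w hw ih =>
    rw [lieElt_smul_smul]
    refine add_mem ?_ (ih _)
    refine Submodule.span_induction (fun z hz => ?_) ?_ (fun a b _ _ ha hb => ?_)
      (fun t z _ hz => ?_) (ih x)
    · exact Submodule.subset_span (IsLowering.step α n hn hα y hy z hz)
    · rw [smul_zero]; exact zero_mem _
    · rw [smul_add]; exact add_mem ha hb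
    · rw [smul_comm]; exact Submodule.smul_mem _ _ hz

/-- The T-span of the lowering words is stable under 𝔤 and contains the generator, so it is
everything. A word with at least one factor has weight strictly below `lam`. -/
lemma IsHighestWeight.mem_sup (hg : IsGrading 𝔟 h₀) {v : M}
    (hv : IsHighestWeight φ h₀ lam v) (hspan : Submodule.span (BimodAlg 𝔤 T) {v} = ⊤) (m : M) :
    m ∈ Submodule.span T {v} ⊔ ⨆ (ν) (_ : Below h₀ ν lam), weightSpace 𝔥 φ ν M := by
  have hst : ∀ (x : 𝔤), ∀ m ∈ Submodule.span T {w : M | IsLowering h₀ v w},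
      lieElt T x • m ∈ Submodule.span T {w : M | IsLowering h₀ v w} := by
    intro x m hm
    refine Submodule.span_induction (fun z hz => hv.lieElt_smul_mem_span hg x hz) ?_
      (fun a b _ _ ha hb => ?_) (fun t z _ hz => ?_) hm
    · rw [smul_zero]; exact zero_mem _
    · rw [smul_add]; exact add_mem ha hb
    · rw [smul_comm]; exact Submodule.smul_mem _ _ hz
  have htop : (⊤ : Submodule (BimodAlg 𝔤 T) M) ≤ submoduleOfLieStable _ hst := by
    rw [← hspan, Submodule.span_singleton_le_iff_mem]
    exact Submodule.subset_span (s := {w : M | IsLowering h₀ v w}) .base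
  have hm : m ∈ Submodule.span T {w : M | IsLowering h₀ v w} := htop (Submodule.mem_top (x := m))
  refine Submodule.span_le.2 (fun w hw => ?_) hm
  rcases IsLowering.eq_or_mem hv.mem hw with rfl | ⟨ν, hν, hw⟩
  · exact Submodule.mem_sup_left (Submodule.mem_span_singleton_self _)
  · exact Submodule.mem_sup_right
      (le_iSup₂_of_le (f := fun ν (_ : Below h₀ ν lam) => weightSpace 𝔥 φ ν M) ν hν le_rfl hw)

lemma IsHighestWeight.iSup_eq_top (hg : IsGrading 𝔟 h₀) {v : M}
    (hv : IsHighestWeight φ h₀ lam v) (hspan : Submodule.span (BimodAlg 𝔤 T) {v} = ⊤) :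
    ⨆ ν, weightSpace 𝔥 φ ν M = ⊤ := by
  refine eq_top_iff.2 fun m _ => ?_
  refine SetLike.le_def.1 (sup_le ?_ ?_) (hv.mem_sup hg hspan m)
  · rw [Submodule.span_singleton_le_iff_mem]
    exact Submodule.mem_iSup_of_mem lam hv.mem
  · exact iSup₂_le fun ν _ => le_iSup (fun ν => weightSpace 𝔥 φ ν M) ν

lemma IsHighestWeight.mem_span_of_mem (hg : IsGrading 𝔟 h₀) {v : M}
    (hv : IsHighestWeight φ h₀ lam v) (hspan : Submodule.span (BimodAlg 𝔤 T) {v} = ⊤) {m : M}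
    (hm : m ∈ weightSpace 𝔥 φ lam M) : ∃ t : T, t • v = m := by
  obtain ⟨a, ha, b, hb, hab⟩ := Submodule.mem_sup.1 (hv.mem_sup hg hspan m)
  obtain ⟨t, rfl⟩ := Submodule.mem_span_singleton.1 ha
  refine ⟨t, ?_⟩
  have h1 : b ∈ weightSpace 𝔥 φ lam M := by
    rw [← eq_sub_iff_add_eq'] at hab
    rw [hab]
    exact sub_mem hm (Submodule.smul_mem _ _ hv.mem)
  have h2 : b ∈ ⨆ (ν) (_ : ν ≠ lam), weightSpace 𝔥 φ ν M :=
    SetLike.le_def.1 (biSup_mono fun ν hν => Below.ne hν) hb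
  have h0 : b = 0 := (Submodule.mem_bot T).1
    ((iSupIndep_weightSpace φ M lam).le_bot ⟨h1, h2⟩)
  rw [← hab, h0, add_zero]

lemma IsHighestWeight.isBoundedBy (hg : IsGrading 𝔟 h₀) {v : M}
    (hv : IsHighestWeight φ h₀ lam v) (hspan : Submodule.span (BimodAlg 𝔤 T) {v} = ⊤) :
    IsBoundedBy φ h₀ lam M := by
  intro ν m hm hm0
  by_contra hcon
  push Not at hcon
  refine hm0 ((Submodule.mem_bot T).1 ((iSupIndep_weightSpace φ M ν).le_bot ⟨hm, ?_⟩))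
  refine SetLike.le_def.1 (sup_le ?_ ?_) (hv.mem_sup hg hspan m)
  · rw [Submodule.span_singleton_le_iff_mem]
    exact le_iSup₂_of_le (f := fun κ (_ : κ ≠ ν) => weightSpace 𝔥 φ κ M) lam hcon.1.symm le_rfl
      hv.mem
  · exact biSup_mono fun κ hκ h => hcon.2 (h ▸ hκ)

lemma IsHighestWeight.lieElt_smul_eq (hg : IsGrading 𝔟 h₀) {v : M}
    (hv : IsHighestWeight φ h₀ lam v) {y : 𝔤} (hy : y ∈ 𝔟) :
    lieElt T y • v = deformedChar φ lam y • v := by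
  refine hg.borel_induction (p := fun y => lieElt T y • v = deformedChar φ lam y • v)
    (fun x y hx hy => ?_) (fun α n hn hα x hx => ?_)
    (fun H => (mem_weightSpace_iff_deformedChar φ).1 hv.mem H) hy
  · rw [lieElt_add, add_smul, hx, hy, map_add, add_smul]
  · rw [hv.smul_eq_zero α n hn hα x hx,
      deformedChar_of_mem_rootSpace φ lam (IsGrading.isNonZero_of_pos hn hα) hx, zero_smul]

lemma IsHighestWeight.of_lieElt_smul_eq (hg : IsGrading 𝔟 h₀) {v : M}
    (hv : ∀ y ∈ 𝔟, lieElt T y • v = deformedChar φ lam y • v) : IsHighestWeight φ h₀ lam v where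
  mem := (mem_weightSpace_iff_deformedChar φ).2 fun H => hv H (hg.cartan_mem_borel H)
  smul_eq_zero α n hn hα x hx := by
    rw [hv x (hg.mem_borel hα hx),
      deformedChar_of_mem_rootSpace φ lam (IsGrading.isNonZero_of_pos hn hα) hx, zero_smul]

/-! ### Verma modules -/

lemma smul_vermaMk_one (a : BimodAlg 𝔤 T) :
    a • vermaMk 𝔟 φ lam 1 = (Submodule.Quotient.mk a : verma 𝔟 φ lam) := by
  change (Submodule.Quotient.mk (a • (1 : BimodAlg 𝔤 T)) : verma 𝔟 φ lam) = _
  rw [smul_eq_mul, mul_one]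

lemma smul_vermaMk (t : T) : t • vermaMk 𝔟 φ lam 1 = vermaMk 𝔟 φ lam t := by
  rw [← algebraMap_smul (BimodAlg 𝔤 T), smul_vermaMk_one]
  rfl

lemma lieElt_smul_vermaMk_one {y : 𝔤} (hy : y ∈ 𝔟) :
    lieElt T y • vermaMk 𝔟 φ lam 1 = deformedChar φ lam y • vermaMk 𝔟 φ lam 1 := by
  rw [smul_vermaMk, smul_vermaMk_one]
  refine (Submodule.Quotient.eq _).2 (Submodule.subset_span ⟨1, 1, y, hy, ?_⟩)
  rw [one_mul, mul_one]
  rfl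

variable (φ lam) in
lemma isHighestWeight_vermaMk_one (hg : IsGrading 𝔟 h₀) :
    IsHighestWeight φ h₀ lam (vermaMk 𝔟 φ lam 1) :=
  .of_lieElt_smul_eq hg fun _ => lieElt_smul_vermaMk_one

variable (φ 𝔟 lam) in
lemma span_vermaMk_one : Submodule.span (BimodAlg 𝔤 T) {vermaMk 𝔟 φ lam 1} = ⊤ := by
  refine eq_top_iff.2 fun m _ => ?_
  obtain ⟨a, rfl⟩ := Submodule.Quotient.mk_surjective _ m
  exact Submodule.mem_span_singleton.2 ⟨a, smul_vermaMk_one a⟩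

lemma verma_hom_ext {f g : verma 𝔟 φ lam ⟶ M}
    (h : f.hom (vermaMk 𝔟 φ lam 1) = g.hom (vermaMk 𝔟 φ lam 1)) : f = g := by
  ext m
  obtain ⟨a, rfl⟩ := Submodule.mem_span_singleton.1
    ((span_vermaMk_one φ 𝔟 lam).symm ▸ Submodule.mem_top (x := m))
  rw [map_smul, map_smul, h]

/-- The universal property of induction: elements of 𝔟 operate on a highest weight vector by the
deformed character, so the relations of the Verma module are killed. -/
lemma exists_verma_hom (hg : IsGrading 𝔟 h₀) {m : M} (hm : IsHighestWeight φ h₀ lam m) :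
    ∃ f : verma 𝔟 φ lam ⟶ M, f.hom (vermaMk 𝔟 φ lam 1) = m := by
  refine ⟨ModuleCat.ofHom (Submodule.liftQ _ (LinearMap.toSpanSingleton (BimodAlg 𝔤 T) M m) ?_),
    ?_⟩
  · rw [Submodule.span_le]
    rintro _ ⟨t, w, y, hy, rfl⟩
    have h1 : (t ⊗ₜ[ℂ] (w * UniversalEnvelopingAlgebra.ι ℂ y) : BimodAlg 𝔤 T) =
        t ⊗ₜ w * lieElt T y := by
      rw [lieElt, Algebra.TensorProduct.tmul_mul_tmul, mul_one]
    have h2 : ((deformedChar φ lam y * t) ⊗ₜ[ℂ] w : BimodAlg 𝔤 T) =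
        deformedChar φ lam y • t ⊗ₜ w := by
      rw [TensorProduct.smul_tmul', smul_eq_mul]
    rw [SetLike.mem_coe, LinearMap.mem_ker, LinearMap.toSpanSingleton_apply, h1, h2, sub_smul,
      mul_smul, hm.lieElt_smul_eq hg hy, smul_comm, smul_assoc, sub_self]
  · change (1 : BimodAlg 𝔤 T) • m = m
    rw [one_smul]

end HighestWeight

end DeformedO

namespace DeformedO

/-! ### Local finiteness of bimodules with weights bounded above -/

section LocallyFinite

attribute [local instance 100] LieRing.ofAssociativeRing
attribute [local instance] ModuleCat.moduleOfAlgebraModule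
attribute [local instance] ModuleCat.isScalarTower_of_algebra_moduleCat

open LieModule LieAlgebra LieSubalgebra

variable {𝔤 : Type u} {T : Type v} [LieRing 𝔤] [LieAlgebra ℂ 𝔤] [CommRing T] [Algebra ℂ T]
  {𝔥 : LieSubalgebra ℂ 𝔤} [FiniteDimensional ℂ 𝔤] [𝔥.IsCartanSubalgebra]
  [LieAlgebra.IsSemisimple ℂ 𝔤] {φ : SymmetricAlgebra ℂ 𝔥 →ₐ[ℂ] T} {h₀ : 𝔥}
  {𝔟 : LieSubalgebra ℂ 𝔤} {lam : Module.Dual ℂ 𝔥} {M : Bimod 𝔤 T}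

/-- Stability of a subspace under all positive root vectors. -/
def IsRaisingStable (h₀ : 𝔥) (V : Submodule ℂ M) : Prop :=
  ∀ (α : Weight ℂ 𝔥 𝔤) (n : ℕ), 0 < n → α h₀ = n → ∀ x ∈ rootSpace 𝔥 α, ∀ w ∈ V,
    lieElt T x • w ∈ V

lemma isRaisingStable_bot : IsRaisingStable h₀ (⊥ : Submodule ℂ M) := by
  intro α n _ _ x _ w hw
  rw [(Submodule.mem_bot ℂ).1 hw, smul_zero]
  exact zero_mem _

lemma IsRaisingStable.iSup {ι : Sort*} {V : ι → Submodule ℂ M}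
    (hV : ∀ i, IsRaisingStable h₀ (V i)) : IsRaisingStable h₀ (⨆ i, V i) := by
  intro α n hn hα x hx w hw
  induction hw using Submodule.iSup_induction' with
  | mem i y hy => exact Submodule.mem_iSup_of_mem i (hV i α n hn hα x hx y hy)
  | zero => rw [smul_zero]; exact zero_mem _
  | add y z _ _ hy hz => rw [smul_add]; exact add_mem hy hz

lemma IsRaisingStable.sup {V W : Submodule ℂ M} (hV : IsRaisingStable h₀ V)
    (hW : IsRaisingStable h₀ W) : IsRaisingStable h₀ (V ⊔ W) := by
  rw [sup_eq_iSup]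
  exact .iSup (by rintro (_ | _) <;> assumption)

/-- Induction on the distance N from ν to the bound. A positive root vector brings m closer to the
bound, where a finite-dimensional stable space is already known, or else kills it. There are
finitely many positive roots, each with a one-dimensional root space, so adding these spaces to the
line ℂm is enough. -/
lemma exists_isRaisingStable_of_mem_weightSpace (hb : IsBoundedBy φ h₀ lam M) (N : ℕ)
    (ν : Module.Dual ℂ 𝔥) (hν : lam h₀ = ν h₀ + N) {m : M} (hm : m ∈ weightSpace 𝔥 φ ν M) :
    ∃ V : Submodule ℂ M, m ∈ V ∧ FiniteDimensional ℂ V ∧ IsRaisingStable h₀ V := by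
  induction N using Nat.strong_induction_on generalizing ν m with
  | _ N ih =>
  have key : ∀ α : Weight ℂ 𝔥 𝔤, ∃ V : Submodule ℂ M, FiniteDimensional ℂ V ∧
      IsRaisingStable h₀ V ∧
      ∀ n : ℕ, 0 < n → α h₀ = n → ∀ x ∈ rootSpace 𝔥 α, lieElt T x • m ∈ V := by
    intro α
    by_cases hα : ∃ n : ℕ, 0 < n ∧ α h₀ = n
    · obtain ⟨n, hn, hα⟩ := hα
      obtain ⟨e, he, he0⟩ := α.exists_ne_zero
      have hem := lieElt_smul_mem_weightSpace φ α he hm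
      have hV : ∃ V : Submodule ℂ M, lieElt T e • m ∈ V ∧ FiniteDimensional ℂ V ∧
          IsRaisingStable h₀ V := by
        by_cases h0 : lieElt T e • m = 0
        · exact ⟨⊥, by rw [h0]; exact zero_mem _, inferInstance, isRaisingStable_bot⟩
        · have hadd : (ν + α.toLinear) h₀ = ν h₀ + n := by rw [← hα]; rfl
          obtain ⟨k, hk⟩ : ∃ k : ℕ, lam h₀ = (ν + α.toLinear) h₀ + k := by
            rcases hb _ _ hem h0 with h | ⟨k, _, hk⟩
            · exact ⟨0, by rw [h]; simp⟩
            · exact ⟨k, hk⟩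
          have hNk : N = n + k := by
            have h := hν.symm.trans hk
            rw [hadd, add_assoc, add_right_inj] at h
            exact_mod_cast h
          exact ih k (by omega) _ hk hem
      obtain ⟨V, h1, h2, h3⟩ := hV
      refine ⟨V, h2, h3, fun _ _ _ x hx => ?_⟩
      obtain ⟨c, rfl⟩ := IsKilling.exists_smul_eq_of_mem_rootSpace
        (IsGrading.isNonZero_of_pos hn hα) he he0 hx
      rw [lieElt_smul, algebraMap_smul, smul_assoc]
      exact V.smul_mem c h1
    · exact ⟨⊥, inferInstance, isRaisingStable_bot, fun n hn h => absurd ⟨n, hn, h⟩ hα⟩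
  choose V hfin hst hmem using key
  refine ⟨Submodule.span ℂ {m} ⊔ ⨆ α, V α,
    Submodule.mem_sup_left (Submodule.mem_span_singleton_self m), inferInstance, ?_⟩
  intro α n hn hα x hx w hw
  obtain ⟨a, ha, b, hb, rfl⟩ := Submodule.mem_sup.1 hw
  obtain ⟨c, rfl⟩ := Submodule.mem_span_singleton.1 ha
  rw [smul_add, smul_comm]
  refine Submodule.mem_sup_right (add_mem ?_ (IsRaisingStable.iSup hst α n hn hα x hx b hb))
  exact Submodule.smul_mem _ _ (Submodule.mem_iSup_of_mem α (hmem α n hn hα x hx))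

lemma IsGrading.isInO (hg : IsGrading 𝔟 h₀) (hb : IsBoundedBy φ h₀ lam M)
    (htop : ⨆ ν, weightSpace 𝔥 φ ν M = ⊤) : IsInO 𝔟 φ M := by
  refine ⟨fun m => ?_, htop⟩
  have hV : ∃ V : Submodule ℂ M, m ∈ V ∧ FiniteDimensional ℂ V ∧ IsRaisingStable h₀ V := by
    have hm : m ∈ ⨆ ν, weightSpace 𝔥 φ ν M := htop ▸ Submodule.mem_top
    induction hm using Submodule.iSup_induction' with
    | zero => exact ⟨⊥, zero_mem _, inferInstance, isRaisingStable_bot⟩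
    | add y z _ _ hy hz =>
      obtain ⟨V, h1, h2, h3⟩ := hy
      obtain ⟨W, h1', h2', h3'⟩ := hz
      exact ⟨V ⊔ W, add_mem (Submodule.mem_sup_left h1) (Submodule.mem_sup_right h1'),
        inferInstance, h3.sup h3'⟩
    | mem ν y hy =>
      by_cases h0 : y = 0
      · exact ⟨⊥, h0 ▸ zero_mem _, inferInstance, isRaisingStable_bot⟩
      · rcases hb ν y hy h0 with rfl | ⟨n, _, hn⟩
        · exact exists_isRaisingStable_of_mem_weightSpace hb 0 ν (by simp) hy
        · exact exists_isRaisingStable_of_mem_weightSpace hb n ν hn hy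
  obtain ⟨V, hm, hfin, hst⟩ := hV
  refine ⟨V, hm, hfin, fun x hx w hw => ?_⟩
  refine gradedPart_induction (p := fun x => lieElt T x • w ∈ V) ?_ (fun x y hx hy => ?_)
    (fun α n hn hα x hx => ?_) (hg.nilrad_le hx)
  · rw [lieElt_zero, zero_smul]; exact zero_mem _
  · rw [lieElt_add, add_smul]; exact add_mem hx hy
  · obtain ⟨k, rfl⟩ := Int.eq_ofNat_of_zero_le (le_of_lt hn)
    exact hst α k (by simpa using hn) (by simpa using hα) x hx w hw

end LocallyFinite

/-! ### Nabla modules: values, weights and maps into them -/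

section Nabla

attribute [local instance 100] LieRing.ofAssociativeRing

open LieModule LieAlgebra LieSubalgebra

variable {𝔤 : Type u} {T : Type v} [LieRing 𝔤] [LieAlgebra ℂ 𝔤] [CommRing T] [Algebra ℂ T]
  {𝔥 : LieSubalgebra ℂ 𝔤} [FiniteDimensional ℂ 𝔤] [𝔥.IsCartanSubalgebra]
  [LieAlgebra.IsSemisimple ℂ 𝔤] {φ : SymmetricAlgebra ℂ 𝔥 →ₐ[ℂ] T} {h₀ : 𝔥}
  {𝔟 : LieSubalgebra ℂ 𝔤} {lam μ κ : Module.Dual ℂ 𝔥} {M : Bimod 𝔤 T}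

local notation "ιU" => UniversalEnvelopingAlgebra.ι ℂ

/-- The values of the elements of `∇_T(μ)` at a point of the enveloping algebra. -/
noncomputable def nablaAt (𝔟 : LieSubalgebra ℂ 𝔤) (φ : SymmetricAlgebra ℂ 𝔥 →ₐ[ℂ] T)
    (μ : Module.Dual ℂ 𝔥) (z : UniversalEnvelopingAlgebra ℂ 𝔤) : nabla 𝔟 φ μ →ₗ[T] T where
  toFun ψ := FunSpace.eval (ψ.1 : coind (oppositeBorel 𝔥 𝔟) φ μ).1 z
  map_add' _ _ := rfl
  map_smul' t ψ := by
    rw [← algebraMap_smul (BimodAlg 𝔤 T) t ψ]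
    refine (FunSpace.eval_tmul_smul t 1 (ψ.1 : coind (oppositeBorel 𝔥 𝔟) φ μ).1 z).trans ?_
    rw [mul_one]
    rfl

lemma nablaAt_one (ψ : nabla 𝔟 φ μ) : nablaAt 𝔟 φ μ 1 ψ = nablaEval 𝔟 φ μ ψ := rfl

lemma nabla_ext {ψ ψ' : nabla 𝔟 φ μ} (h : ∀ z, nablaAt 𝔟 φ μ z ψ = nablaAt 𝔟 φ μ z ψ') :
    ψ = ψ' :=
  Subtype.ext (Subtype.ext (LinearMap.ext h))

lemma nablaAt_smul (z w : UniversalEnvelopingAlgebra ℂ 𝔤) (ψ : nabla 𝔟 φ μ) :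
    nablaAt 𝔟 φ μ z (((1 : T) ⊗ₜ[ℂ] w : BimodAlg 𝔤 T) • ψ) = nablaAt 𝔟 φ μ (z * w) ψ := by
  refine (FunSpace.eval_tmul_smul 1 w (ψ.1 : coind (oppositeBorel 𝔥 𝔟) φ μ).1 z).trans ?_
  rw [one_mul]
  rfl

lemma nablaAt_ι_mul {y : 𝔤} (hy : y ∈ oppositeBorel 𝔥 𝔟) (z : UniversalEnvelopingAlgebra ℂ 𝔤)
    (ψ : nabla 𝔟 φ μ) :
    nablaAt 𝔟 φ μ (ιU y * z) ψ = deformedChar φ μ y * nablaAt 𝔟 φ μ z ψ :=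
  (ψ.1 : coind (oppositeBorel 𝔥 𝔟) φ μ).2 y hy z

lemma nablaAt_add (z w : UniversalEnvelopingAlgebra ℂ 𝔤) (ψ : nabla 𝔟 φ μ) :
    nablaAt 𝔟 φ μ (z + w) ψ = nablaAt 𝔟 φ μ z ψ + nablaAt 𝔟 φ μ w ψ :=
  map_add (show UniversalEnvelopingAlgebra ℂ 𝔤 →ₗ[ℂ] T from
    (ψ.1 : coind (oppositeBorel 𝔥 𝔟) φ μ).1) z w

lemma nablaAt_scalar (c : ℂ) (z : UniversalEnvelopingAlgebra ℂ 𝔤) (ψ : nabla 𝔟 φ μ) :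
    nablaAt 𝔟 φ μ (c • z) ψ = c • nablaAt 𝔟 φ μ z ψ :=
  map_smul (show UniversalEnvelopingAlgebra ℂ 𝔤 →ₗ[ℂ] T from
    (ψ.1 : coind (oppositeBorel 𝔥 𝔟) φ μ).1) c z

lemma nablaEval_lieElt_smul {y : 𝔤} (hy : y ∈ oppositeBorel 𝔥 𝔟) (ψ : nabla 𝔟 φ μ) :
    nablaEval 𝔟 φ μ (lieElt T y • ψ) = deformedChar φ μ y * nablaEval 𝔟 φ μ ψ := by
  rw [← nablaAt_one, lieElt, nablaAt_smul, one_mul, ← mul_one (ιU y), nablaAt_ι_mul hy, nablaAt_one]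

variable (φ 𝔟 μ) in
-- Weight vectors of the coinduced bimodule lie in ∇ and are weight vectors there, so passing to the
-- sum of weight spaces once is enough.
lemma iSup_weightSpace_nabla : ⨆ ν, weightSpace 𝔥 φ ν (nabla 𝔟 φ μ) = ⊤ := by
  let C : Bimod 𝔤 T := ModuleCat.of (BimodAlg 𝔤 T) (coind (oppositeBorel 𝔥 𝔟) φ μ)
  let i : nabla 𝔟 φ μ ⟶ C := ModuleCat.ofHom (weightSum φ C).subtype
  have key : ∀ c ∈ ⨆ ν, weightSpace 𝔥 φ ν C,
      ∃ ψ ∈ ⨆ ν, weightSpace 𝔥 φ ν (nabla 𝔟 φ μ), i.hom ψ = c := by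
    intro c hc
    induction hc using Submodule.iSup_induction' with
    | mem ν c hc =>
      have hc' : c ∈ ⨆ ν, weightSpace 𝔥 φ ν C :=
        le_iSup (fun ν => weightSpace 𝔥 φ ν C) ν hc
      exact ⟨⟨c, hc'⟩, Submodule.mem_iSup_of_mem ν
        (mem_weightSpace_of_injective φ i (Submodule.subtype_injective _) hc), rfl⟩
    | zero => exact ⟨0, zero_mem _, map_zero _⟩
    | add a b _ _ ha hb =>
      obtain ⟨ψ, h, rfl⟩ := ha
      obtain ⟨ψ', h', rfl⟩ := hb
      exact ⟨ψ + ψ', add_mem h h', map_add _ _ _⟩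
  refine eq_top_iff.2 fun ψ _ => ?_
  obtain ⟨ψ', h, h'⟩ := key _ ψ.2
  rwa [Subtype.ext h'] at h

/-- On ψ(1) an element H of 𝔥 acts by κ(H) + φ(H), as ψ has weight κ, and by μ(H) + φ(H), by
equivariance. The φ(H) cancel, and κ(H) - μ(H) is a nonzero complex number for some H, hence
invertible in T. -/
lemma nablaEval_eq_zero_of_ne (hg : IsGrading 𝔟 h₀) (hκ : κ ≠ μ) {ψ : nabla 𝔟 φ μ}
    (hψ : ψ ∈ weightSpace 𝔥 φ κ (nabla 𝔟 φ μ)) : nablaEval 𝔟 φ μ ψ = 0 := by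
  obtain ⟨H, hH⟩ : ∃ H, κ H ≠ μ H := by
    by_contra hcon
    push Not at hcon
    exact hκ (LinearMap.ext hcon)
  have h := nablaEval_lieElt_smul (hg.cartan_mem_opposite H) ψ
  rw [(mem_weightSpace_iff φ).1 hψ H, ← nablaAt_one, map_smul, nablaAt_one, deformedChar_coe, smul_eq_mul,
    ← sub_eq_zero, ← sub_mul, add_sub_add_right_eq_sub, ← map_sub, ← Algebra.smul_def] at h
  exact (smul_eq_zero_iff_right (sub_ne_zero.2 hH)).1 h

/-- The products of positive root vectors in the enveloping algebra. -/
inductive IsRaisingWord (h₀ : 𝔥) : UniversalEnvelopingAlgebra ℂ 𝔤 → Prop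
  | one : IsRaisingWord h₀ 1
  | step (α : Weight ℂ 𝔥 𝔤) (n : ℕ) (hn : 0 < n) (hα : α h₀ = n) (x : 𝔤)
    (hx : x ∈ rootSpace 𝔥 α) (z : UniversalEnvelopingAlgebra ℂ 𝔤) (hz : IsRaisingWord h₀ z) :
    IsRaisingWord h₀ (ιU x * z)

/-- The products of elements of a subalgebra `𝔠` with products of positive root vectors. -/
inductive IsTriangularWord (h₀ : 𝔥) (𝔠 : LieSubalgebra ℂ 𝔤) :
    UniversalEnvelopingAlgebra ℂ 𝔤 → Prop
  | raising (z : UniversalEnvelopingAlgebra ℂ 𝔤) (hz : IsRaisingWord h₀ z) :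
    IsTriangularWord h₀ 𝔠 z
  | step (y : 𝔤) (hy : y ∈ 𝔠) (z : UniversalEnvelopingAlgebra ℂ 𝔤)
    (hz : IsTriangularWord h₀ 𝔠 z) : IsTriangularWord h₀ 𝔠 (ιU y * z)

/-- The spanning half of the triangular decomposition: x moves past a factor y at the cost of the
shorter word with [x,y]. Only positive root vectors have to travel to the right; the other pieces of
x can stay in front. -/
lemma ι_mul_mem_span_isTriangularWord (hg : IsGrading 𝔟 h₀) (x : 𝔤)
    {z : UniversalEnvelopingAlgebra ℂ 𝔤} (hz : IsTriangularWord h₀ (oppositeBorel 𝔥 𝔟) z) :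
    ιU x * z ∈ Submodule.span ℂ {z | IsTriangularWord h₀ (oppositeBorel 𝔥 𝔟) z} := by
  induction hz generalizing x with
  | raising z hz =>
    induction x using hg.lie_induction with
    | hadd x y hx hy => rw [map_add, add_mul]; exact add_mem hx hy
    | hpos α n hn hα x hx =>
      exact Submodule.subset_span
        (IsTriangularWord.raising _ (IsRaisingWord.step α n hn hα x hx z hz))
    | hH H =>
      exact Submodule.subset_span
        (IsTriangularWord.step _ (hg.cartan_mem_opposite H) z (.raising z hz))
    | hneg α n hn hα x hx =>
      exact Submodule.subset_span
        (IsTriangularWord.step _ (hg.mem_opposite hα hx) z (.raising z hz))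
  | step y hy z hz ih =>
    have h : ιU x * (ιU y * z) = ιU y * (ιU x * z) + ιU ⁅x, y⁆ * z := by
      rw [LieHom.map_lie, LieRing.of_associative_ring_bracket]
      noncomm_ring
    rw [h]
    refine add_mem ?_ (ih _)
    refine Submodule.span_induction (fun w hw => ?_) ?_ (fun a b _ _ ha hb => ?_)
      (fun t w _ hw => ?_) (ih x)
    · exact Submodule.subset_span (IsTriangularWord.step y hy w hw)
    · rw [mul_zero]; exact zero_mem _
    · rw [mul_add]; exact add_mem ha hb
    · rw [mul_smul_comm]; exact Submodule.smul_mem _ _ hw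

/-- Triangular words span U(𝔤), and left factors from the opposite Borel only multiply a value by an
element of T. So ψ is determined by its values on raising words. -/
lemma nabla_eq_zero (hg : IsGrading 𝔟 h₀) {ψ : nabla 𝔟 φ μ}
    (hψ : ∀ z, IsRaisingWord h₀ z → nablaAt 𝔟 φ μ z ψ = 0) : ψ = 0 := by
  have htop : Submodule.span ℂ {z | IsTriangularWord h₀ (oppositeBorel 𝔥 𝔟) z} = ⊤ := by
    refine UniversalEnvelopingAlgebra.eq_top_of_ι_mul_mem _
      (Submodule.subset_span (.raising 1 .one)) fun x w hw => ?_
    refine Submodule.span_induction (fun z hz => ι_mul_mem_span_isTriangularWord hg x hz) ?_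
      (fun a b _ _ ha hb => ?_) (fun t w _ hw => ?_) hw
    · rw [mul_zero]; exact zero_mem _
    · rw [mul_add]; exact add_mem ha hb
    · rw [mul_smul_comm]; exact Submodule.smul_mem _ _ hw
  refine nabla_ext fun z => ?_
  rw [map_zero]
  have hz : z ∈ Submodule.span ℂ {z | IsTriangularWord h₀ (oppositeBorel 𝔥 𝔟) z} :=
    htop ▸ Submodule.mem_top
  refine Submodule.span_induction (fun z hz => ?_) ?_ (fun a b _ _ ha hb => ?_)
      (fun c w _ hw => ?_) hz
  · induction hz with
    | raising z hz => exact hψ z hz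
    | step y hy z _ ih => rw [nablaAt_ι_mul hy, ih, mul_zero]
  · rw [← zero_smul ℂ (1 : UniversalEnvelopingAlgebra ℂ 𝔤), nablaAt_scalar, zero_smul]
  · rw [nablaAt_add, ha, hb, add_zero]
  · rw [nablaAt_scalar, hw, smul_zero]

lemma one_tmul_ι_mul_smul (x : 𝔤) (z : UniversalEnvelopingAlgebra ℂ 𝔤) (m : M) :
    ((1 : T) ⊗ₜ[ℂ] (ιU x * z) : BimodAlg 𝔤 T) • m =
      lieElt T x • ((1 : T) ⊗ₜ[ℂ] z : BimodAlg 𝔤 T) • m := by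
  rw [smul_smul, lieElt, Algebra.TensorProduct.tmul_mul_tmul, mul_one]

lemma IsRaisingWord.smul_mem {z : UniversalEnvelopingAlgebra ℂ 𝔤} (hz : IsRaisingWord h₀ z) {m : M}
    (hm : m ∈ weightSpace 𝔥 φ κ M) : z = 1 ∨ ∃ κ', Below h₀ κ κ' ∧
      ((1 : T) ⊗ₜ[ℂ] z : BimodAlg 𝔤 T) • m ∈ weightSpace 𝔥 φ κ' M := by
  induction hz with
  | one => exact Or.inl rfl
  | step α n hn hα x hx z _ ih =>
    right
    rw [one_tmul_ι_mul_smul]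
    rcases ih with rfl | ⟨κ', h, h'⟩
    · refine ⟨_, below_add_of_pos hn hα, lieElt_smul_mem_weightSpace φ α hx ?_⟩
      rwa [← Algebra.TensorProduct.one_def, one_smul]
    · exact ⟨_, h.trans (below_add_of_pos hn hα), lieElt_smul_mem_weightSpace φ α hx h'⟩

lemma IsRaisingWord.smul_eq_zero {z : UniversalEnvelopingAlgebra ℂ 𝔤} (hz : IsRaisingWord h₀ z)
    {m : M} (hm : IsHighestWeight φ h₀ κ m) :
    z = 1 ∨ ((1 : T) ⊗ₜ[ℂ] z : BimodAlg 𝔤 T) • m = 0 := by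
  induction hz with
  | one => exact Or.inl rfl
  | step α n hn hα x hx z _ ih =>
    right
    rw [one_tmul_ι_mul_smul]
    rcases ih with rfl | h
    · rw [← Algebra.TensorProduct.one_def, one_smul, hm.smul_eq_zero α n hn hα x hx]
    · rw [h, smul_zero]

variable (φ μ) in
-- The value of ψ at a raising word z is (zψ)(1), where zψ has weight κ or a weight above κ. If this
-- weight is never μ, all these values vanish.
lemma isBoundedBy_nabla (hg : IsGrading 𝔟 h₀) : IsBoundedBy φ h₀ μ (nabla 𝔟 φ μ) := by
  intro κ ψ hψ h0
  by_contra hcon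
  push Not at hcon
  refine h0 (nabla_eq_zero hg fun z hz => ?_)
  rcases hz.smul_mem hψ with rfl | ⟨κ', h, h'⟩
  · exact nablaEval_eq_zero_of_ne hg hcon.1 hψ
  · rw [← one_mul z, ← nablaAt_smul, nablaAt_one]
    exact nablaEval_eq_zero_of_ne hg (by rintro rfl; exact hcon.2 h) h'

lemma eq_zero_of_nablaEval_eq_zero (hg : IsGrading 𝔟 h₀) {ψ : nabla 𝔟 φ μ}
    (hψ : ψ ∈ weightSpace 𝔥 φ μ (nabla 𝔟 φ μ)) (h : nablaEval 𝔟 φ μ ψ = 0) : ψ = 0 := by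
  refine nabla_eq_zero hg fun z hz => ?_
  rcases hz.smul_mem hψ with rfl | ⟨κ', h, h'⟩
  · exact h
  · rw [← one_mul z, ← nablaAt_smul, nablaAt_one]
    exact nablaEval_eq_zero_of_ne hg h.ne.symm h'

/-- Nontrivial raising words kill ψ, so ψ(1) is its only possibly nonzero value on raising words;
and ψ(1) = 0 because the weight is not μ. -/
lemma IsHighestWeight.eq_zero_of_ne (hg : IsGrading 𝔟 h₀) {ψ : nabla 𝔟 φ μ}
    (hψ : IsHighestWeight φ h₀ lam ψ) (hne : lam ≠ μ) : ψ = 0 := by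
  refine nabla_eq_zero hg fun z hz => ?_
  rcases hz.smul_eq_zero hψ with rfl | h
  · exact nablaEval_eq_zero_of_ne hg hne hψ.mem
  · rw [← one_mul z, ← nablaAt_smul, h, map_zero]

/-- Homomorphisms to `∇_T(μ)` are given by equivariant forms. -/
lemma exists_hom_nabla (hM : ⨆ ν, weightSpace 𝔥 φ ν M = ⊤) (ℓ : M →ₗ[T] T)
    (hℓ : ∀ y ∈ oppositeBorel 𝔥 𝔟, ∀ m, ℓ (lieElt T y • m) = deformedChar φ μ y * ℓ m) :
    ∃ r : M ⟶ nabla 𝔟 φ μ, ∀ m, nablaEval 𝔟 φ μ (r.hom m) = ℓ m := by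
  let C : Bimod 𝔤 T := ModuleCat.of (BimodAlg 𝔤 T) (coind (oppositeBorel 𝔥 𝔟) φ μ)
  -- Frobenius reciprocity: m goes to the function z ↦ ℓ(zm). It lands in ∇, not merely in the
  -- coinduced bimodule, because M is the sum of its weight spaces.
  let ev : M → FunSpace 𝔤 T := fun m =>
    { toFun := fun z => ℓ (((1 : T) ⊗ₜ[ℂ] z : BimodAlg 𝔤 T) • m)
      map_add' := fun z w => by rw [TensorProduct.tmul_add, add_smul, map_add]
      map_smul' := fun c z => by
        rw [TensorProduct.tmul_smul, ← algebraMap_smul T c (1 ⊗ₜ[ℂ] z : BimodAlg 𝔤 T), smul_assoc,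
          map_smul, algebraMap_smul, RingHom.id_apply] }
  have hev : ∀ m z, (ev m).eval z = ℓ (((1 : T) ⊗ₜ[ℂ] z : BimodAlg 𝔤 T) • m) := fun _ _ => rfl
  have hevadd : ∀ m m', ev (m + m') = ev m + ev m' := fun m m' => by
    refine LinearMap.ext fun z => ?_
    change ℓ _ = ℓ _ + ℓ _
    rw [smul_add, map_add]
  have hevsmul : ∀ (a : BimodAlg 𝔤 T) (m), ev (a • m) = a • ev m := fun a m => by
    induction a using TensorProduct.induction_on with
    | zero =>
      rw [zero_smul, zero_smul]
      refine LinearMap.ext fun z => ?_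
      change ℓ _ = 0
      rw [smul_zero, map_zero]
    | add a b ha hb => rw [add_smul, add_smul, hevadd, ha, hb]
    | tmul t w =>
      refine LinearMap.ext fun z => ?_
      refine Eq.trans ?_ (FunSpace.eval_tmul_smul t w (ev m) z).symm
      change ℓ _ = t * ℓ _
      rw [tmul_eq_smul t w, smul_assoc, smul_comm _ t, map_smul, smul_smul,
        Algebra.TensorProduct.tmul_mul_tmul, mul_one, smul_eq_mul]
  let f : M ⟶ C := ModuleCat.ofHom
    { toFun := fun m => ⟨ev m, fun y hy z => by
        rw [hev, hev, one_tmul_ι_mul_smul, hℓ y hy]⟩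
      map_add' := fun m m' => Subtype.ext (hevadd m m')
      map_smul' := fun a m => Subtype.ext (hevsmul a m) }
  refine ⟨ModuleCat.ofHom (LinearMap.codRestrict (weightSum φ C) f.hom fun m =>
    map_mem_iSup_weightSpace φ f (hM ▸ Submodule.mem_top)), fun m => ?_⟩
  change ℓ (((1 : T) ⊗ₜ[ℂ] (1 : UniversalEnvelopingAlgebra ℂ 𝔤) : BimodAlg 𝔤 T) • m) = ℓ m
  rw [← Algebra.TensorProduct.one_def, one_smul]

end Nabla

end DeformedO

namespace DeformedO

/-! ### The canonical map from Δ to ∇ and its consequences -/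

section VermaForm

attribute [local instance 100] LieRing.ofAssociativeRing

open LieModule LieAlgebra LieSubalgebra

variable {𝔤 : Type u} {T : Type v} [LieRing 𝔤] [LieAlgebra ℂ 𝔤] [CommRing T] [Algebra ℂ T]
  {𝔥 : LieSubalgebra ℂ 𝔤} [FiniteDimensional ℂ 𝔤] [𝔥.IsCartanSubalgebra]
  [LieAlgebra.IsSemisimple ℂ 𝔤] (φ : SymmetricAlgebra ℂ 𝔥 →ₐ[ℂ] T) {h₀ : 𝔥}
  {𝔟 : LieSubalgebra ℂ 𝔤} (lam : Module.Dual ℂ 𝔥)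

local notation "ιU" => UniversalEnvelopingAlgebra.ι ℂ

/-- A form on the enveloping algebra that is equivariant under right multiplication by `𝔟` descends
to the Verma module. -/
lemma exists_form_of_right_equivariant (ψ : UniversalEnvelopingAlgebra ℂ 𝔤 →ₗ[ℂ] T)
    (hψ : ∀ x ∈ 𝔟, ∀ z, ψ (z * ιU x) = deformedChar φ lam x * ψ z) :
    ∃ ℓ : verma 𝔟 φ lam →ₗ[T] T, ∀ z,
      ℓ (((1 : T) ⊗ₜ[ℂ] z : BimodAlg 𝔤 T) • vermaMk 𝔟 φ lam 1) = ψ z := by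
  let L : BimodAlg 𝔤 T →ₗ[T] T := TensorProduct.AlgebraTensorModule.lift
    ((LinearMap.lsmul T (UniversalEnvelopingAlgebra ℂ 𝔤 →ₗ[ℂ] T)).flip ψ)
  have hL : ∀ t z, L (t ⊗ₜ z) = t * ψ z := fun _ _ => rfl
  -- The largest left ideal in the kernel of `L`. As the relations span a left ideal, it is enough
  -- to find their generators in it.
  let J : Submodule (BimodAlg 𝔤 T) (BimodAlg 𝔤 T) :=
    { carrier := {b | ∀ a, L (a * b) = 0}
      add_mem' := fun h h' a => by rw [mul_add, map_add, h a, h' a, add_zero]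
      zero_mem' := fun a => by rw [mul_zero, map_zero]
      smul_mem' := fun c b h a => by rw [smul_eq_mul, ← mul_assoc, h] }
  let R : Submodule (BimodAlg 𝔤 T) (BimodAlg 𝔤 T) := Submodule.span (BimodAlg 𝔤 T)
    {a | ∃ (t : T) (w : UniversalEnvelopingAlgebra ℂ 𝔤), ∃ y ∈ 𝔟,
      a = t ⊗ₜ[ℂ] (w * ιU y) - (deformedChar φ lam y * t) ⊗ₜ[ℂ] w}
  have hR : R ≤ J := by
    refine Submodule.span_le.2 ?_
    rintro _ ⟨t, w, y, hy, rfl⟩ a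
    induction a using TensorProduct.induction_on with
    | zero => rw [zero_mul, map_zero]
    | add a b ha hb => rw [add_mul, map_add, ha, hb, add_zero]
    | tmul s z =>
      rw [mul_sub, Algebra.TensorProduct.tmul_mul_tmul, Algebra.TensorProduct.tmul_mul_tmul,
        map_sub, hL, hL, ← mul_assoc z, hψ y hy]
      ring
  let q : verma 𝔟 φ lam →+ T := QuotientAddGroup.lift R.toAddSubgroup L.toAddMonoidHom
    fun a ha => by simpa using hR ha 1
  have hq : ∀ a : BimodAlg 𝔤 T, q (a • vermaMk 𝔟 φ lam 1) = L a := fun a => by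
    rw [smul_vermaMk_one]
    rfl
  refine ⟨{ q with map_smul' := fun t m => ?_ }, fun z => ?_⟩
  · obtain ⟨a, rfl⟩ := Submodule.mem_span_singleton.1
      ((span_vermaMk_one φ 𝔟 lam).symm ▸ Submodule.mem_top (x := m))
    change q (t • a • vermaMk 𝔟 φ lam 1) = t • q (a • vermaMk 𝔟 φ lam 1)
    rw [← smul_assoc, hq, hq, map_smul]
  · refine (hq _).trans ?_
    rw [hL, one_mul]

lemma deformedChar_eq_zero_of_mem_gradedPart {S : Set ℤ} (hS : (0 : ℤ) ∉ S) {x : 𝔤}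
    (hx : x ∈ gradedPart h₀ S) : deformedChar φ lam x = 0 := by
  refine gradedPart_induction (p := fun x => deformedChar φ lam x = 0) (map_zero _)
    (fun x y hx hy => by rw [map_add, hx, hy, add_zero])
    (fun α n hn hα x hx => deformedChar_of_mem_rootSpace φ lam (fun h => hS ?_) hx) hx
  rw [h.eq, Pi.zero_apply] at hα
  have : n = 0 := by exact_mod_cast hα.symm
  exact this ▸ hn

/-- The part of negative degree is a complement of 𝔟 and is normalized by 𝔥, and together with 𝔥 it
makes up the opposite Borel. So the form on U(𝔤) built from this decomposition is equivariant on
both sides as required. This provides the canonical map Δ → ∇. -/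
lemma exists_verma_form (hg : IsGrading 𝔟 h₀) :
    ∃ ℓ : verma 𝔟 φ lam →ₗ[T] T, ℓ (vermaMk 𝔟 φ lam 1) = 1 ∧
      ∀ y ∈ oppositeBorel 𝔥 𝔟, ∀ m, ℓ (lieElt T y • m) = deformedChar φ lam y * ℓ m := by
  let 𝔫 : LieSubalgebra ℂ 𝔤 := gradedSubalgebra h₀ {n : ℤ | n < 0}
    (fun a ha b hb => by simp only [Set.mem_ofPred_eq] at *; omega)
  have h𝔫 : ∀ y ∈ 𝔫, deformedChar φ lam y = 0 := fun y hy =>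
    deformedChar_eq_zero_of_mem_gradedPart φ lam (S := {n : ℤ | n < 0}) (by simp) hy
  have hcompl : IsCompl 𝔫.toSubmodule 𝔟.toSubmodule := by
    rw [hg.borel]
    refine ⟨disjoint_gradedPart ?_, codisjoint_iff.2 (gradedPart_sup hg.exists_int ?_)⟩
    · exact Set.disjoint_left.2 fun n (h : n < 0) (h' : 0 ≤ n) => by omega
    · exact Set.eq_univ_of_forall fun n => lt_or_ge n 0
  obtain ⟨ψ, h1, hr, hn, hH⟩ := UniversalEnvelopingAlgebra.exists_equivariant_form hcompl
    (deformedChar φ lam) h𝔫 (fun x hx y hy => by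
      refine deformedChar_eq_zero_of_mem_gradedPart φ lam (S := {n : ℤ | 0 < n}) (by simp)
        (hg.nilrad_le ⟨⁅(⟨x, hx⟩ : 𝔟), ⟨y, hy⟩⁆, ?_, rfl⟩)
      have h : (LieAlgebra.derivedSeries ℂ 𝔟 1).toSubmodule =
        Submodule.span ℂ {⁅x, y⁆ | (x : 𝔟) (y : 𝔟)} := coe_derivedSeries_one_eq ℂ 𝔟
      rw [h]
      exact Submodule.subset_span ⟨_, _, rfl⟩)
  obtain ⟨ℓ, hℓ⟩ := exists_form_of_right_equivariant φ lam ψ hr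
  have hleft : ∀ y ∈ oppositeBorel 𝔥 𝔟, ∀ z, ψ (ιU y * z) = deformedChar φ lam y * ψ z := by
    intro y hy z
    refine hg.opposite_induction (p := fun y => ψ (ιU y * z) = deformedChar φ lam y * ψ z)
      (fun x y hx hy => by rw [map_add, add_mul, map_add, hx, hy, map_add, add_mul])
      (fun H => hH H (hg.cartan_mem_borel H) (fun y hy => ?_) z)
      (fun α n hn' hα x hx => ?_) hy
    · exact lie_mem_gradedPart (S := {0}) (by simp) (cartan_le_gradedPart (by simp) H.2) hy
    · have hx' : x ∈ 𝔫 := rootSpace_le_gradedPart (n := -n) (by simpa using hn')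
        (by simpa using hα) hx
      rw [hn x hx', h𝔫 x hx', zero_mul]
  refine ⟨ℓ, ?_, fun y hy m => ?_⟩
  · have h := hℓ 1
    rwa [← Algebra.TensorProduct.one_def, one_smul, h1] at h
  · obtain ⟨a, rfl⟩ := Submodule.mem_span_singleton.1
      ((span_vermaMk_one φ 𝔟 lam).symm ▸ Submodule.mem_top (x := m))
    induction a using TensorProduct.induction_on with
    | zero => rw [zero_smul, smul_zero, map_zero, mul_zero]
    | add a b ha hb => rw [add_smul, smul_add, map_add, ha, hb, map_add, mul_add]
    | tmul t z =>
      rw [tmul_eq_smul, smul_assoc, smul_comm _ t, map_smul ℓ t, map_smul ℓ t, ← one_tmul_ι_mul_smul, hℓ,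
        hℓ, hleft y hy, smul_eq_mul, smul_eq_mul, mul_left_comm]

lemma isInO_verma (hg : IsGrading 𝔟 h₀) : IsInO 𝔟 φ (verma 𝔟 φ lam) :=
  hg.isInO ((isHighestWeight_vermaMk_one φ lam hg).isBoundedBy hg (span_vermaMk_one φ 𝔟 lam))
    ((isHighestWeight_vermaMk_one φ lam hg).iSup_eq_top hg (span_vermaMk_one φ 𝔟 lam))

lemma isInO_nabla (hg : IsGrading 𝔟 h₀) : IsInO 𝔟 φ (nabla 𝔟 φ lam) :=
  hg.isInO (isBoundedBy_nabla φ lam hg) (iSup_weightSpace_nabla φ 𝔟 lam)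

/-- The canonical homomorphism from a Verma module to the nabla module of the same weight. -/
lemma exists_hom_verma_nabla (hg : IsGrading 𝔟 h₀) :
    ∃ f : verma 𝔟 φ lam ⟶ nabla 𝔟 φ lam,
      nablaEval 𝔟 φ lam (f.hom (vermaMk 𝔟 φ lam 1)) = 1 := by
  obtain ⟨ℓ, h1, hℓ⟩ := exists_verma_form φ lam hg
  obtain ⟨f, hf⟩ := exists_hom_nabla (isInO_verma φ lam hg).2 ℓ hℓ
  exact ⟨f, by rw [hf, h1]⟩

variable {φ lam} {M : Bimod 𝔤 T} {μ : Module.Dual ℂ 𝔥}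

lemma IsHighestWeight.map {N : Bimod 𝔤 T} {v : M} (hv : IsHighestWeight φ h₀ lam v) (f : M ⟶ N) :
    IsHighestWeight φ h₀ lam (f.hom v) where
  mem := hom_mem_weightSpace φ f hv.mem
  smul_eq_zero α n hn hα x hx := by
    rw [← map_smul, hv.smul_eq_zero α n hn hα x hx, map_zero]

lemma nabla_hom_ext {f g : M ⟶ nabla 𝔟 φ μ}
    (h : ∀ m, nablaEval 𝔟 φ μ (f.hom m) = nablaEval 𝔟 φ μ (g.hom m)) : f = g := by
  ext m
  refine nabla_ext fun z => ?_
  rw [← one_mul z, ← nablaAt_smul, ← nablaAt_smul, ← map_smul, ← map_smul]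
  exact h _

/-- There are no nonzero homomorphisms from a Verma module to a nabla module of different weight. -/
lemma verma_hom_nabla_eq_zero (hg : IsGrading 𝔟 h₀) (h : lam ≠ μ)
    (f : verma 𝔟 φ lam ⟶ nabla 𝔟 φ μ) : f = 0 :=
  verma_hom_ext (((isHighestWeight_vermaMk_one φ lam hg).map f).eq_zero_of_ne hg h)

variable (φ lam)

/-- The isomorphism `T ≃ Δ_T(lam)^lam`. -/
lemma exists_vermaEquiv (hg : IsGrading 𝔟 h₀) :
    ∃ c : T ≃ₗ[T] weightSpace 𝔥 φ lam (verma 𝔟 φ lam), ∀ t,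
      (c t : verma 𝔟 φ lam) = vermaMk 𝔟 φ lam t := by
  have hv := isHighestWeight_vermaMk_one φ lam hg
  obtain ⟨f, hf⟩ := exists_hom_verma_nabla φ lam hg
  let c : T →ₗ[T] weightSpace 𝔥 φ lam (verma 𝔟 φ lam) :=
    LinearMap.toSpanSingleton T _ ⟨vermaMk 𝔟 φ lam 1, hv.mem⟩
  have hc : ∀ t, (c t : verma 𝔟 φ lam) = t • vermaMk 𝔟 φ lam 1 := fun _ => rfl
  refine ⟨LinearEquiv.ofBijective c ⟨?_, ?_⟩, fun t => (hc t).trans (smul_vermaMk t)⟩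
  -- Mapping t times the generator to ∇ and evaluating at 1 gives back t.
  · refine (injective_iff_map_eq_zero c).2 fun t ht => ?_
    have h := hc t
    rw [ht] at h
    have h' := congrArg (fun m => nablaAt 𝔟 φ lam 1 (f.hom m)) h
    simpa only [hom_smul, map_smul, nablaAt_one, hf, smul_eq_mul, mul_one,
      ZeroMemClass.coe_zero, map_zero, eq_comm] using h'
  · intro m
    obtain ⟨t, ht⟩ := hv.mem_span_of_mem hg (span_vermaMk_one φ 𝔟 lam) m.2
    exact ⟨t, Subtype.ext ht⟩

/-- The isomorphism `∇_T(lam)^lam ≃ T`. -/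
lemma exists_nablaEquiv (hg : IsGrading 𝔟 h₀) :
    ∃ d : weightSpace 𝔥 φ lam (nabla 𝔟 φ lam) ≃ₗ[T] T, ∀ ψ,
      d ψ = nablaEval 𝔟 φ lam ψ := by
  obtain ⟨f, hf⟩ := exists_hom_verma_nabla φ lam hg
  let d : weightSpace 𝔥 φ lam (nabla 𝔟 φ lam) →ₗ[T] T :=
    (nablaAt 𝔟 φ lam 1).comp (Submodule.subtype _)
  refine ⟨LinearEquiv.ofBijective d ⟨?_, fun t => ?_⟩, fun ψ => rfl⟩
  · exact (injective_iff_map_eq_zero d).2 fun ψ hψ =>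
      Subtype.ext (eq_zero_of_nablaEval_eq_zero hg ψ.2 hψ)
  · refine ⟨t • ⟨f.hom (vermaMk 𝔟 φ lam 1),
      hom_mem_weightSpace φ f (isHighestWeight_vermaMk_one φ lam hg).mem⟩, ?_⟩
    rw [map_smul]
    change t • nablaEval 𝔟 φ lam (f.hom (vermaMk 𝔟 φ lam 1)) = t
    rw [hf, smul_eq_mul, mul_one]

/-- The isomorphism `Hom(Δ_T(lam), ∇_T(lam)) ≃ T`. -/
lemma exists_homEquiv (hg : IsGrading 𝔟 h₀) (hΔ : IsInO 𝔟 φ (verma 𝔟 φ lam))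
    (hN : IsInO 𝔟 φ (nabla 𝔟 φ lam)) :
    ∃ e : ((⟨_, hΔ⟩ : CatO 𝔟 φ) ⟶ ⟨_, hN⟩) ≃ₗ[T] T, ∀ f,
      e f = nablaEval 𝔟 φ lam (f.hom.hom (vermaMk 𝔟 φ lam 1)) := by
  obtain ⟨f₀, hf₀⟩ := exists_hom_verma_nabla φ lam hg
  let e : ((⟨_, hΔ⟩ : CatO 𝔟 φ) ⟶ ⟨_, hN⟩) →ₗ[T] T :=
    { toFun := fun f => nablaAt 𝔟 φ lam 1 (f.hom.hom (vermaMk 𝔟 φ lam 1))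
      map_add' := fun f g => map_add (nablaAt 𝔟 φ lam 1) _ _
      map_smul' := fun t f => map_smul (nablaAt 𝔟 φ lam 1) t _ }
  refine ⟨LinearEquiv.ofBijective e ⟨?_, fun t => ⟨t • ObjectProperty.homMk f₀, ?_⟩⟩, fun f => rfl⟩
  · refine (injective_iff_map_eq_zero e).2 fun f hf => ?_
    refine ObjectProperty.hom_ext _ (verma_hom_ext ?_)
    exact eq_zero_of_nablaEval_eq_zero hg
      (hom_mem_weightSpace φ f.hom (isHighestWeight_vermaMk_one φ lam hg).mem) hf
  · rw [map_smul]
    change t • nablaEval 𝔟 φ lam (f₀.hom (vermaMk 𝔟 φ lam 1)) = t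
    rw [hf₀, smul_eq_mul, mul_one]

end VermaForm

/-! ### Splitting of extensions of Verma modules by nabla modules -/

section ShortExact

attribute [local instance 100] LieRing.ofAssociativeRing

open LieModule LieAlgebra LieSubalgebra

variable {𝔤 : Type u} {T : Type v} [LieRing 𝔤] [LieAlgebra ℂ 𝔤] [CommRing T] [Algebra ℂ T]
  {𝔥 : LieSubalgebra ℂ 𝔤} {φ : SymmetricAlgebra ℂ 𝔥 →ₐ[ℂ] T} {𝔟 : LieSubalgebra ℂ 𝔤}

namespace CatO

/-- The kernel of a homomorphism, as an object of the deformed category. -/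
def kernelObj {X Y : CatO 𝔟 φ} (f : X ⟶ Y) : CatO 𝔟 φ :=
  ⟨ModuleCat.of (BimodAlg 𝔤 T) (LinearMap.ker f.hom.hom), by
    have : Mono (ModuleCat.ofHom (LinearMap.ker f.hom.hom).subtype) :=
      (ModuleCat.mono_iff_injective _).2 (Submodule.subtype_injective _)
    exact (IsInO 𝔟 φ).prop_of_mono (ModuleCat.ofHom (LinearMap.ker f.hom.hom).subtype) X.2⟩

/-- The inclusion of the kernel of a homomorphism. -/
def kernelInclusion {X Y : CatO 𝔟 φ} (f : X ⟶ Y) : kernelObj f ⟶ X :=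
  ObjectProperty.homMk (ModuleCat.ofHom (LinearMap.ker f.hom.hom).subtype)

lemma kernelInclusion_comp {X Y : CatO 𝔟 φ} (f : X ⟶ Y) : kernelInclusion f ≫ f = 0 := by
  refine ObjectProperty.hom_ext _ (ModuleCat.hom_ext (LinearMap.ext fun m => ?_))
  exact m.2

/-- The kernel taken in bimodules is again an object of 𝒪(T), so a monomorphism of the full
subcategory can be tested against its inclusion. -/
lemma injective_of_mono {X Y : CatO 𝔟 φ} (f : X ⟶ Y) [Mono f] : Function.Injective f.hom.hom := by
  refine (injective_iff_map_eq_zero _).2 fun m hm => ?_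
  have h : kernelInclusion f = 0 := by
    rw [← cancel_mono f, kernelInclusion_comp, Limits.zero_comp]
  exact congrArg (fun g => g.hom.hom (⟨m, hm⟩ : LinearMap.ker f.hom.hom)) h

/-- Dually, the cokernel taken in bimodules stays in 𝒪(T). -/
lemma surjective_of_epi {X Y : CatO 𝔟 φ} (f : X ⟶ Y) [Epi f] : Function.Surjective f.hom.hom := by
  let q : Y.obj ⟶ ModuleCat.of (BimodAlg 𝔤 T) (Y.obj ⧸ LinearMap.range f.hom.hom) :=
    ModuleCat.ofHom (LinearMap.range f.hom.hom).mkQ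
  have : Epi q := (ModuleCat.epi_iff_surjective _).2 (Submodule.mkQ_surjective _)
  let Q : CatO 𝔟 φ := ⟨_, (IsInO 𝔟 φ).prop_of_epi q Y.2⟩
  let q' : Y ⟶ Q := ObjectProperty.homMk q
  have h : f ≫ q' = 0 := by
    refine ObjectProperty.hom_ext _ (ModuleCat.hom_ext (LinearMap.ext fun m => ?_))
    exact (Submodule.Quotient.mk_eq_zero _).2 ⟨m, rfl⟩
  have h0 : q' = 0 := by rw [← cancel_epi f, h, Limits.comp_zero]
  intro y
  exact (Submodule.Quotient.mk_eq_zero _).1 (congrArg (fun g => g.hom.hom y) h0)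

lemma exists_of_shortExact {S : ShortComplex (CatO 𝔟 φ)} (hS : S.ShortExact) {m : S.X₂.obj}
    (hm : S.g.hom.hom m = 0) : ∃ n, S.f.hom.hom n = m := by
  have := hS.mono_f
  have h := hS.exact.lift_f (kernelInclusion S.g) (kernelInclusion_comp S.g)
  exact ⟨(hS.exact.lift (kernelInclusion S.g) (kernelInclusion_comp S.g)).hom.hom
    (⟨m, hm⟩ : LinearMap.ker S.g.hom.hom), congrArg (fun g => g.hom.hom
      (⟨m, hm⟩ : LinearMap.ker S.g.hom.hom)) h⟩

end CatO

/-- Take the component of weight `lam` of any preimage. The other components map to the sum of the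
other weight spaces, and by independence their contribution is zero. -/
lemma exists_mem_weightSpace_of_surjective {M N : Bimod 𝔤 T} (f : M ⟶ N)
    (hf : Function.Surjective f.hom) (hM : ⨆ ν, weightSpace 𝔥 φ ν M = ⊤) {lam : Module.Dual ℂ 𝔥}
    {n : N} (hn : n ∈ weightSpace 𝔥 φ lam N) : ∃ m ∈ weightSpace 𝔥 φ lam M, f.hom m = n := by
  obtain ⟨m, rfl⟩ := hf n
  have hm : m ∈ weightSpace 𝔥 φ lam M ⊔ ⨆ (ν) (_ : ν ≠ lam), weightSpace 𝔥 φ ν M := by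
    rw [(isCompl_weightSpace φ hM lam).sup_eq_top]; exact Submodule.mem_top
  obtain ⟨a, ha, b, hb, rfl⟩ := Submodule.mem_sup.1 hm
  refine ⟨a, ha, ?_⟩
  rw [map_add] at hn ⊢
  have h1 : f.hom b ∈ weightSpace 𝔥 φ lam N := by
    have h := sub_mem hn (hom_mem_weightSpace φ f ha)
    rwa [add_sub_cancel_left] at h
  have h2 : f.hom b ∈ ⨆ (ν) (_ : ν ≠ lam), weightSpace 𝔥 φ ν N := by
    clear h1 hn hm
    rw [iSup_subtype'] at hb ⊢
    induction hb using Submodule.iSup_induction' with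
    | mem ν x hx => exact Submodule.mem_iSup_of_mem ν (hom_mem_weightSpace φ f hx)
    | zero => rw [map_zero]; exact zero_mem _
    | add x y _ _ hx hy => rw [map_add]; exact add_mem hx hy
  rw [(Submodule.mem_bot T).1 ((iSupIndep_weightSpace φ N lam).le_bot ⟨h1, h2⟩), add_zero]

variable [FiniteDimensional ℂ 𝔤] [𝔥.IsCartanSubalgebra] [LieAlgebra.IsSemisimple ℂ 𝔤]
  {h₀ : 𝔥} {lam μ : Module.Dual ℂ 𝔥} {E : Bimod 𝔤 T}

/-- An extension of `Δ_T(lam)` by `∇_T(μ)` splits if `lam` is not below `μ`. -/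
lemma exists_section_of_not_below (hg : IsGrading 𝔟 h₀) (hE : ⨆ ν, weightSpace 𝔥 φ ν E = ⊤)
    (i : nabla 𝔟 φ μ ⟶ E) (p : E ⟶ verma 𝔟 φ lam) (hi : Function.Injective i.hom)
    (hp : Function.Surjective p.hom) (hip : ∀ m, p.hom m = 0 → ∃ n, i.hom n = m)
    (h : ¬ Below h₀ lam μ) : ∃ s : verma 𝔟 φ lam ⟶ E, s ≫ p = 𝟙 _ := by
  have hv := isHighestWeight_vermaMk_one φ lam hg
  obtain ⟨m, hm, hmv⟩ := exists_mem_weightSpace_of_surjective p hp hE hv.mem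
  have hhw : IsHighestWeight φ h₀ lam m := by
    refine ⟨hm, fun α n hn hα x hx => ?_⟩
    -- A positive root vector moves the lift into ∇(μ), in weight lam + α. If the result were
    -- nonzero, lam + α would be μ or below μ, and so `lam` would be below μ.
    obtain ⟨ψ, hψ⟩ := hip (lieElt T x • m) (by
      rw [map_smul, hmv, hv.smul_eq_zero α n hn hα x hx])
    have hψm : ψ ∈ weightSpace 𝔥 φ (lam + α.toLinear) (nabla 𝔟 φ μ) :=
      mem_weightSpace_of_injective φ i hi (hψ ▸ lieElt_smul_mem_weightSpace φ α hx hm)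
    by_cases h0 : ψ = 0
    · rw [← hψ, h0, map_zero]
    · have hb := below_add_of_pos (ν := lam) hn hα
      rcases isBoundedBy_nabla φ μ hg _ ψ hψm h0 with e | e
      · exact absurd (e ▸ hb) h
      · exact absurd (hb.trans e) h
  obtain ⟨s, hs⟩ := exists_verma_hom hg hhw
  refine ⟨s, verma_hom_ext ?_⟩
  change p.hom (s.hom _) = _
  rw [hs, hmv]
  rfl

/-- A form on an extension of `Δ_T(lam)` by `∇_T(μ)` that extends the evaluation. -/
lemma exists_form_of_below (hg : IsGrading 𝔟 h₀) (hE : ⨆ ν, weightSpace 𝔥 φ ν E = ⊤)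
    (i : nabla 𝔟 φ μ ⟶ E) (p : E ⟶ verma 𝔟 φ lam) (hi : Function.Injective i.hom)
    (hip : ∀ m, p.hom m = 0 → ∃ n, i.hom n = m) (h : Below h₀ lam μ) :
    ∃ ℓ : E →ₗ[T] T, (∀ ψ, ℓ (i.hom ψ) = nablaEval 𝔟 φ μ ψ) ∧
      ∀ y ∈ oppositeBorel 𝔥 𝔟, ∀ m, ℓ (lieElt T y • m) = deformedChar φ μ y * ℓ m := by
  have hvb := (isHighestWeight_vermaMk_one φ lam hg).isBoundedBy hg (span_vermaMk_one φ 𝔟 lam)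
  -- All weights of Δ(lam) are below μ. In any other weight, E therefore coincides with ∇(μ); this
  -- covers μ itself and everything above it.
  have hlift : ∀ ν, ¬ Below h₀ ν μ → ∀ m ∈ weightSpace 𝔥 φ ν E,
      ∃ ψ ∈ weightSpace 𝔥 φ ν (nabla 𝔟 φ μ), i.hom ψ = m := by
    intro ν hν m hm
    obtain ⟨ψ, rfl⟩ := hip m (by
      by_contra h0
      rcases hvb ν _ (hom_mem_weightSpace φ p hm) h0 with rfl | h'
      · exact hν h
      · exact hν (h'.trans h))
    exact ⟨ψ, mem_weightSpace_of_injective φ i hi hm, rfl⟩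
  have hEb : ∀ ν, ∀ m ∈ weightSpace 𝔥 φ ν E, Below h₀ μ ν → m = 0 := by
    intro ν m hm hν
    obtain ⟨ψ, hψ, rfl⟩ := hlift ν hν.asymm m hm
    by_contra h0
    rcases isBoundedBy_nabla φ μ hg ν ψ hψ (fun h => h0 (by rw [h, map_zero])) with e | e
    · exact hν.ne e.symm
    · exact hν.asymm e
  let j : weightSpace 𝔥 φ μ (nabla 𝔟 φ μ) ≃ₗ[T] weightSpace 𝔥 φ μ E :=
    LinearEquiv.ofBijective (restrictWeight φ μ i)
      ⟨fun a b hab => Subtype.ext (hi (congrArg Subtype.val hab)), fun m => by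
        obtain ⟨ψ, hψ, e⟩ := hlift μ (fun h => h.ne rfl) m m.2
        exact ⟨⟨ψ, hψ⟩, Subtype.ext e⟩⟩
  -- Project to E^μ, identify it with ∇(μ)^μ and evaluate at 1. On ∇(μ) this is evaluation, which
  -- already vanishes on the other weights.
  let ℓ : E →ₗ[T] T := nablaAt 𝔟 φ μ 1 ∘ₗ Submodule.subtype _ ∘ₗ j.symm.toLinearMap ∘ₗ
    Submodule.projectionOnto _ _ (isCompl_weightSpace φ hE μ)
  have hne : ∀ ν, ν ≠ μ → ∀ m ∈ weightSpace 𝔥 φ ν E, ℓ m = 0 := by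
    intro ν hν m hm
    have h0 := Submodule.projectionOnto_apply_of_mem_right (isCompl_weightSpace φ hE μ)
      (x := m) (le_iSup₂_of_le (f := fun ν (_ : ν ≠ μ) => weightSpace 𝔥 φ ν E) ν hν le_rfl hm)
    simp only [ℓ, LinearMap.comp_apply, h0, map_zero]
  have hμ : ∀ ψ ∈ weightSpace 𝔥 φ μ (nabla 𝔟 φ μ), ℓ (i.hom ψ) = nablaEval 𝔟 φ μ ψ := by
    intro ψ hψ
    have h1 := Submodule.projectionOnto_apply_left (isCompl_weightSpace φ hE μ) (j ⟨ψ, hψ⟩)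
    have h2 : ((j ⟨ψ, hψ⟩ : weightSpace 𝔥 φ μ E) : E) = i.hom ψ := rfl
    rw [h2] at h1
    simp only [ℓ, LinearMap.comp_apply, h1, LinearEquiv.coe_coe, LinearEquiv.symm_apply_apply]
    rfl
  refine ⟨ℓ, fun ψ => ?_, fun y hy m => ?_⟩
  · have hψ : ψ ∈ ⨆ ν, weightSpace 𝔥 φ ν (nabla 𝔟 φ μ) :=
      iSup_weightSpace_nabla φ 𝔟 μ ▸ Submodule.mem_top
    simp only [← nablaAt_one] at hμ ⊢
    induction hψ using Submodule.iSup_induction' with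
    | zero => simp only [map_zero]
    | add a b _ _ ha hb => simp only [map_add, ha, hb]
    | mem ν ψ hψ =>
      by_cases hν : ν = μ
      · subst hν
        exact hμ ψ hψ
      · rw [hne ν hν _ (hom_mem_weightSpace φ i hψ), nablaAt_one,
          nablaEval_eq_zero_of_ne hg hν hψ]
  · have hm : m ∈ ⨆ ν, weightSpace 𝔥 φ ν E := hE ▸ Submodule.mem_top
    induction hm using Submodule.iSup_induction' with
    | zero => rw [smul_zero, map_zero, mul_zero]
    | add a b _ _ ha hb => rw [smul_add, map_add, ha, hb, map_add, mul_add]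
    | mem ν m hm =>
      refine hg.opposite_induction
        (p := fun y => ℓ (lieElt T y • m) = deformedChar φ μ y * ℓ m)
        (fun x y hx hy => by rw [lieElt_add, add_smul, map_add, hx, hy, map_add, add_mul])
        (fun H => ?_) (fun α n hn hα x hx => ?_) hy
      · rw [(mem_weightSpace_iff_deformedChar φ).1 hm H, map_smul, smul_eq_mul]
        by_cases hν : ν = μ
        · rw [hν]
        · rw [hne ν hν m hm, mul_zero, mul_zero]
      · rw [deformedChar_of_mem_rootSpace φ μ (IsGrading.isNonZero_of_neg hn hα) hx, zero_mul]
        -- A negative root vector reaches weight μ only from a weight above μ, and E has none.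
        by_cases hν : ν + α.toLinear = μ
        · rw [hEb ν m hm (hν ▸ below_add_of_neg hn hα), smul_zero, map_zero]
        · exact hne _ hν _ (lieElt_smul_mem_weightSpace φ α hx hm)

/-- An extension of `Δ_T(lam)` by `∇_T(μ)` splits if `lam` is below `μ`. -/
lemma exists_retraction_of_below (hg : IsGrading 𝔟 h₀) (hE : ⨆ ν, weightSpace 𝔥 φ ν E = ⊤)
    (i : nabla 𝔟 φ μ ⟶ E) (p : E ⟶ verma 𝔟 φ lam) (hi : Function.Injective i.hom)
    (hip : ∀ m, p.hom m = 0 → ∃ n, i.hom n = m) (h : Below h₀ lam μ) :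
    ∃ r : E ⟶ nabla 𝔟 φ μ, i ≫ r = 𝟙 _ := by
  obtain ⟨ℓ, hℓi, hℓ⟩ := exists_form_of_below hg hE i p hi hip h
  obtain ⟨r, hr⟩ := exists_hom_nabla hE ℓ hℓ
  exact ⟨r, nabla_hom_ext fun ψ => (hr _).trans (hℓi ψ)⟩

/-- The first extension groups from Verma modules to nabla modules vanish. -/
lemma subsingleton_ext_verma_nabla (hg : IsGrading 𝔟 h₀) (hΔ : IsInO 𝔟 φ (verma 𝔟 φ lam))
    (hN : IsInO 𝔟 φ (nabla 𝔟 φ μ)) :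
    Subsingleton (Abelian.Ext (⟨_, hΔ⟩ : CatO 𝔟 φ) ⟨_, hN⟩ 1) := by
  refine Abelian.Ext.subsingleton_one_of_split _ _ fun E i p w hS => ?_
  have := hS.mono_f
  have := hS.epi_g
  have hi := CatO.injective_of_mono i
  have hp := CatO.surjective_of_epi p
  have hip : ∀ m, p.hom.hom m = 0 → ∃ n, i.hom.hom n = m := fun m =>
    CatO.exists_of_shortExact hS
  -- In the first case the splitting is found as a retraction onto ∇ and converted into a section;
  -- in the second the section is direct.
  by_cases h : Below h₀ lam μ
  · obtain ⟨r, hr⟩ := exists_retraction_of_below hg E.2.2 i.hom p.hom hi hip h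
    let σ := ShortComplex.Splitting.ofExactOfRetraction _ hS.exact (ObjectProperty.homMk r)
      (ObjectProperty.hom_ext _ hr) hS.epi_g
    exact ⟨σ.s, σ.s_g⟩
  · obtain ⟨s, hs⟩ := exists_section_of_not_below hg E.2.2 i.hom p.hom hi hp hip h
    exact ⟨ObjectProperty.homMk s, ObjectProperty.hom_ext _ hs⟩

end ShortExact

end DeformedO

/-! ### The theorem -/

theorem mainTheorem9 {𝔤 : Type u} [LieRing 𝔤] [LieAlgebra ℂ 𝔤] [FiniteDimensional ℂ 𝔤]
    [LieAlgebra.IsSemisimple ℂ 𝔤]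
    (𝔥 : LieSubalgebra ℂ 𝔤) [𝔥.IsCartanSubalgebra]
    (𝔟 : LieSubalgebra ℂ 𝔤) (h𝔟 : 𝔟.IsBorel) (h𝔥𝔟 : 𝔥 ≤ 𝔟)
    {T : Type v} [CommRing T] [Algebra ℂ T] (φ : SymmetricAlgebra ℂ 𝔥 →ₐ[ℂ] T) :
    ∃ (hΔ : ∀ lam : Module.Dual ℂ 𝔥, DeformedO.IsInO 𝔟 φ (DeformedO.verma 𝔟 φ lam))
      (hN : ∀ lam : Module.Dual ℂ 𝔥, DeformedO.IsInO 𝔟 φ (DeformedO.nabla 𝔟 φ lam)),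
      let Δ : Module.Dual ℂ 𝔥 → DeformedO.CatO 𝔟 φ := fun lam => ⟨_, hΔ lam⟩
      let N : Module.Dual ℂ 𝔥 → DeformedO.CatO 𝔟 φ := fun lam => ⟨_, hN lam⟩
      (∀ lam : Module.Dual ℂ 𝔥,
        ∃ (c : T ≃ₗ[T] DeformedO.weightSpace 𝔥 φ lam (DeformedO.verma 𝔟 φ lam))
          (d : DeformedO.weightSpace 𝔥 φ lam (DeformedO.nabla 𝔟 φ lam) ≃ₗ[T] T)
          (e : (Δ lam ⟶ N lam) ≃ₗ[T] T),
          (∀ t, (c t : DeformedO.verma 𝔟 φ lam) = DeformedO.vermaMk 𝔟 φ lam t) ∧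
          (∀ ψ, d ψ = DeformedO.nablaEval 𝔟 φ lam ψ) ∧
          ∀ (f : Δ lam ⟶ N lam) (t : T),
            d (DeformedO.restrictWeight φ lam f.hom (c t)) = e f * t) ∧
      (∀ lam μ : Module.Dual ℂ 𝔥, lam ≠ μ → ∀ f : Δ lam ⟶ N μ, f = 0) ∧
      (∀ lam μ : Module.Dual ℂ 𝔥, Subsingleton (Abelian.Ext (Δ lam) (N μ) 1)) := by
  have hg := h𝔟.isGrading h𝔥𝔟
  have hΔ := fun lam => DeformedO.isInO_verma φ lam hg
  have hN := fun lam => DeformedO.isInO_nabla φ lam hg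
  refine ⟨hΔ, hN, fun lam => ?_, fun lam μ h f => ObjectProperty.hom_ext _
    (DeformedO.verma_hom_nabla_eq_zero hg h f.hom),
    fun lam μ => DeformedO.subsingleton_ext_verma_nabla hg (hΔ lam) (hN μ)⟩
  obtain ⟨c, hc⟩ := DeformedO.exists_vermaEquiv φ lam hg
  obtain ⟨d, hd⟩ := DeformedO.exists_nablaEquiv φ lam hg
  obtain ⟨e, he⟩ := DeformedO.exists_homEquiv φ lam hg (hΔ lam) (hN lam)
  refine ⟨c, d, e, hc, hd, fun f t => ?_⟩
  rw [hd, he]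
  change DeformedO.nablaAt 𝔟 φ lam 1 (f.hom.hom (c t : DeformedO.verma 𝔟 φ lam)) = _
  rw [hc, ← DeformedO.smul_vermaMk, DeformedO.hom_smul, map_smul, smul_eq_mul, mul_comm]
  rfl
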